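/- Let $M,N$ be integers with $1\le M<N$ and $M\mid N$. A base station with $N$ antennas serves users with $M$ antennas each. User $k$ has the channel $\mathbf H_k=\mathbf R_{R,k}^{1/2}\widetilde{\mathbf H}_k\in\mathbb C^{M\times N}$, where $\mathbf R_{R,k}$ is Hermitian positive definite and all entries of all $\widetilde{\mathbf H}_k$ are independent $\mathcal{CN}(0,1)$ variables. A random set $\mathcal S$ of exactly $N/M$ users is scheduled, independently of the channels and of the codebooks below. Each user has its own codebook of $2^B$ random codewords $\mathbf U\in\mathbb C^{N\times M}$ with $\mathbf U^H\mathbf U=\mathbf I_M$ and with isotropically (uniformly) distributed column space; all codewords of all users are independent, and they are independent of the channels. For $\mathbf B\in\mathbb C^{M\times N}$ of full row rank let $\delta(\mathbf B,\mathbf U)=\sqrt{M-\operatorname{tr}(\mathbf Q^H\mathbf U\mathbf U^H\mathbf Q)}$, where the columns of $\mathbf Q\in\mathbb C^{N\times M}$ are an orthonormal basis of the span of the columns of $\mathbf B^H$, and let $\bar{\mathbf H}_k$ be a codeword $\mathbf U$ of user $k$'s codebook that minimizes $\delta(\mathbf H_k,\mathbf U)$. For $k\in\mathcal S$ let $\mathbf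 W_k,\bar{\mathbf W}_k\in\mathbb C^{N\times M}$ satisfy $\mathbf W_k^H\mathbf W_k=\bar{\mathbf W}_k^H\bar{\mathbf W}_k=\mathbf I_M$ and $\mathbf H_\ell\mathbf W_k=\mathbf 0$, $\bar{\mathbf H}_\ell^H\bar{\mathbf W}_k=\mathbf 0$ for all $\ell\in\mathcal S\setminus\{k\}$ (block-diagonalization with perfect and with quantized channel knowledge). With total power $P\ge 0$ and equal power allocation $\frac{P}{M|\mathcal S|}=\frac PN$ per stream, the rates of user $k$ are $$g_k=\log_2\det\Big(\mathbf I_M+\tfrac PN\mathbf H_k\mathbf W_k\mathbf W_k^H\mathbf H_k^H\Big),\qquad g_k^{Q}=\log_2\frac{\det\big(\mathbf I_M+\frac PN\sum_{\ell\in\mathcal S}\mathbf H_k\bar{\mathbf W}_\ell\bar{\mathbf W}_\ell^H\mathbf H_k^H\big)}{\det\big(\mathbf I_M+\frac PN\sum_{\ell\in\mathcal S\setminus\{k\}}\mathbf H_k\bar{\mathbf W}_\ell\bar{\mathbf W}_\ell^H\mathbf H_k^H\big)}.$$ Then the average quantization distortion $D^{\mathrm{BD}}_B=\mathbb E\{\delta^2(\mathbf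 H_k,\bar{\mathbf H}_k)\}$ depends only on $M,N,B$. For every user $k$ that is scheduled with positive probability, the rates $g_k$ and $g_k^Q$ have finite conditional expectations given $k\in\mathcal S$, and $$\mathbb E\{g_k-g_k^{Q}\mid k\in\mathcal S\}\le\log_2\det\Big(\mathbf I_M+\frac PM D^{\mathrm{BD}}_B\,\mathbf R_{R,k}\Big).$$ Moreover, as $B\to\infty$ with $M,N$ fixed, $D^{\mathrm{BD}}_B$ is asymptotically equivalent (the ratio tends to $1$) to $$\frac{\Gamma\left(\frac1{M(N-M)}\right)}{M(N-M)}\left(\frac{2^B}{(M(N-M))!}\prod_{i=1}^M\frac{(N-i)!}{(M-i)!}\right)^{-\frac1{M(N-M)}}.$$ -/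

import Mathlib

open MeasureTheory ProbabilityTheory Matrix Filter Asymptotics
open scoped ComplexOrder

/-- Matrices carry the product sigma-algebra of their entries. -/
instance Matrix.instMeasurableSpaceEntries {m n α : Type*} [MeasurableSpace α] :
    MeasurableSpace (Matrix m n α) :=
  inferInstanceAs (MeasurableSpace (m → n → α))

namespace BlockDiag

/-- The circularly-symmetric complex Gaussian law `CN(0,1)`: independent real and imaginary
parts, each real Gaussian with mean `0` and variance `1/2`. -/
noncomputable def complexNormal : Measure ℂ :=
  ((gaussianReal 0 (1 / 2)).prod (gaussianReal 0 (1 / 2))).map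
    Complex.measurableEquivRealProd.symm

/-- The orthogonal projection onto the row space of a channel matrix `H : M × N` of full row
rank, as a subspace of `ℂ^N` (the span of the columns of `Hᴴ`). -/
noncomputable def rowProj {M N : ℕ} (H : Matrix (Fin M) (Fin N) ℂ) :
    Matrix (Fin N) (Fin N) ℂ :=
  Hᴴ * (H * Hᴴ)⁻¹ * H

/-- Chordal distance between the row space of a channel `H : M × N` of full row rank and the
column space of a semi-unitary codeword `U : N × M`. It equals `√(M - tr(Qᴴ U Uᴴ Q))` for every
orthonormal basis `Q` of the row space, see `chordalDist_eq`. -/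
noncomputable def chordalDist {M N : ℕ} (H : Matrix (Fin M) (Fin N) ℂ)
    (U : Matrix (Fin N) (Fin M) ℂ) : ℝ :=
  Real.sqrt ((M : ℝ) - (rowProj H * (U * Uᴴ)).trace.re)

theorem rowProj_eq {M N : ℕ} (H : Matrix (Fin M) (Fin N) ℂ) (Q : Matrix (Fin N) (Fin M) ℂ)
    (hQ : Qᴴ * Q = 1)
    (hspan : LinearMap.range Q.mulVecLin = LinearMap.range Hᴴ.mulVecLin) :
    rowProj H = Q * Qᴴ := by
  have key : ∀ X Y : Matrix (Fin N) (Fin M) ℂ,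
      LinearMap.range X.mulVecLin ≤ LinearMap.range Y.mulVecLin →
        ∃ T : Matrix (Fin M) (Fin M) ℂ, X = Y * T := by
    intro X Y h
    have h1 : ∀ j, ∃ v : Fin M → ℂ, Y *ᵥ v = X.col j := by
      intro j
      have : X.col j ∈ LinearMap.range Y.mulVecLin :=
        h ⟨Pi.single j 1, by simp⟩
      obtain ⟨v, hv⟩ := this
      exact ⟨v, by simpa using hv⟩
    choose v hv using h1
    refine ⟨Matrix.of fun i j => v j i, ?_⟩
    ext i j
    have := congrFun (hv j) i
    simpa [Matrix.mul_apply, Matrix.mulVec, dotProduct] using this.symm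
  obtain ⟨T, hT⟩ := key Hᴴ Q hspan.ge
  obtain ⟨S, hS⟩ := key Q Hᴴ hspan.le
  have hTS : T * S = 1 := by
    calc T * S = Qᴴ * Q * (T * S) := by rw [hQ, Matrix.one_mul]
      _ = Qᴴ * (Q * T * S) := by simp only [Matrix.mul_assoc]
      _ = 1 := by rw [← hT, ← hS, hQ]
  have hST : S * T = 1 := mul_eq_one_comm.mp hTS
  have hH : H = Tᴴ * Qᴴ := by
    rw [← Matrix.conjTranspose_mul, ← hT, Matrix.conjTranspose_conjTranspose]
  have hHH : H * Hᴴ = Tᴴ * T := by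
    rw [hT, hH, Matrix.mul_assoc, ← Matrix.mul_assoc Qᴴ, hQ, Matrix.one_mul]
  have hinv : (H * Hᴴ)⁻¹ = S * Sᴴ := by
    apply Matrix.inv_eq_right_inv
    rw [hHH, Matrix.mul_assoc, ← Matrix.mul_assoc T, hTS, Matrix.one_mul,
      ← Matrix.conjTranspose_mul, hST, Matrix.conjTranspose_one]
  have hST' : Sᴴ * Tᴴ = 1 := by
    rw [← Matrix.conjTranspose_mul, hTS, Matrix.conjTranspose_one]
  rw [rowProj, hinv, hT, hH]
  calc Q * T * (S * Sᴴ) * (Tᴴ * Qᴴ) = Q * (T * S) * (Sᴴ * Tᴴ) * Qᴴ := by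
        simp only [Matrix.mul_assoc]
    _ = Q * Qᴴ := by rw [hTS, hST', Matrix.mul_one, Matrix.mul_one]

theorem chordalDist_eq {M N : ℕ} (H : Matrix (Fin M) (Fin N) ℂ) (U Q : Matrix (Fin N) (Fin M) ℂ)
    (hQ : Qᴴ * Q = 1)
    (hspan : LinearMap.range Q.mulVecLin = LinearMap.range Hᴴ.mulVecLin) :
    chordalDist H U = Real.sqrt ((M : ℝ) - (Qᴴ * U * Uᴴ * Q).trace.re) := by
  rw [chordalDist, rowProj_eq H Q hQ hspan, Matrix.mul_assoc Q, Matrix.trace_mul_comm Q]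
  simp only [Matrix.mul_assoc]

/-- A probability law on `N × M` matrices under which the matrix is almost surely semi-unitary
and its column space is uniformly (isotropically) distributed on the complex Grassmannian of
`M`-dimensional subspaces of `ℂ^N`: the law of that subspace, encoded by its orthogonal
projection `U Uᴴ`, is invariant under every unitary rotation of `ℂ^N`. The choice of orthonormal
basis within the subspace is left free. -/
def IsIsotropicCodeword {M N : ℕ} (ν : Measure (Matrix (Fin N) (Fin M) ℂ)) : Prop :=
  IsProbabilityMeasure ν ∧ (∀ᵐ U ∂ν, Uᴴ * U = 1) ∧
    ∀ V ∈ Matrix.unitaryGroup (Fin N) ℂ,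
      ν.map (fun U => V * (U * Uᴴ) * Vᴴ) = ν.map (fun U => U * Uᴴ)

/-- `W` is a family of block-diagonalization precoders for the channels `H` and the scheduling
set `S`: each `W k` is semi-unitary and causes no interference at the other scheduled users. -/
def IsBDPrecoder {K M N : ℕ} (H : Fin K → Matrix (Fin M) (Fin N) ℂ) (S : Finset (Fin K))
    (W : Fin K → Matrix (Fin N) (Fin M) ℂ) : Prop :=
  ∀ k ∈ S, (W k)ᴴ * W k = 1 ∧ ∀ l ∈ S \ {k}, H l * W k = 0

/-- Equal power allocation: total power `P` split over the `M` streams of all users in `S`. -/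
noncomputable def equalPower {K : ℕ} (M : ℕ) (P : ℝ) (S : Finset (Fin K)) :
    Matrix (Fin M) (Fin M) ℂ :=
  ((P / ((M : ℝ) * (S.card : ℝ)) : ℝ) : ℂ) • 1

/-- Information rate of user `k` under block-diagonalization with perfect channel knowledge. -/
noncomputable def rateBD {K M N : ℕ} (P : ℝ) (H : Fin K → Matrix (Fin M) (Fin N) ℂ)
    (S : Finset (Fin K)) (W : Fin K → Matrix (Fin N) (Fin M) ℂ) (k : Fin K) : ℝ :=
  Real.logb 2 (1 + H k * W k * equalPower M P S * (W k)ᴴ * (H k)ᴴ).det.re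

/-- Information rate of user `k` when the precoders `W` are computed from quantized channels, so
that the interference from the other scheduled users need not vanish. -/
noncomputable def rateBDQ {K M N : ℕ} (P : ℝ) (H : Fin K → Matrix (Fin M) (Fin N) ℂ)
    (S : Finset (Fin K)) (W : Fin K → Matrix (Fin N) (Fin M) ℂ) (k : Fin K) : ℝ :=
  Real.logb 2
    ((1 + ∑ l ∈ S, H k * W l * equalPower M P S * (W l)ᴴ * (H k)ᴴ).det.re /
      (1 + ∑ l ∈ S \ {k}, H k * W l * equalPower M P S * (W l)ᴴ * (H k)ᴴ).det.re)

/-- A downlink with `N` transmit antennas and `K` users with `M` antennas each, receive-side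
correlated Rayleigh fading, `N / M` users scheduled independently of the channels and codebooks,
and feedback of the channel row spaces by random vector quantization with `B` bits per user. -/
structure BDSystem (M N K B : ℕ) {Ω : Type*} [MeasurableSpace Ω] (μ : Measure Ω) where
  /-- receive-side correlation matrices -/
  R : Fin K → Matrix (Fin M) (Fin M) ℂ
  R_posDef : ∀ k, (R k).PosDef
  /-- square roots of the correlation matrices (the Hermitian root or any other one) -/
  Rsqrt : Fin K → Matrix (Fin M) (Fin M) ℂ
  Rsqrt_mul : ∀ k, Rsqrt k * (Rsqrt k)ᴴ = R k
  /-- uncorrelated channels, all of whose entries are independent and `CN(0,1)` -/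
  Hw : Fin K → Ω → Matrix (Fin M) (Fin N) ℂ
  Hw_law : ∀ k i j, HasLaw (fun ω => Hw k ω i j) complexNormal μ
  Hw_meas : ∀ k, Measurable (Hw k)
  Hw_indep : iIndepFun (fun (p : Fin K × Fin M × Fin N) ω => Hw p.1 ω p.2.1 p.2.2) μ
  /-- the random codebooks, one for each user, with independent isotropic codewords -/
  U : Fin K → Fin (2 ^ B) → Ω → Matrix (Fin N) (Fin M) ℂ
  U_meas : ∀ k i, Measurable (U k i)
  U_law : ∀ k i, IsIsotropicCodeword (μ.map (U k i))
  U_indep : iIndepFun (fun (p : Fin K × Fin (2 ^ B)) => U p.1 p.2) μ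
  Hw_U_indep : IndepFun (fun ω k => Hw k ω) (fun ω k i => U k i ω) μ
  /-- the random scheduling set -/
  S : Ω → Finset (Fin K)
  S_meas : Measurable S
  S_card : ∀ ω, (S ω).card = N / M
  S_indep : IndepFun S (fun ω => ((fun k => Hw k ω), (fun k i => U k i ω))) μ
  /-- index of a codeword minimizing the chordal distance to the user's channel -/
  sel : Fin K → Ω → Fin (2 ^ B)
  sel_min : ∀ᵐ ω ∂μ, ∀ k i, chordalDist (Rsqrt k * Hw k ω) (U k (sel k ω) ω) ≤
    chordalDist (Rsqrt k * Hw k ω) (U k i ω)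
  /-- precoders under perfect channel knowledge -/
  W : Ω → Fin K → Matrix (Fin N) (Fin M) ℂ
  W_bd : ∀ᵐ ω ∂μ, IsBDPrecoder (fun k => Rsqrt k * Hw k ω) (S ω) (W ω)
  /-- precoders computed by treating the fed back codewords as the true channels -/
  Wq : Ω → Fin K → Matrix (Fin N) (Fin M) ℂ
  Wq_bd : ∀ᵐ ω ∂μ, IsBDPrecoder (fun k => (U k (sel k ω) ω)ᴴ) (S ω) (Wq ω)

namespace BDSystem

variable {M N K B : ℕ} {Ω : Type*} [MeasurableSpace Ω] {μ : Measure Ω}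

/-- The channel matrices. -/
def H (s : BDSystem M N K B μ) (ω : Ω) (k : Fin K) : Matrix (Fin M) (Fin N) ℂ :=
  s.Rsqrt k * s.Hw k ω

/-- The quantized channel (fed back codeword) of user `k`. -/
def Hbar (s : BDSystem M N K B μ) (ω : Ω) (k : Fin K) : Matrix (Fin N) (Fin M) ℂ :=
  s.U k (s.sel k ω) ω

/-- Rate of user `k` with perfect channel knowledge. -/
noncomputable def g (s : BDSystem M N K B μ) (P : ℝ) (k : Fin K) (ω : Ω) : ℝ :=
  rateBD P (s.H ω) (s.S ω) (s.W ω) k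

/-- Rate of user `k` with quantized channel knowledge. -/
noncomputable def gQ (s : BDSystem M N K B μ) (P : ℝ) (k : Fin K) (ω : Ω) : ℝ :=
  rateBDQ P (s.H ω) (s.S ω) (s.Wq ω) k

end BDSystem

/-- The closed-form approximation of the average quantization distortion. -/
noncomputable def distortionApprox (M N B : ℕ) : ℝ :=
  Real.Gamma (1 / ((M : ℝ) * ((N : ℝ) - M))) / ((M : ℝ) * ((N : ℝ) - M)) *
    ((2 : ℝ) ^ B / ((M * (N - M)).factorial : ℝ) *
        ∏ i ∈ Finset.Icc 1 M, ((N - i).factorial : ℝ) / ((M - i).factorial : ℝ)) ^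
      (-(1 / ((M : ℝ) * ((N : ℝ) - M))))

end BlockDiag

set_option linter.unusedSectionVars false

namespace BlockDiag

/-! All quantities are reduced to independent, uniformly distributed subspaces, encoded by their
orthogonal projections. The correlation root is invertible, so it does not change the row space of
the channel. A Gaussian matrix is unitarily invariant, and an invariant law on projections of given
rank is unique (`eq_of_conj_invariant`), so channel row spaces, codeword spaces and even selected
codeword spaces (`measurePreserving_psel`) all have the law `projLaw`.

Distortion. Given the channel, the `2 ^ B` squared distances are independent with a common
distribution function `F`, so the mean minimum is `∫ (1 - F) ^ 2 ^ B` (`integral_dist_psel`). Near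
zero `F z ~ c z ^ n` with `n = M (N - M)`. To see this, write the Gaussian matrix as `[A | A X]`
with `A` square. The row space depends only on `X`, and its squared distance to `[1 | 0]` is `‖X‖²`
to leading order. The Jacobian of the substitution is `|det A| ^ (2 (N - M))`, so `c` is the mean of
that power divided by `n!` (`lintegral_det_gaussMat`, `tendsto_distCDF`). Rescaling `z` by `(c 2 ^
B) ^ (-1 / n)` produces `∫ exp (-t ^ n) = Γ(1 + 1 / n)` (`tendsto_integral_one_sub_pow`).

Rate loss. `N / M` independent uniform subspaces almost surely span the space, so the
zero-interference conditions force `W Wᴴ` to be the projection `bdProj` onto the complement of the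
other users' subspaces. Drop the interference from the numerator of the quantized rate. What remains
there has the same mean as the perfect rate, because given the served channel both precoders are the
same function of independent uniform subspaces. The loss is thus at most the mean `log det` of the
interference covariance, and concavity moves the mean inside (`integral_log_det_interference_le`).

That mean covariance follows from symmetry. Given the quantized space `p` of user `k`, the mean of
another user's precoder projection is `M / (N - M) • (1 - p)`. The mean of `G (1 - p) Gᴴ` is `N D /
M` times the identity. Summing over the `N / M - 1` interferers and multiplying by `P / N` leaves `P
D / M`. Scheduling is independent of everything else, so the estimate is averaged over the values of
the scheduled set. -/

/-! ### Complex Gaussian vectors: density, null sets, invariance. -/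

theorem complexNormal_eq_withDensity :
    complexNormal = (volume : Measure ℂ).withDensity
      (fun z => ENNReal.ofReal (Real.pi⁻¹ * Real.exp (-‖z‖ ^ 2))) := by
  have hv : ((1 / 2 : NNReal)) ≠ 0 := by norm_num
  have hmp : MeasurePreserving Complex.measurableEquivRealProd.symm
      (volume : Measure (ℝ × ℝ)) (volume : Measure ℂ) :=
    Complex.volume_preserving_equiv_real_prod.symm
  rw [complexNormal, gaussianReal_of_var_ne_zero _ hv,
    prod_withDensity (measurable_gaussianPDF _ _) (measurable_gaussianPDF _ _),
    ← Measure.volume_eq_prod]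
  ext s hs
  rw [Measure.map_apply (MeasurableEquiv.measurable _) hs, withDensity_apply _ hs,
    withDensity_apply _ (MeasurableEquiv.measurable _ hs), ← hmp.setLIntegral_comp_preimage_emb
      (MeasurableEquiv.measurableEmbedding _)]
  refine lintegral_congr fun p => ?_
  have h2 : ‖Complex.measurableEquivRealProd.symm p‖ ^ 2 = p.1 ^ 2 + p.2 ^ 2 := by
    rw [← Complex.normSq_eq_norm_sq, Complex.normSq_apply]
    simp [Complex.measurableEquivRealProd]
    ring
  rw [h2, gaussianPDF, gaussianPDF, ← ENNReal.ofReal_mul (gaussianPDFReal_nonneg _ _ _)]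
  congr 1
  simp only [gaussianPDFReal]
  have : (2 * Real.pi * ((1 / 2 : NNReal) : ℝ)) = Real.pi := by push_cast; ring
  rw [this, mul_mul_mul_comm, ← Real.exp_add, ← mul_inv, Real.mul_self_sqrt Real.pi_pos.le]
  congr 2
  push_cast
  ring

instance : IsProbabilityMeasure complexNormal := by
  unfold complexNormal
  exact Measure.isProbabilityMeasure_map (MeasurableEquiv.measurable _).aemeasurable

/-- The law of a vector of independent `CN(0,1)` variables. -/
noncomputable def gauss (ι : Type*) [Fintype ι] : Measure (ι → ℂ) :=
  Measure.pi fun _ => complexNormal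

instance (ι : Type*) [Fintype ι] : IsProbabilityMeasure (gauss ι) := by
  unfold gauss; infer_instance

theorem gauss_eq_withDensity (ι : Type*) [Fintype ι] :
    gauss ι = (volume : Measure (ι → ℂ)).withDensity
      (fun x => ENNReal.ofReal (Real.pi⁻¹ ^ Fintype.card ι * Real.exp (-∑ i, ‖x i‖ ^ 2))) := by
  have hint : Integrable (fun z : ℂ => Real.pi⁻¹ * Real.exp (-‖z‖ ^ 2)) := by
    refine ⟨by fun_prop, ?_⟩
    rw [hasFiniteIntegral_iff_ofReal (ae_of_all _ fun z => by positivity)]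
    have : (volume : Measure ℂ).withDensity
      (fun z => ENNReal.ofReal (Real.pi⁻¹ * Real.exp (-‖z‖ ^ 2))) Set.univ = 1 := by
      rw [← complexNormal_eq_withDensity]; exact measure_univ
    rw [withDensity_apply _ MeasurableSet.univ, Measure.restrict_univ] at this
    rw [this]; exact ENNReal.one_lt_top
  refine Measure.pi_eq fun s hs => ?_
  rw [withDensity_apply _ (MeasurableSet.univ_pi hs), volume_pi, Measure.restrict_pi_pi]
  have hprod : ∀ x : ι → ℂ, Real.pi⁻¹ ^ Fintype.card ι * Real.exp (-∑ i, ‖x i‖ ^ 2) =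
      ∏ i, (Real.pi⁻¹ * Real.exp (-‖x i‖ ^ 2)) := fun x => by
    rw [Finset.prod_mul_distrib, ← Real.exp_sum, Finset.sum_neg_distrib]; simp
  simp_rw [hprod]
  rw [← ofReal_integral_eq_lintegral_ofReal
      (Integrable.fintype_prod (f := fun _ z => Real.pi⁻¹ * Real.exp (-‖z‖ ^ 2))
        fun i => hint.integrableOn)
      (ae_of_all _ fun x => Finset.prod_nonneg fun i _ => by positivity),
    integral_fintype_prod_eq_prod (fun _ z => Real.pi⁻¹ * Real.exp (-‖z‖ ^ 2)),
    ENNReal.ofReal_prod_of_nonneg fun i _ => integral_nonneg fun z => by positivity]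
  refine Finset.prod_congr rfl fun i _ => ?_
  rw [complexNormal_eq_withDensity, withDensity_apply _ (hs i),
    ofReal_integral_eq_lintegral_ofReal hint.integrableOn (ae_of_all _ fun x => by positivity)]

theorem gauss_absolutelyContinuous (ι : Type*) [Fintype ι] :
    gauss ι ≪ (volume : Measure (ι → ℂ)) := by
  rw [gauss_eq_withDensity]; exact withDensity_absolutelyContinuous _ _

/-- The zero set of a real-analytic function that is not identically zero is a null set. -/
theorem addHaar_zeros_of_analytic {E : Type*} [NormedAddCommGroup E] [NormedSpace ℝ E]
    [FiniteDimensional ℝ E] [MeasurableSpace E] [BorelSpace E] (μ : Measure E)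
    [μ.IsAddHaarMeasure] (f : E → ℂ) (hf : AnalyticOnNhd ℝ f Set.univ) (x₀ : E)
    (hx₀ : f x₀ ≠ 0) : μ {x | f x = 0} = 0 := by
  have hc : Continuous f := continuousOn_univ.mp hf.continuousOn
  have hclosed : MeasurableSet {x | f x = 0} := (isClosed_eq hc continuous_const).measurableSet
  have hmeas : MeasurableSet {p : ℝ × E | f (x₀ + p.1 • p.2) = 0} :=
    (isClosed_eq (by fun_prop) continuous_const).measurableSet
  -- On each line through `x₀` the restriction is a one-variable analytic function that is nonzero
  -- at `0`, so its zeros are discrete, hence countable. Fubini then yields one `t ≠ 0` whose slice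
  -- is null, and that slice is an affine image of the zero set.
  have hnull : ((volume : Measure ℝ).prod μ) {p : ℝ × E | f (x₀ + p.1 • p.2) = 0} = 0 := by
    rw [Measure.prod_apply_symm hmeas]
    refine (lintegral_congr fun x => ?_).trans lintegral_zero
    have han : AnalyticOnNhd ℝ (fun t : ℝ => f (x₀ + t • x)) Set.univ :=
      hf.comp (fun t _ => by fun_prop) (fun t _ => Set.mem_univ _)
    have h0 := mem_codiscrete'.mp (han.preimage_zero_mem_codiscrete (x := 0) (by simpa using hx₀))
    have hd : IsDiscrete {t : ℝ | f (x₀ + t • x) = 0} := by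
      have := h0.2
      rwa [← Set.preimage_compl, compl_compl] at this
    exact ((HereditarilyLindelofSpace.isLindelof _).countable_of_isDiscrete hd).measure_zero _
  have h2 := (Measure.measure_prod_null hmeas).mp hnull
  obtain ⟨t, ht, ht0⟩ : ∃ t : ℝ, μ (Prod.mk t ⁻¹' {p : ℝ × E | f (x₀ + p.1 • p.2) = 0}) = 0 ∧ t ≠ 0 := by
    have h3 : ∀ᵐ t : ℝ, t ≠ 0 := by simp [ae_iff]
    obtain ⟨t, ht⟩ := (h2.and h3).exists
    exact ⟨t, ht.1, ht.2⟩
  have h4 : Prod.mk t ⁻¹' {p : ℝ × E | f (x₀ + p.1 • p.2) = 0} =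
      (fun x => t • x) ⁻¹' ((fun x => x₀ + x) ⁻¹' {x | f x = 0}) := rfl
  rw [h4, Measure.addHaar_preimage_smul _ ht0, measure_preimage_add] at ht
  simpa [ht0] using ht

theorem gauss_zeros_of_analytic {ι : Type*} [Fintype ι] (f : (ι → ℂ) → ℂ)
    (hf : AnalyticOnNhd ℝ f Set.univ) (x₀ : ι → ℂ) (hx₀ : f x₀ ≠ 0) :
    ∀ᵐ x ∂(gauss ι), f x ≠ 0 := by
  refine (gauss_absolutelyContinuous ι).ae_le ?_
  have h := addHaar_zeros_of_analytic volume f hf x₀ hx₀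
  exact measure_eq_zero_iff_ae_notMem.mp h

/-- The law `gauss` is invariant under norm-preserving linear maps. -/
theorem measurePreserving_gauss {ι : Type*} [Fintype ι] (L : (ι → ℂ) →ₗ[ℝ] (ι → ℂ))
    (hL : ∀ x, ∑ i, ‖L x i‖ ^ 2 = ∑ i, ‖x i‖ ^ 2) : MeasurePreserving L (gauss ι) (gauss ι) := by
  have hcont : Continuous L := L.continuous_of_finiteDimensional
  have hinj : Function.Injective L := by
    rw [← LinearMap.ker_eq_bot, LinearMap.ker_eq_bot']
    intro x hx
    have h := hL x
    rw [hx] at h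
    simp only [Pi.zero_apply, norm_zero, ne_eq, OfNat.ofNat_ne_zero, not_false_eq_true, zero_pow,
      Finset.sum_const_zero] at h
    ext i
    have := (Finset.sum_eq_zero_iff_of_nonneg (fun i _ => by positivity)).mp h.symm i
      (Finset.mem_univ i)
    simpa using this
  have hdet : LinearMap.det L ≠ 0 := by
    have := (LinearMap.isUnit_iff_ker_eq_bot L).mpr (LinearMap.ker_eq_bot.mpr hinj)
    exact (LinearMap.isUnit_det L this).ne_zero
  -- A linear map scales Lebesgue measure by a constant. The Euclidean ball `B` is its own preimage
  -- and has finite nonzero volume, so the constant is one. The ball is written out because the norm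
  -- on `ι → ℂ` is the supremum norm.
  have hvol : Measure.map L (volume : Measure (ι → ℂ)) = volume := by
    have h := Measure.map_linearMap_addHaar_eq_smul_addHaar (volume : Measure (ι → ℂ)) hdet
    set c := ENNReal.ofReal |(LinearMap.det L)⁻¹|
    let B : Set (ι → ℂ) := {x | ∑ i, ‖x i‖ ^ 2 ≤ 1}
    have hB : IsClosed B := isClosed_le (by fun_prop) continuous_const
    have hpre : L ⁻¹' B = B := by ext x; simp [B, hL]
    have hfin : volume B ≠ ⊤ := by
      refine (Metric.isCompact_of_isClosed_isBounded hB
        ((Metric.isBounded_closedBall (x := 0) (r := 1)).subset fun x hx => ?_)).measure_lt_top.ne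
      rw [mem_closedBall_zero_iff, pi_norm_le_iff_of_nonneg zero_le_one]
      intro i
      have h1 : ‖x i‖ ^ 2 ≤ 1 := (Finset.single_le_sum (f := fun i => ‖x i‖ ^ 2)
        (fun i _ => by positivity) (Finset.mem_univ i)).trans hx
      exact (sq_le_one_iff₀ (norm_nonneg _)).mp h1
    have hpos : volume B ≠ 0 := by
      have ho : IsOpen {x : ι → ℂ | ∑ i, ‖x i‖ ^ 2 < 1} :=
        isOpen_lt (by fun_prop) continuous_const
      exact ((ho.measure_pos volume ⟨0, by simp⟩).trans_le
        (measure_mono fun x hx => le_of_lt (Set.mem_ofPred.mp hx))).ne'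
    have h1 := congrArg (fun m => m B) h
    simp only [Measure.smul_apply, smul_eq_mul] at h1
    rw [Measure.map_apply hcont.measurable hB.measurableSet, hpre] at h1
    have hc : c = 1 := by
      have h2 : 1 * volume B = c * volume B := by rw [one_mul]; exact h1
      exact ((ENNReal.mul_left_inj hpos hfin).mp h2).symm
    rw [h, hc, one_smul]
  refine ⟨hcont.measurable, ?_⟩
  ext s hs
  rw [Measure.map_apply hcont.measurable hs, gauss_eq_withDensity,
    withDensity_apply _ (hcont.measurable hs), withDensity_apply _ hs]
  conv_rhs => rw [← hvol]
  rw [setLIntegral_map hs (by fun_prop) hcont.measurable]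
  simp_rw [hL]

theorem measurePreserving_gauss_comp {ι κ : Type*} [Fintype ι] [Fintype κ] {f : ι → κ}
    (hf : Function.Injective f) :
    MeasurePreserving (fun (x : κ → ℂ) i => x (f i)) (gauss κ) (gauss ι) := by
  refine ⟨by fun_prop, ?_⟩
  have h1 : iIndepFun (fun (k : κ) (x : κ → ℂ) => x k) (gauss κ) :=
    iIndepFun_pi (X := fun _ => id) fun _ => aemeasurable_id
  have h2 := (h1.precomp hf).map_fun_eq_pi_map
    (fun i => (measurable_pi_apply (f i)).aemeasurable)
  refine h2.trans ?_
  unfold gauss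
  congr 1
  funext i
  exact (measurePreserving_eval (fun _ : κ => complexNormal) (f i)).map_eq

/-! ### Moments of Gaussian sums of squares. -/

theorem lintegral_enorm_pow_complexNormal (r : ℕ) :
    ∫⁻ z, (‖z‖ₑ ^ 2) ^ r ∂complexNormal = (r.factorial : ENNReal) := by
  have h := Complex.integral_rpow_mul_exp_neg_rpow (p := 2) (q := 2 * r) (by norm_num)
    (by have : (0:ℝ) ≤ r := r.cast_nonneg
        linarith)
  have hexp : (2 * (r : ℝ) + 2) / 2 = r + 1 := by ring
  rw [hexp, Real.Gamma_nat_eq_factorial] at h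
  have hfun : ∀ z : ℂ, ‖z‖ ^ (2 * (r : ℝ)) * Real.exp (-‖z‖ ^ (2 : ℝ)) =
      (‖z‖ ^ 2) ^ r * Real.exp (-‖z‖ ^ 2) := fun z => by
    rw [← pow_mul, ← Real.rpow_natCast, ← Real.rpow_natCast ‖z‖ 2]; push_cast; rfl
  simp_rw [hfun] at h
  have hint : Integrable (fun z : ℂ => (‖z‖ ^ 2) ^ r * Real.exp (-‖z‖ ^ 2)) := by
    refine Integrable.of_integral_ne_zero ?_
    rw [h]; positivity
  rw [complexNormal_eq_withDensity, lintegral_withDensity_eq_lintegral_mul _ (by fun_prop)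
    (by fun_prop)]
  have h2 : ∀ z : ℂ, ((fun z : ℂ => ENNReal.ofReal (Real.pi⁻¹ * Real.exp (-‖z‖ ^ 2))) *
      (fun z : ℂ => (‖z‖ₑ ^ 2) ^ r)) z =
      ENNReal.ofReal (Real.pi⁻¹ * ((‖z‖ ^ 2) ^ r * Real.exp (-‖z‖ ^ 2))) := fun z => by
    rw [Pi.mul_apply, ← ofReal_norm, ← ENNReal.ofReal_pow (norm_nonneg _),
      ← ENNReal.ofReal_pow (by positivity), ← ENNReal.ofReal_mul (by positivity)]
    congr 1; ring
  simp_rw [h2]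
  rw [← ofReal_integral_eq_lintegral_ofReal (hint.const_mul _)
    (ae_of_all _ fun z => by positivity), integral_const_mul, h]
  rw [← ENNReal.ofReal_natCast]
  congr 1
  field_simp

/-- Divided by `r!`, this is the hockey-stick identity for `Nat.multichoose`. It is the moment
identity for adding an exponential variable to a Gamma variable. -/
theorem ascFactorial_succ_eq_sum (n r : ℕ) :
    (n + 1).ascFactorial r =
      ∑ j ∈ Finset.range (r + 1), j.factorial * n.ascFactorial (r - j) * r.choose j := by
  have h : ∀ m k : ℕ, m.ascFactorial k = k.factorial * m.multichoose k := fun m k => by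
    cases m with
    | zero => cases k <;> simp [Nat.ascFactorial_eq_prod_range, Finset.prod_range_succ']
    | succ m =>
      rw [Nat.ascFactorial_eq_factorial_mul_choose, Nat.multichoose_eq]
      congr 2
      omega
  have hm : (n + 1).multichoose r = (r + n).choose n := by
    rw [Nat.multichoose_eq, add_right_comm, Nat.add_sub_cancel, add_comm,
      Nat.choose_symm_of_eq_add rfl]
  rw [h, hm, ← Nat.sum_range_multichoose, Finset.mul_sum, ← Finset.sum_range_reflect]
  refine Finset.sum_congr rfl fun j hj => ?_
  have hj' : j ≤ r := Nat.lt_succ_iff.mp (Finset.mem_range.mp hj)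
  rw [h, ← Nat.choose_mul_factorial_mul_factorial hj']
  simp only [Nat.add_sub_cancel]
  ring

/-- The sum of squares is Gamma distributed with shape `n`. One coordinate is split off, the power
is expanded binomially, and `ascFactorial_succ_eq_sum` reassembles the moments. -/
theorem lintegral_sum_enorm_pow_gauss_fin (n r : ℕ) :
    ∫⁻ x, (∑ i, ‖x i‖ₑ ^ 2) ^ r ∂(gauss (Fin n)) = (n.ascFactorial r : ENNReal) := by
  induction n generalizing r with
  | zero => cases r <;> simp [Nat.ascFactorial_eq_prod_range, Finset.prod_range_succ']
  | succ n ih =>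
    have hmp := (measurePreserving_piFinSuccAbove (fun _ : Fin (n + 1) => complexNormal) 0).symm
    rw [gauss, ← hmp.lintegral_comp (by fun_prop)]
    have hx : ∀ p : ℂ × (Fin n → ℂ), (∑ i, ‖(MeasurableEquiv.piFinSuccAbove
        (fun _ : Fin (n + 1) => ℂ) 0).symm p i‖ₑ ^ 2) ^ r =
        ∑ j ∈ Finset.range (r + 1), (‖p.1‖ₑ ^ 2) ^ j * (∑ i, ‖p.2 i‖ₑ ^ 2) ^ (r - j) *
          (r.choose j : ENNReal) := fun p => by
      rw [Fin.sum_univ_succ, ← add_pow]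
      rfl
    simp_rw [hx]
    rw [lintegral_finsetSum _ (fun j _ => by fun_prop), ascFactorial_succ_eq_sum]
    push_cast
    refine Finset.sum_congr rfl fun j _ => ?_
    rw [lintegral_mul_const _ (by fun_prop)]
    congr 1
    rw [lintegral_prod_mul (f := fun z : ℂ => (‖z‖ₑ ^ 2) ^ j)
      (g := fun x : Fin n → ℂ => (∑ i, ‖x i‖ₑ ^ 2) ^ (r - j)) (by fun_prop)
      (Measurable.aemeasurable (by fun_prop)), lintegral_enorm_pow_complexNormal]
    congr 1
    exact ih (r - j)

theorem lintegral_sum_enorm_pow_gauss (ι : Type*) [Fintype ι] (r : ℕ) :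
    ∫⁻ x, (∑ i, ‖x i‖ₑ ^ 2) ^ r ∂(gauss ι) = ((Fintype.card ι).ascFactorial r : ENNReal) := by
  rw [← lintegral_sum_enorm_pow_gauss_fin,
    ← (measurePreserving_gauss_comp (Fintype.equivFin ι).injective).lintegral_comp (by fun_prop)]
  refine lintegral_congr fun x => ?_
  rw [Fintype.sum_equiv (Fintype.equivFin ι) _ (fun i => ‖x i‖ₑ ^ 2) fun i => rfl]

/-! ### Positive matrices and concavity of `log det`. -/

section LinearAlgebra

variable {n : Type*} [Fintype n] [DecidableEq n]

theorem exists_spectral {A : Matrix n n ℂ} (hA : A.IsHermitian) :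
    ∃ V : Matrix n n ℂ, Vᴴ * V = 1 ∧ V * Vᴴ = 1 ∧
      A = V * diagonal (fun i => (hA.eigenvalues i : ℂ)) * Vᴴ := by
  refine ⟨hA.eigenvectorUnitary, ?_, ?_, ?_⟩
  · exact Unitary.coe_star_mul_self hA.eigenvectorUnitary
  · exact Unitary.coe_mul_star_self hA.eigenvectorUnitary
  · have h := hA.spectral_theorem
    rw [Unitary.conjStarAlgAut_apply] at h
    exact h

theorem exists_eq_mul_conjTranspose {A : Matrix n n ℂ} (hA : A.PosSemidef) :
    ∃ C : Matrix n n ℂ, A = C * Cᴴ := by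
  obtain ⟨V, -, -, h⟩ := exists_spectral hA.1
  refine ⟨V * diagonal (fun i => (Real.sqrt (hA.1.eigenvalues i) : ℂ)), ?_⟩
  rw [conjTranspose_mul, diagonal_conjTranspose, Matrix.mul_assoc, ← Matrix.mul_assoc (diagonal _),
    diagonal_mul_diagonal, ← Matrix.mul_assoc]
  have h2 : (fun i => (Real.sqrt (hA.1.eigenvalues i) : ℂ) *
      star (fun i => (Real.sqrt (hA.1.eigenvalues i) : ℂ)) i) =
      fun i => (hA.1.eigenvalues i : ℂ) := by
    funext i
    simp only [Pi.star_apply, RCLike.star_def, Complex.conj_ofReal]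
    rw [← Complex.ofReal_mul, Real.mul_self_sqrt (hA.eigenvalues_nonneg i)]
  rw [h2]
  exact h

theorem re_trace_nonneg {A : Matrix n n ℂ} (hA : A.PosSemidef) : 0 ≤ A.trace.re :=
  (Complex.le_def.mp hA.trace_nonneg).1

theorem re_trace_mul_nonneg {A B : Matrix n n ℂ} (hA : A.PosSemidef) (hB : B.PosSemidef) :
    0 ≤ (A * B).trace.re := by
  obtain ⟨C, rfl⟩ := exists_eq_mul_conjTranspose hA
  rw [Matrix.mul_assoc, trace_mul_comm, Matrix.mul_assoc, ← Matrix.mul_assoc]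
  exact re_trace_nonneg (hB.conjTranspose_mul_mul_same C)

theorem re_det_pos {A : Matrix n n ℂ} (hA : A.PosDef) : 0 < A.det.re :=
  (Complex.lt_def.mp hA.det_pos).1

theorem det_eq_re {A : Matrix n n ℂ} (hA : A.PosDef) : A.det = (A.det.re : ℂ) :=
  Complex.ext rfl (by simpa using (Complex.lt_def.mp hA.det_pos).2.symm)

theorem log_det_le_trace {A : Matrix n n ℂ} (hA : A.PosDef) :
    Real.log A.det.re ≤ A.trace.re - Fintype.card n := by
  have h1 : A.det.re = ∏ i, hA.1.eigenvalues i := by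
    rw [hA.1.det_eq_prod_eigenvalues]
    change (∏ i, ((hA.1.eigenvalues i : ℝ) : ℂ)).re = _
    rw [← Complex.ofReal_prod, Complex.ofReal_re]
  have h2 : A.trace.re = ∑ i, hA.1.eigenvalues i := by
    rw [hA.1.trace_eq_sum_eigenvalues]
    change (∑ i, ((hA.1.eigenvalues i : ℝ) : ℂ)).re = _
    rw [← Complex.ofReal_sum, Complex.ofReal_re]
  rw [h1, h2, Real.log_prod fun i _ => (hA.eigenvalues_pos i).ne']
  calc ∑ i, Real.log (hA.1.eigenvalues i) ≤ ∑ i, (hA.1.eigenvalues i - 1) :=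
        Finset.sum_le_sum fun i _ => Real.log_le_sub_one_of_pos (hA.eigenvalues_pos i)
    _ = _ := by simp [Finset.sum_sub_distrib]

/-- The tangent-plane inequality expressing concavity of `log det`. -/
theorem log_det_le_log_det_add {A B : Matrix n n ℂ} (hA : A.PosDef) (hB : B.PosDef) :
    Real.log A.det.re ≤ Real.log B.det.re + ((B⁻¹ * A).trace.re - Fintype.card n) := by
  obtain ⟨C, hC⟩ := exists_eq_mul_conjTranspose hB.posSemidef
  have hdet : C.det ≠ 0 := fun h => by
    have := hB.det_pos.ne'
    rw [hC, det_mul, h, zero_mul] at this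
    exact this rfl
  have hu : IsUnit C.det := isUnit_iff_ne_zero.mpr hdet
  -- With `B = C Cᴴ`, conjugating by `C⁻¹` reduces the claim to the case `B = 1`, which is
  -- `log_det_le_trace`.
  have hZ : (C⁻¹ * A * C⁻¹ᴴ).PosDef := by
    refine hA.mul_mul_conjTranspose_same (Matrix.vecMul_injective_of_isUnit ?_)
    exact (Matrix.isUnit_nonsing_inv_iff).mpr ((Matrix.isUnit_iff_isUnit_det C).mpr hu)
  have h1 := log_det_le_trace hZ
  have hdet2 : (C⁻¹ * A * C⁻¹ᴴ).det.re = A.det.re / B.det.re := by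
    have h3 : (C⁻¹ * A * C⁻¹ᴴ).det * B.det = A.det := by
      rw [hC, ← det_mul]
      have : C⁻¹ * A * C⁻¹ᴴ * (C * Cᴴ) = C⁻¹ * A * (C⁻¹ᴴ * C * Cᴴ) := by
        simp only [Matrix.mul_assoc]
      rw [det_mul, det_mul, det_mul, det_mul, det_conjTranspose, det_conjTranspose]
      have h4 : C⁻¹.det * C.det = 1 := by rw [← det_mul, nonsing_inv_mul _ hu, det_one]
      have h5 : star C⁻¹.det * star C.det = 1 := by rw [← star_mul', h4, star_one]
      linear_combination (C.det * A.det * C⁻¹.det) * h5 + A.det * h4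
    rw [det_eq_re hZ, det_eq_re hB, det_eq_re hA, ← Complex.ofReal_mul, Complex.ofReal_inj] at h3
    rw [eq_div_iff (re_det_pos hB).ne', h3]
  have htr : (C⁻¹ * A * C⁻¹ᴴ).trace = (B⁻¹ * A).trace := by
    rw [trace_mul_comm, ← Matrix.mul_assoc, hC, Matrix.mul_inv_rev, conjTranspose_nonsing_inv]
  rw [hdet2, Real.log_div (re_det_pos hA).ne' (re_det_pos hB).ne', htr] at h1
  linarith

/-- In the tangent-plane inequality at `B`, the linear term is `-tr (B⁻¹ (B - A))`, which is
nonpositive as the trace of a product of positive matrices. -/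
theorem re_det_le_re_det {A B : Matrix n n ℂ} (hA : A.PosDef) (hB : B.PosDef)
    (hAB : (B - A).PosSemidef) : A.det.re ≤ B.det.re := by
  have h := log_det_le_log_det_add hA hB
  have h1 := re_trace_mul_nonneg hB.inv.posSemidef hAB
  have hu : IsUnit B.det := isUnit_iff_ne_zero.mpr hB.det_pos.ne'
  rw [Matrix.mul_sub, nonsing_inv_mul _ hu, trace_sub, trace_one, Complex.sub_re,
    Complex.natCast_re] at h1
  exact (Real.log_le_log_iff (re_det_pos hA) (re_det_pos hB)).mp (by linarith)

/-! ### Orthogonal projections, unitary conjugacy and equivariant maps. -/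

/-- Orthogonal projections of rank `r`. -/
structure IsProj (r : ℕ) (p : Matrix n n ℂ) : Prop where
  herm : pᴴ = p
  idem : p * p = p
  trace_eq : p.trace = r

namespace IsProj

variable {r : ℕ} {p q : Matrix n n ℂ}

theorem posSemidef (hp : IsProj r p) : p.PosSemidef := by
  have := posSemidef_conjTranspose_mul_self p
  rwa [hp.herm, hp.idem] at this

theorem posSemidef_one_sub (hp : IsProj r p) : (1 - p).PosSemidef := by
  have := posSemidef_conjTranspose_mul_self (1 - p)
  rwa [conjTranspose_sub, hp.herm, conjTranspose_one, Matrix.sub_mul, Matrix.mul_sub,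
    Matrix.mul_sub, hp.idem, Matrix.one_mul, Matrix.mul_one, Matrix.one_mul, sub_self,
    sub_zero] at this

theorem conj (hp : IsProj r p) {V : Matrix n n ℂ} (hV : V ∈ unitaryGroup n ℂ) :
    IsProj r (V * p * Vᴴ) := by
  have hV1 : Vᴴ * V = 1 := mem_unitaryGroup_iff'.mp hV
  refine ⟨?_, ?_, ?_⟩
  · simp only [conjTranspose_mul, conjTranspose_conjTranspose, hp.herm, Matrix.mul_assoc]
  · calc V * p * Vᴴ * (V * p * Vᴴ) = V * p * (Vᴴ * V) * p * Vᴴ := by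
          simp only [Matrix.mul_assoc]
      _ = V * p * Vᴴ := by rw [hV1, Matrix.mul_one, Matrix.mul_assoc V, hp.idem]
  · rw [trace_mul_comm, ← Matrix.mul_assoc, hV1, Matrix.one_mul, hp.trace_eq]

/-- Taking adjoints gives `q * p = p` as well, so `q - p` equals `(q - p)ᴴ * (q - p)`. Its trace is
zero because the ranks agree, hence it vanishes. -/
theorem eq_of_mul_eq (hp : IsProj r p) (hq : IsProj r q) (h : p * q = p) : p = q := by
  have h2 : q * p = p := by
    have := congrArg conjTranspose h
    rwa [conjTranspose_mul, hp.herm, hq.herm] at this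
  have h3 : (q - p)ᴴ * (q - p) = q - p := by
    rw [conjTranspose_sub, hp.herm, hq.herm, Matrix.sub_mul, Matrix.mul_sub, Matrix.mul_sub,
      hp.idem, hq.idem, h, h2, sub_self, sub_zero]
  have h4 : ((q - p)ᴴ * (q - p)).trace = 0 := by
    rw [h3, trace_sub, hp.trace_eq, hq.trace_eq, sub_self]
  exact (sub_eq_zero.mp (trace_conjTranspose_mul_self_eq_zero_iff.mp h4)).symm

theorem eigenvalues_eq_zero_or_one (hp : IsProj r p) (i : n) :
    (show p.IsHermitian from hp.herm).eigenvalues i = 0 ∨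
      (show p.IsHermitian from hp.herm).eigenvalues i = 1 := by
  have hA : p.IsHermitian := hp.herm
  obtain ⟨V, hV1, hV2, h⟩ := exists_spectral hA
  have h2 : Vᴴ * p * V = diagonal (fun i => (hA.eigenvalues i : ℂ)) := by
    calc Vᴴ * p * V = Vᴴ * (V * diagonal (fun i => (hA.eigenvalues i : ℂ)) * Vᴴ) * V := by
          rw [← h]
      _ = (Vᴴ * V) * diagonal (fun i => (hA.eigenvalues i : ℂ)) * (Vᴴ * V) := by
          simp only [Matrix.mul_assoc]
      _ = _ := by rw [hV1, Matrix.one_mul, Matrix.mul_one]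
  have h3 : (Vᴴ * p * V) * (Vᴴ * p * V) = Vᴴ * p * V := by
    calc (Vᴴ * p * V) * (Vᴴ * p * V) = Vᴴ * (p * (V * Vᴴ) * p) * V := by
          simp only [Matrix.mul_assoc]
      _ = _ := by rw [hV2, Matrix.mul_one, hp.idem]
  rw [h2, diagonal_mul_diagonal] at h3
  have h4 := congrFun (diagonal_injective h3) i
  rw [← Complex.ofReal_mul, Complex.ofReal_inj] at h4
  rcases eq_or_ne (hA.eigenvalues i) 0 with h5 | h5
  · exact Or.inl h5
  · exact Or.inr (mul_left_cancel₀ h5 (by rw [h4, mul_one]))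

end IsProj

theorem permMatrix_conj (σ : Equiv.Perm n) (A : Matrix n n ℂ) :
    σ.permMatrix ℂ * A * (σ.permMatrix ℂ)ᴴ = A.submatrix σ σ := by
  rw [conjTranspose_permMatrix, Equiv.Perm.permMatrix, Equiv.Perm.permMatrix,
    PEquiv.toMatrix_toPEquiv_mul, PEquiv.mul_toMatrix_toPEquiv]
  rfl

theorem permMatrix_mem_unitaryGroup (σ : Equiv.Perm n) :
    σ.permMatrix ℂ ∈ unitaryGroup n ℂ := by
  have h := permMatrix_conj σ (1 : Matrix n n ℂ)
  rw [Matrix.mul_one, submatrix_one_equiv] at h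
  exact mem_unitaryGroup_iff.mpr h

/-- Any two orthogonal projections of the same rank are unitarily conjugate. -/
theorem IsProj.exists_unitary_conj {r : ℕ} {p q : Matrix n n ℂ} (hp : IsProj r p)
    (hq : IsProj r q) : ∃ V ∈ unitaryGroup n ℂ, q = V * p * Vᴴ := by
  have hA : p.IsHermitian := hp.herm
  have hB : q.IsHermitian := hq.herm
  obtain ⟨V, hV1, hV2, hV⟩ := exists_spectral hA
  obtain ⟨W, hW1, hW2, hW⟩ := exists_spectral hB
  have hcard : ∀ {s : Matrix n n ℂ} (hs : IsProj r s),
      Fintype.card {i // (show s.IsHermitian from hs.herm).eigenvalues i = 1} = r := by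
    intro s hs
    have hS : s.IsHermitian := hs.herm
    have h1 := hs.trace_eq
    rw [hS.trace_eq_sum_eigenvalues] at h1
    have h2 : ∀ i, (hS.eigenvalues i : ℂ) = if hS.eigenvalues i = 1 then 1 else 0 := fun i => by
      rcases hs.eigenvalues_eq_zero_or_one i with h | h <;> simp [h]
    change ∑ i, ((hS.eigenvalues i : ℝ) : ℂ) = _ at h1
    rw [Finset.sum_congr rfl fun i _ => h2 i, Finset.sum_boole, Nat.cast_inj] at h1
    rw [Fintype.card_subtype]; exact h1
  -- Both spectra consist of zeros and exactly `r` ones, so a bijection between the positions of the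
  -- ones extends to a permutation matching the eigenvalues.
  let e : {i // hB.eigenvalues i = 1} ≃ {i // hA.eigenvalues i = 1} :=
    Fintype.equivOfCardEq ((hcard hq).trans (hcard hp).symm)
  let σ : Equiv.Perm n := e.extendSubtype
  have hσ : ∀ i, hA.eigenvalues (σ i) = hB.eigenvalues i := fun i => by
    by_cases h : hB.eigenvalues i = 1
    · rw [h]; exact e.extendSubtype_mem i h
    · have h1 := e.extendSubtype_not_mem i h
      rw [(hq.eigenvalues_eq_zero_or_one i).resolve_right h,
        (hp.eigenvalues_eq_zero_or_one (σ i)).resolve_right h1]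
  have hVm : Vᴴ ∈ unitaryGroup n ℂ := by
    rw [mem_unitaryGroup_iff, star_eq_conjTranspose, conjTranspose_conjTranspose]; exact hV1
  have hWm : W ∈ unitaryGroup n ℂ := mem_unitaryGroup_iff.mpr hW2
  refine ⟨W * σ.permMatrix ℂ * Vᴴ, mul_mem (mul_mem hWm (permMatrix_mem_unitaryGroup σ)) hVm, ?_⟩
  have hD : σ.permMatrix ℂ * diagonal (fun i => (hA.eigenvalues i : ℂ)) * (σ.permMatrix ℂ)ᴴ =
      diagonal (fun i => (hB.eigenvalues i : ℂ)) := by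
    rw [permMatrix_conj, submatrix_diagonal_equiv]
    congr 1
    ext i
    simp [hσ]
  calc q = W * diagonal (fun i => (hB.eigenvalues i : ℂ)) * Wᴴ := hW
    _ = W * (σ.permMatrix ℂ * ((Vᴴ * V) * diagonal (fun i => (hA.eigenvalues i : ℂ)) * (Vᴴ * V)) *
        (σ.permMatrix ℂ)ᴴ) * Wᴴ := by rw [hV1, Matrix.one_mul, Matrix.mul_one, hD]
    _ = W * σ.permMatrix ℂ * Vᴴ * (V * diagonal (fun i => (hA.eigenvalues i : ℂ)) * Vᴴ) *
        (W * σ.permMatrix ℂ * Vᴴ)ᴴ := by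
      simp only [conjTranspose_mul, conjTranspose_conjTranspose, Matrix.mul_assoc]
    _ = _ := by rw [← hV]

/-- A function of rank-`r` projections that commutes with unitary conjugation is a fixed linear
combination of the projection and its complement. -/
theorem exists_eq_smul_add_smul_of_equivariant {r : ℕ} (Φ : Matrix n n ℂ → Matrix n n ℂ)
    (hΦ : ∀ V ∈ unitaryGroup n ℂ, ∀ p, IsProj r p → Φ (V * p * Vᴴ) = V * Φ p * Vᴴ) :
    ∃ a b : ℂ, ∀ p, IsProj r p → Φ p = a • p + b • (1 - p) := by
  by_cases hex : ∃ p : Matrix n n ℂ, IsProj r p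
  swap
  · exact ⟨0, 0, fun p hp => absurd ⟨p, hp⟩ hex⟩
  obtain ⟨p, hp⟩ := hex
  have hA : p.IsHermitian := hp.herm
  obtain ⟨V, hV1, hV2, hV⟩ := exists_spectral hA
  set χ : n → ℂ := fun i => (hA.eigenvalues i : ℂ) with hχ
  have hχ01 : ∀ i, χ i = 0 ∨ χ i = 1 := fun i => by
    rcases hp.eigenvalues_eq_zero_or_one i with h | h <;> simp [hχ, h]
  have hVm : Vᴴ ∈ unitaryGroup n ℂ := by
    rw [mem_unitaryGroup_iff, star_eq_conjTranspose, conjTranspose_conjTranspose]; exact hV1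
  have hp0 : IsProj r (diagonal χ) := by
    have h1 := hp.conj hVm
    have h2 : Vᴴ * p * Vᴴᴴ = diagonal χ := by
      calc Vᴴ * p * Vᴴᴴ = Vᴴ * (V * diagonal χ * Vᴴ) * V := by
            rw [← hV, conjTranspose_conjTranspose]
        _ = (Vᴴ * V) * diagonal χ * (Vᴴ * V) := by simp only [Matrix.mul_assoc]
        _ = _ := by rw [hV1, Matrix.one_mul, Matrix.mul_one]
    rwa [h2] at h1
  -- Schur's lemma by hand for the stabilizer of a coordinate projection: a sign flip of one
  -- coordinate kills the off-diagonal entries, and swapping two coordinates of the same eigenspace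
  -- (`hdiag`) equates their diagonal entries.
  have hoff : ∀ i j, i ≠ j → Φ (diagonal χ) i j = 0 := by
    intro i j hij
    let e : n → ℂ := fun k => if k = i then -1 else 1
    have hee : ∀ k, e k * star e k = 1 := fun k => by
      by_cases h : k = i <;> simp [e, h]
    have hD : diagonal e * (diagonal e)ᴴ = 1 := by
      rw [diagonal_conjTranspose, diagonal_mul_diagonal, ← diagonal_one]
      exact congrArg diagonal (funext hee)
    have h1 := hΦ (diagonal e) (mem_unitaryGroup_iff.mpr hD) _ hp0
    have h2 : diagonal e * diagonal χ * (diagonal e)ᴴ = diagonal χ := by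
      rw [(commute_diagonal e χ).eq, Matrix.mul_assoc, hD, Matrix.mul_one]
    rw [h2] at h1
    have h3 := congrFun (congrFun h1 i) j
    rw [diagonal_conjTranspose, mul_diagonal, diagonal_mul] at h3
    simp only [e, if_true, Pi.star_apply, if_neg hij.symm, star_one, mul_one, neg_mul,
      one_mul] at h3
    exact self_eq_neg.mp h3
  have hdiag : ∀ i j, χ i = χ j → Φ (diagonal χ) i i = Φ (diagonal χ) j j := by
    intro i j hij
    have h1 := hΦ _ (permMatrix_mem_unitaryGroup (Equiv.swap i j)) _ hp0
    rw [permMatrix_conj, permMatrix_conj, submatrix_diagonal_equiv] at h1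
    have h2 : χ ∘ Equiv.swap i j = χ := by
      funext k
      simp only [Function.comp_apply]
      rcases eq_or_ne k i with rfl | h
      · rw [Equiv.swap_apply_left, hij]
      rcases eq_or_ne k j with rfl | h'
      · rw [Equiv.swap_apply_right, hij]
      rw [Equiv.swap_apply_of_ne_of_ne h h']
    rw [h2] at h1
    have h3 := congrFun (congrFun h1 i) i
    rwa [submatrix_apply, Equiv.swap_apply_left] at h3
  have hval : ∀ z : ℂ, ∃ c, ∀ i, χ i = z → Φ (diagonal χ) i i = c := fun z => by
    by_cases h : ∃ i, χ i = z
    · obtain ⟨i, hi⟩ := h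
      exact ⟨_, fun j hj => hdiag j i (hj.trans hi.symm)⟩
    · exact ⟨0, fun j hj => absurd ⟨j, hj⟩ h⟩
  obtain ⟨a, ha⟩ := hval 1
  obtain ⟨b, hb⟩ := hval 0
  have hΦ0 : Φ (diagonal χ) = a • diagonal χ + b • (1 - diagonal χ) := by
    ext i j
    rcases eq_or_ne i j with rfl | hij
    · rcases hχ01 i with h | h
      · simp [h, hb i h]
      · simp [h, ha i h]
    · simp [hoff i j hij, hij]
  refine ⟨a, b, fun q hq => ?_⟩
  obtain ⟨W, hW, rfl⟩ := hp0.exists_unitary_conj hq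
  have hWW : W * Wᴴ = 1 := mem_unitaryGroup_iff.mp hW
  rw [hΦ W hW _ hp0, hΦ0]
  simp only [Matrix.mul_add, Matrix.add_mul, Matrix.mul_smul, Matrix.smul_mul, Matrix.mul_sub,
    Matrix.sub_mul, Matrix.mul_one, hWW]

/-! ### Kernel projections as limits of resolvents. -/

/-- The orthogonal projection onto the kernel of a positive semidefinite matrix. -/
noncomputable def kerProj (A : Matrix n n ℂ) : Matrix n n ℂ :=
  Matrix.of fun i j => limUnder atTop fun k : ℕ => (1 + (k : ℂ) • A)⁻¹ i j

theorem inv_one_add_smul_eq {A V : Matrix n n ℂ} {l : n → ℝ} (hl : ∀ i, 0 ≤ l i)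
    (hV1 : Vᴴ * V = 1) (hV2 : V * Vᴴ = 1) (hA : A = V * diagonal (fun i => (l i : ℂ)) * Vᴴ)
    (k : ℕ) : (1 + (k : ℂ) • A)⁻¹ = V * diagonal (fun i => (1 + (k : ℂ) * l i)⁻¹) * Vᴴ := by
  have h1 : 1 + (k : ℂ) • A = V * diagonal (fun i => 1 + (k : ℂ) * l i) * Vᴴ := by
    have h2 : diagonal (fun i => 1 + (k : ℂ) * l i) =
        1 + (k : ℂ) • diagonal (fun i => (l i : ℂ)) := by
      ext i j
      rcases eq_or_ne i j with rfl | h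
      · simp
      · simp [h]
    rw [h2, Matrix.mul_add, Matrix.add_mul, Matrix.mul_one, hV2, Matrix.mul_smul,
      Matrix.smul_mul, ← hA]
  apply Matrix.inv_eq_right_inv
  rw [h1]
  calc V * diagonal (fun i => 1 + (k : ℂ) * l i) * Vᴴ *
        (V * diagonal (fun i => (1 + (k : ℂ) * l i)⁻¹) * Vᴴ)
      = V * (diagonal (fun i => 1 + (k : ℂ) * l i) * (Vᴴ * V) *
        diagonal (fun i => (1 + (k : ℂ) * l i)⁻¹)) * Vᴴ := by simp only [Matrix.mul_assoc]
    _ = V * 1 * Vᴴ := by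
        rw [hV1, Matrix.mul_one, diagonal_mul_diagonal]
        congr 2
        rw [← diagonal_one]
        congr 1
        funext i
        apply mul_inv_cancel₀
        have : (1 + (k : ℂ) * l i) = ((1 + k * l i : ℝ) : ℂ) := by push_cast; rfl
        rw [this, Complex.ofReal_ne_zero]
        have := mul_nonneg (Nat.cast_nonneg (α := ℝ) k) (hl i)
        positivity
    _ = 1 := by rw [Matrix.mul_one, hV2]

/-- The resolvent eigenvalue `(1 + k l)⁻¹` is constantly `1` if `l = 0` and tends to `0` otherwise.
The definition as a limit makes measurability in `A` immediate, which a choice of eigenvectors would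
not. -/
theorem kerProj_eq {A V : Matrix n n ℂ} {l : n → ℝ} (hl : ∀ i, 0 ≤ l i) (hV1 : Vᴴ * V = 1)
    (hV2 : V * Vᴴ = 1) (hA : A = V * diagonal (fun i => (l i : ℂ)) * Vᴴ) :
    kerProj A = V * diagonal (fun i => if l i = 0 then (1 : ℂ) else 0) * Vᴴ := by
  have hinv := inv_one_add_smul_eq hl hV1 hV2 hA
  have hent : ∀ (d : n → ℂ) (i j : n), (V * diagonal d * Vᴴ) i j =
      ∑ x, V i x * d x * Vᴴ x j := fun d i j => by
    rw [Matrix.mul_apply]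
    exact Finset.sum_congr rfl fun x _ => by rw [mul_diagonal]
  ext i j
  rw [kerProj, of_apply, hent]
  apply Tendsto.limUnder_eq
  simp only [hinv, hent]
  refine tendsto_finsetSum _ fun x _ => ?_
  refine Tendsto.mul_const _ (Tendsto.const_mul _ ?_)
  rcases eq_or_ne (l x) 0 with h | h
  · simp [h]
  · rw [if_neg h]
    refine tendsto_inv₀_cobounded.comp ?_
    rw [← tendsto_norm_atTop_iff_cobounded]
    refine tendsto_atTop_mono (f := fun k : ℕ => (k : ℝ) * l x) (fun k => ?_)
      (tendsto_natCast_atTop_atTop.atTop_mul_const (lt_of_le_of_ne (hl x) h.symm))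
    have : (1 + (k : ℂ) * l x) = ((1 + k * l x : ℝ) : ℂ) := by push_cast; rfl
    rw [this, Complex.norm_real, Real.norm_eq_abs]
    exact le_trans (by linarith) (le_abs_self _)

theorem mul_kerProj {A : Matrix n n ℂ} (hA : A.PosSemidef) : A * kerProj A = 0 := by
  obtain ⟨V, hV1, hV2, hV⟩ := exists_spectral hA.1
  rw [kerProj_eq hA.eigenvalues_nonneg hV1 hV2 hV]
  calc A * (V * diagonal (fun i => if hA.1.eigenvalues i = 0 then (1 : ℂ) else 0) * Vᴴ)
      = (V * diagonal (fun i => (hA.1.eigenvalues i : ℂ)) * Vᴴ) *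
        (V * diagonal (fun i => if hA.1.eigenvalues i = 0 then (1 : ℂ) else 0) * Vᴴ) := by
        rw [← hV]
    _ = V * (diagonal (fun i => (hA.1.eigenvalues i : ℂ)) * (Vᴴ * V) *
        diagonal (fun i => if hA.1.eigenvalues i = 0 then (1 : ℂ) else 0)) * Vᴴ := by
        simp only [Matrix.mul_assoc]
    _ = 0 := by
        rw [hV1, Matrix.mul_one, diagonal_mul_diagonal]
        have : (fun i => (hA.1.eigenvalues i : ℂ) *
          if hA.1.eigenvalues i = 0 then (1 : ℂ) else 0) = fun _ => 0 := by
          funext i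
          by_cases h : hA.1.eigenvalues i = 0 <;> simp [h]
        rw [this, diagonal_zero, Matrix.mul_zero, Matrix.zero_mul]

theorem exists_mul_eq_one_sub_kerProj {A : Matrix n n ℂ} (hA : A.PosSemidef) :
    ∃ X, X * A = 1 - kerProj A := by
  obtain ⟨V, hV1, hV2, hV⟩ := exists_spectral hA.1
  -- The pseudo-inverse; the convention `0⁻¹ = 0` is what leaves the kernel directions out.
  refine ⟨V * diagonal (fun i => (hA.1.eigenvalues i : ℂ)⁻¹) * Vᴴ, ?_⟩
  rw [kerProj_eq hA.eigenvalues_nonneg hV1 hV2 hV]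
  calc V * diagonal (fun i => (hA.1.eigenvalues i : ℂ)⁻¹) * Vᴴ * A
      = V * diagonal (fun i => (hA.1.eigenvalues i : ℂ)⁻¹) * Vᴴ *
        (V * diagonal (fun i => (hA.1.eigenvalues i : ℂ)) * Vᴴ) := by rw [← hV]
    _ = V * (diagonal (fun i => (hA.1.eigenvalues i : ℂ)⁻¹) * (Vᴴ * V) *
        diagonal (fun i => (hA.1.eigenvalues i : ℂ))) * Vᴴ := by simp only [Matrix.mul_assoc]
    _ = V * (1 - diagonal (fun i => if hA.1.eigenvalues i = 0 then (1 : ℂ) else 0)) * Vᴴ := by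
        rw [hV1, Matrix.mul_one, diagonal_mul_diagonal, ← diagonal_one, diagonal_sub]
        congr 3
        funext i
        by_cases h : hA.1.eigenvalues i = 0 <;> simp [h]
    _ = _ := by rw [Matrix.mul_sub, Matrix.sub_mul, Matrix.mul_one, hV2]

theorem isProj_kerProj {A : Matrix n n ℂ} (hA : A.PosSemidef) {r : ℕ}
    (hr : A.rank + r = Fintype.card n) : IsProj r (kerProj A) := by
  obtain ⟨V, hV1, hV2, hV⟩ := exists_spectral hA.1
  rw [kerProj_eq hA.eigenvalues_nonneg hV1 hV2 hV]
  refine IsProj.conj ⟨?_, ?_, ?_⟩ (mem_unitaryGroup_iff.mpr hV2)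
  · rw [diagonal_conjTranspose]
    congr 1
    funext i
    by_cases h : hA.1.eigenvalues i = 0 <;> simp [h]
  · rw [diagonal_mul_diagonal]
    congr 1
    funext i
    by_cases h : hA.1.eigenvalues i = 0 <;> simp [h]
  · rw [trace_diagonal, Finset.sum_boole, Nat.cast_inj]
    have h1 := hA.1.rank_eq_card_non_zero_eigs
    rw [Fintype.card_subtype_compl, Fintype.card_subtype] at h1
    have h2 : (Finset.univ.filter fun i => hA.1.eigenvalues i = 0).card ≤ Fintype.card n :=
      Finset.card_le_univ _
    omega

/-- The range of `q` lies in the kernel of `A`, and both have dimension `r`. This is how a precoder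
is recognised from its zero-interference conditions. -/
theorem IsProj.eq_kerProj {A q : Matrix n n ℂ} {r : ℕ} (hq : IsProj r q) (hA : A.PosSemidef)
    (hE : IsProj r (kerProj A)) (h : A * q = 0) : q = kerProj A := by
  obtain ⟨X, hX⟩ := exists_mul_eq_one_sub_kerProj hA
  have h1 : (1 - kerProj A) * q = 0 := by rw [← hX, Matrix.mul_assoc, h, Matrix.mul_zero]
  have h2 : kerProj A * q = q := by
    rw [Matrix.sub_mul, Matrix.one_mul, sub_eq_zero] at h1; exact h1.symm
  refine hq.eq_of_mul_eq hE ?_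
  have := congrArg conjTranspose h2
  rwa [conjTranspose_mul, hq.herm, hE.herm] at this

theorem kerProj_conj {A V : Matrix n n ℂ} (hA : A.PosSemidef) (hV : V ∈ unitaryGroup n ℂ) :
    kerProj (V * A * Vᴴ) = V * kerProj A * Vᴴ := by
  obtain ⟨W, hW1, hW2, hW⟩ := exists_spectral hA.1
  have hV1 : Vᴴ * V = 1 := mem_unitaryGroup_iff'.mp hV
  have hV2 : V * Vᴴ = 1 := mem_unitaryGroup_iff.mp hV
  rw [kerProj_eq hA.eigenvalues_nonneg hW1 hW2 hW,
    kerProj_eq (V := V * W) hA.eigenvalues_nonneg]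
  · simp only [conjTranspose_mul, Matrix.mul_assoc]
  · rw [conjTranspose_mul, Matrix.mul_assoc, ← Matrix.mul_assoc Vᴴ, hV1, Matrix.one_mul, hW1]
  · rw [conjTranspose_mul, Matrix.mul_assoc, ← Matrix.mul_assoc W, hW2, Matrix.one_mul, hV2]
  · calc V * A * Vᴴ = V * (W * diagonal (fun i => (hA.1.eigenvalues i : ℂ)) * Wᴴ) * Vᴴ := by
          rw [← hW]
      _ = _ := by simp only [conjTranspose_mul, Matrix.mul_assoc]

end LinearAlgebra

/-! ### Measurability of matrix operations. -/

section MeasurableMatrix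

variable {l m n α : Type*}

instance [Countable m] [Countable n] : BorelSpace (Matrix m n ℂ) :=
  inferInstanceAs (BorelSpace (m → n → ℂ))

instance [Countable m] [Countable n] : SecondCountableTopology (Matrix m n ℂ) :=
  inferInstanceAs (SecondCountableTopology (m → n → ℂ))

theorem measurable_matrix_iff [MeasurableSpace α] {f : α → Matrix m n ℂ} :
    Measurable f ↔ ∀ i j, Measurable fun x => f x i j := by
  constructor
  · intro h i j
    exact (measurable_pi_apply j).comp ((measurable_pi_apply i).comp h)
  · intro h
    exact measurable_pi_lambda _ fun i => measurable_pi_lambda _ fun j => h i j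

variable [MeasurableSpace α]

theorem _root_.Measurable.matrix_entry {f : α → Matrix m n ℂ} (hf : Measurable f) (i : m) (j : n) :
    Measurable fun x => f x i j :=
  measurable_matrix_iff.mp hf i j

@[fun_prop]
theorem _root_.Measurable.matrix_mul [Fintype m] {f : α → Matrix l m ℂ} {g : α → Matrix m n ℂ}
    (hf : Measurable f) (hg : Measurable g) : Measurable fun x => f x * g x := by
  rw [measurable_matrix_iff] at *
  intro i j
  simp only [Matrix.mul_apply]
  exact Finset.measurable_fun_sum _ fun k _ => (hf i k).mul (hg k j)

@[fun_prop]
theorem _root_.Measurable.matrix_conjTranspose {f : α → Matrix m n ℂ} (hf : Measurable f) :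
    Measurable fun x => (f x)ᴴ := by
  rw [measurable_matrix_iff] at *
  intro i j
  exact Complex.continuous_conj.measurable.comp (hf j i)

@[fun_prop]
theorem _root_.Measurable.matrix_const_smul {f : α → Matrix m n ℂ} (c : ℂ) (hf : Measurable f) :
    Measurable fun x => c • f x := by
  rw [measurable_matrix_iff] at *
  exact fun i j => (hf i j).const_mul c

@[fun_prop]
theorem _root_.Measurable.matrix_sum {ι : Type*} (s : Finset ι) {f : ι → α → Matrix m n ℂ}
    (hf : ∀ i, Measurable (f i)) : Measurable fun x => ∑ i ∈ s, f i x := by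
  rw [measurable_matrix_iff]
  intro i j
  simp only [Matrix.sum_apply]
  exact Finset.measurable_fun_sum _ fun k _ => measurable_matrix_iff.mp (hf k) i j

@[fun_prop]
theorem _root_.Measurable.matrix_trace [Fintype n] {f : α → Matrix n n ℂ} (hf : Measurable f) :
    Measurable fun x => (f x).trace := by
  rw [measurable_matrix_iff] at hf
  simp only [Matrix.trace, Matrix.diag]
  exact Finset.measurable_fun_sum _ fun k _ => hf k k

variable [Fintype n] [DecidableEq n]

@[fun_prop]
theorem _root_.Measurable.matrix_det {f : α → Matrix n n ℂ} (hf : Measurable f) :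
    Measurable fun x => (f x).det :=
  (Continuous.matrix_det continuous_id).measurable.comp hf

@[fun_prop]
theorem _root_.Measurable.matrix_inv {f : α → Matrix n n ℂ} (hf : Measurable f) :
    Measurable fun x => (f x)⁻¹ := by
  have h : Measurable fun A : Matrix n n ℂ => A⁻¹ := by
    rw [measurable_matrix_iff]
    intro i j
    have h1 : Measurable fun A : Matrix n n ℂ => A.adjugate i j :=
      (Continuous.matrix_adjugate continuous_id).measurable.matrix_entry i j
    simp only [Matrix.inv_def, Matrix.smul_apply, Ring.inverse_eq_inv', smul_eq_mul]
    exact (Measurable.matrix_det measurable_id).inv.mul h1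
  exact h.comp hf

@[fun_prop]
theorem _root_.Measurable.kerProj {f : α → Matrix n n ℂ} (hf : Measurable f) :
    Measurable fun x => kerProj (f x) := by
  rw [measurable_matrix_iff]
  intro i j
  refine (StronglyMeasurable.limUnder fun k => ?_).measurable
  exact (measurable_matrix_iff.mp (by fun_prop) i j).stronglyMeasurable

theorem measurableSet_isProj (r : ℕ) : MeasurableSet {p : Matrix n n ℂ | IsProj r p} := by
  have : {p : Matrix n n ℂ | IsProj r p} =
      {p : Matrix n n ℂ | pᴴ = p} ∩ ({p | p * p = p} ∩ {p | p.trace = (r : ℂ)}) := by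
    ext p
    exact ⟨fun h => ⟨h.1, h.2, h.3⟩, fun h => ⟨h.1, h.2.1, h.2.2⟩⟩
  rw [this]
  exact (measurableSet_eq_fun (by fun_prop) measurable_id).inter
    ((measurableSet_eq_fun (by fun_prop) measurable_id).inter
      (measurableSet_eq_fun (by fun_prop) measurable_const))

end MeasurableMatrix

/-! ### Uniqueness of the unitarily invariant law on projections. -/

section Haar

variable {n : Type*} [Fintype n] [DecidableEq n]

instance : CompactSpace (unitaryGroup n ℂ) := by
  refine (isCompact_iff_compactSpace (s := (unitaryGroup n ℂ : Set (Matrix n n ℂ)))).mp ?_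
  have hK : IsCompact (Set.univ.pi fun _ : n => Set.univ.pi fun _ : n =>
      Metric.closedBall (0 : ℂ) 1) :=
    isCompact_univ_pi fun _ => isCompact_univ_pi fun _ => isCompact_closedBall _ _
  have hc : IsClosed (unitaryGroup n ℂ : Set (Matrix n n ℂ)) := by
    have : (unitaryGroup n ℂ : Set (Matrix n n ℂ)) = {V | V * Vᴴ = 1} := by
      ext V; exact mem_unitaryGroup_iff
    rw [this]
    exact isClosed_eq (by fun_prop) continuous_const
  refine hK.of_isClosed_subset hc fun V hV => ?_
  simp only [Set.mem_univ_pi, mem_closedBall_zero_iff]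
  exact fun i j => entry_norm_bound_of_unitary hV i j

/-- Uniqueness of the unitarily invariant law on projections of a given rank. -/
theorem eq_of_conj_invariant {r : ℕ} (ν₁ ν₂ : Measure (Matrix n n ℂ)) [IsProbabilityMeasure ν₁]
    [IsProbabilityMeasure ν₂] (h₁ : ∀ᵐ p ∂ν₁, IsProj r p) (h₂ : ∀ᵐ p ∂ν₂, IsProj r p)
    (hinv₁ : ∀ V ∈ unitaryGroup n ℂ, ν₁.map (fun p => V * p * Vᴴ) = ν₁)
    (hinv₂ : ∀ V ∈ unitaryGroup n ℂ, ν₂.map (fun p => V * p * Vᴴ) = ν₂) : ν₁ = ν₂ := by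
  let : MeasurableSpace (unitaryGroup n ℂ) := borel _
  have : BorelSpace (unitaryGroup n ℂ) := ⟨rfl⟩
  let η : Measure (unitaryGroup n ℂ) := Measure.haarMeasure ⊤
  have : IsProbabilityMeasure η := ⟨by
    have := Measure.haarMeasure_self
      (K₀ := (⊤ : TopologicalSpace.PositiveCompacts (unitaryGroup n ℂ)))
    simpa using this⟩
  obtain ⟨p₀, hp₀⟩ := h₁.exists
  have hcoe : Measurable fun V : unitaryGroup n ℂ => (V : Matrix n n ℂ) :=
    continuous_subtype_val.measurable
  -- Any invariant law is the Haar orbit measure of the fixed `p₀`. By invariance `ν s` equals its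
  -- average over all conjugations; after Fubini the inner Haar integral at `p = W p₀ Wᴴ` equals
  -- that at `p₀`, by transitivity of the action and left invariance of Haar measure.
  have key : ∀ (ν : Measure (Matrix n n ℂ)) [IsProbabilityMeasure ν],
      (∀ᵐ p ∂ν, IsProj r p) →
      (∀ V ∈ unitaryGroup n ℂ, ν.map (fun p => V * p * Vᴴ) = ν) → ∀ s, MeasurableSet s →
      ν s = ∫⁻ V : unitaryGroup n ℂ, s.indicator 1 ((V : Matrix n n ℂ)ᴴ * p₀ * V) ∂η := by
    intro ν _ hν hinv s hs
    have hind : Measurable (s.indicator (1 : Matrix n n ℂ → ENNReal)) :=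
      measurable_one.indicator hs
    have h1 : ∀ V : unitaryGroup n ℂ,
        ∫⁻ p, s.indicator 1 ((V : Matrix n n ℂ)ᴴ * p * V) ∂ν = ν s := by
      intro V
      have hV : (V : Matrix n n ℂ)ᴴ ∈ unitaryGroup n ℂ := (star V).2
      conv_rhs => rw [← hinv _ hV, ← lintegral_indicator_one hs]
      rw [lintegral_map hind (by fun_prop)]
      simp only [conjTranspose_conjTranspose]
    calc ν s = ∫⁻ V : unitaryGroup n ℂ, ∫⁻ p, s.indicator 1 ((V : Matrix n n ℂ)ᴴ * p * V) ∂ν ∂η := by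
          simp_rw [h1]; simp
      _ = ∫⁻ p, ∫⁻ V : unitaryGroup n ℂ, s.indicator 1 ((V : Matrix n n ℂ)ᴴ * p * V) ∂η ∂ν := by
          refine lintegral_lintegral_swap (Measurable.aemeasurable ?_)
          refine hind.comp ?_
          have : Measurable fun x : unitaryGroup n ℂ × Matrix n n ℂ => (x.1 : Matrix n n ℂ) :=
            hcoe.comp measurable_fst
          exact (this.matrix_conjTranspose.matrix_mul measurable_snd).matrix_mul this
      _ = ∫⁻ p, ∫⁻ V : unitaryGroup n ℂ, s.indicator 1 ((V : Matrix n n ℂ)ᴴ * p₀ * V) ∂η ∂ν := by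
          refine lintegral_congr_ae ?_
          filter_upwards [hν] with p hp
          obtain ⟨W, hW, rfl⟩ := hp₀.exists_unitary_conj hp
          let W' : unitaryGroup n ℂ := ⟨W, hW⟩
          refine Eq.trans ?_ (lintegral_mul_left_eq_self (μ := η)
            (fun V : unitaryGroup n ℂ => s.indicator 1 ((V : Matrix n n ℂ)ᴴ * p₀ * V)) W'⁻¹)
          refine lintegral_congr fun V => ?_
          congr 1
          have : ((W'⁻¹ * V : unitaryGroup n ℂ) : Matrix n n ℂ) = Wᴴ * V := rfl
          rw [this]
          simp only [conjTranspose_mul, conjTranspose_conjTranspose, Matrix.mul_assoc]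
      _ = _ := by simp
  ext s hs
  rw [key ν₁ h₁ hinv₁ s hs, key ν₂ h₂ hinv₂ s hs]

end Haar

/-! ### Row-space projections. -/

section Proj

variable {m n : Type*} [Fintype m] [Fintype n] [DecidableEq m] [DecidableEq n]

/-- The orthogonal projection onto the row space of a matrix of full row rank. -/
noncomputable def proj (G : Matrix m n ℂ) : Matrix n n ℂ := Gᴴ * (G * Gᴴ)⁻¹ * G

@[fun_prop]
theorem _root_.Measurable.proj {α : Type*} [MeasurableSpace α] {f : α → Matrix m n ℂ}
    (hf : Measurable f) : Measurable fun x => proj (f x) := by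
  unfold BlockDiag.proj; fun_prop

theorem isProj_proj {G : Matrix m n ℂ} (hG : (G * Gᴴ).det ≠ 0) :
    IsProj (Fintype.card m) (proj G) := by
  have hu : IsUnit (G * Gᴴ).det := isUnit_iff_ne_zero.mpr hG
  refine ⟨?_, ?_, ?_⟩
  · simp only [proj, conjTranspose_mul, conjTranspose_conjTranspose, conjTranspose_nonsing_inv,
      Matrix.mul_assoc]
  · calc proj G * proj G = Gᴴ * ((G * Gᴴ)⁻¹ * (G * Gᴴ)) * (G * Gᴴ)⁻¹ * G := by
          simp only [proj, Matrix.mul_assoc]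
      _ = _ := by rw [nonsing_inv_mul _ hu, Matrix.mul_one, proj]
  · rw [proj, Matrix.mul_assoc, trace_mul_comm, Matrix.mul_assoc, nonsing_inv_mul _ hu, trace_one]

theorem mul_proj {G : Matrix m n ℂ} (hG : (G * Gᴴ).det ≠ 0) : G * proj G = G := by
  rw [proj, ← Matrix.mul_assoc, ← Matrix.mul_assoc,
    mul_nonsing_inv _ (isUnit_iff_ne_zero.mpr hG), Matrix.one_mul]

/-- An invertible factor on the left leaves the row space unchanged. This removes the receive
correlation from everything that depends on subspaces only. -/
theorem proj_mul_left {L : Matrix m m ℂ} (hL : L.det ≠ 0) (G : Matrix m n ℂ) :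
    proj (L * G) = proj G := by
  have hu : IsUnit L.det := isUnit_iff_ne_zero.mpr hL
  have hu' : IsUnit (Lᴴ).det := by
    rw [det_conjTranspose]; exact isUnit_iff_ne_zero.mpr (star_ne_zero.mpr hL)
  have h1 : L * G * (L * G)ᴴ = L * (G * Gᴴ) * Lᴴ := by
    simp only [conjTranspose_mul, Matrix.mul_assoc]
  rw [proj, h1, Matrix.mul_inv_rev, Matrix.mul_inv_rev, conjTranspose_mul]
  calc Gᴴ * Lᴴ * (Lᴴ⁻¹ * ((G * Gᴴ)⁻¹ * L⁻¹)) * (L * G)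
      = Gᴴ * (Lᴴ * Lᴴ⁻¹) * (G * Gᴴ)⁻¹ * (L⁻¹ * L) * G := by simp only [Matrix.mul_assoc]
    _ = proj G := by
      rw [mul_nonsing_inv _ hu', nonsing_inv_mul _ hu, Matrix.mul_one, Matrix.mul_one, proj]

theorem proj_mul_conjTranspose {V : Matrix n n ℂ} (hV : V ∈ unitaryGroup n ℂ) (G : Matrix m n ℂ) :
    proj (G * Vᴴ) = V * proj G * Vᴴ := by
  have hV1 : Vᴴ * V = 1 := mem_unitaryGroup_iff'.mp hV
  have h1 : G * Vᴴ * (G * Vᴴ)ᴴ = G * Gᴴ := by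
    rw [conjTranspose_mul, conjTranspose_conjTranspose, Matrix.mul_assoc, ← Matrix.mul_assoc Vᴴ,
      hV1, Matrix.one_mul]
  rw [proj, h1, proj, conjTranspose_mul, conjTranspose_conjTranspose]
  simp only [Matrix.mul_assoc]

end Proj

/-! ### Gaussian matrices and their invariance. -/

section GaussMat

/-- The law of an `m × n` matrix with independent `CN(0,1)` entries. -/
noncomputable def gaussMat (m n : Type*) [Fintype m] [Fintype n] : Measure (Matrix m n ℂ) :=
  (gauss (m × n)).map fun x => Matrix.of fun i j => x (i, j)

variable {m n : Type*} [Fintype m] [Fintype n]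

theorem measurable_of_uncurry :
    Measurable fun (x : m × n → ℂ) => (Matrix.of fun i j => x (i, j) : Matrix m n ℂ) :=
  measurable_matrix_iff.mpr fun _ _ => measurable_pi_apply _

instance : IsProbabilityMeasure (gaussMat m n) :=
  Measure.isProbabilityMeasure_map measurable_of_uncurry.aemeasurable

theorem re_trace_mul_conjTranspose (G : Matrix m n ℂ) :
    (G * Gᴴ).trace.re = ∑ p : m × n, ‖G p.1 p.2‖ ^ 2 := by
  rw [Fintype.sum_prod_type, Matrix.trace, Complex.re_sum]
  refine Finset.sum_congr rfl fun i _ => ?_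
  rw [Matrix.diag, Matrix.mul_apply, Complex.re_sum]
  refine Finset.sum_congr rfl fun j _ => ?_
  rw [conjTranspose_apply, RCLike.star_def, Complex.mul_conj, Complex.ofReal_re,
    Complex.normSq_eq_norm_sq]

theorem measurePreserving_gaussMat (L : Matrix m n ℂ → Matrix m n ℂ)
    (hadd : ∀ A B, L (A + B) = L A + L B) (hsmul : ∀ (c : ℂ) A, L (c • A) = c • L A)
    (hL : ∀ A, (L A * (L A)ᴴ).trace.re = (A * Aᴴ).trace.re) :
    MeasurePreserving L (gaussMat m n) (gaussMat m n) := by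
  let φ : (m × n → ℂ) → Matrix m n ℂ := fun x => Matrix.of fun i j => x (i, j)
  let L' : (m × n → ℂ) →ₗ[ℝ] (m × n → ℂ) :=
    { toFun := fun x p => L (φ x) p.1 p.2
      map_add' := fun x y => by
        funext p
        have : φ (x + y) = φ x + φ y := rfl
        rw [this, hadd]; rfl
      map_smul' := fun c x => by
        funext p
        have : φ (c • x) = (c : ℂ) • φ x := by ext i j; simp [φ]
        rw [this, hsmul]
        simp }
  have hφL : ∀ x, φ (L' x) = L (φ x) := fun x => rfl
  have hL' := measurePreserving_gauss L' fun x => by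
    have := hL (φ x)
    rw [re_trace_mul_conjTranspose, re_trace_mul_conjTranspose] at this
    exact this
  have hmeas : Measurable L := by
    have hψ : Measurable fun A : Matrix m n ℂ => fun p : m × n => A p.1 p.2 :=
      measurable_pi_lambda _ fun p => measurable_id.matrix_entry _ _
    have : L = fun A => φ (L' fun p => A p.1 p.2) := rfl
    rw [this]
    exact measurable_of_uncurry.comp (hL'.measurable.comp hψ)
  refine ⟨hmeas, ?_⟩
  rw [gaussMat, Measure.map_map hmeas measurable_of_uncurry]
  have : L ∘ φ = φ ∘ L' := rfl
  change Measure.map (L ∘ φ) _ = Measure.map φ _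
  rw [this, ← Measure.map_map measurable_of_uncurry hL'.measurable, hL'.map_eq]

theorem measurePreserving_gaussMat_mul_right [DecidableEq n] {V : Matrix n n ℂ}
    (hV : V ∈ unitaryGroup n ℂ) :
    MeasurePreserving (fun G : Matrix m n ℂ => G * V) (gaussMat m n) (gaussMat m n) := by
  refine measurePreserving_gaussMat _ (fun A B => Matrix.add_mul _ _ _)
    (fun c A => Matrix.smul_mul _ _ _) fun A => ?_
  have hV2 : V * Vᴴ = 1 := mem_unitaryGroup_iff.mp hV
  rw [conjTranspose_mul, Matrix.mul_assoc, ← Matrix.mul_assoc V, hV2, Matrix.one_mul]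

theorem measurePreserving_gaussMat_mul_left [DecidableEq m] {V : Matrix m m ℂ}
    (hV : V ∈ unitaryGroup m ℂ) :
    MeasurePreserving (fun G : Matrix m n ℂ => V * G) (gaussMat m n) (gaussMat m n) := by
  refine measurePreserving_gaussMat _ (fun A B => Matrix.mul_add _ _ _)
    (fun c A => Matrix.mul_smul _ _ _) fun A => ?_
  have hV1 : Vᴴ * V = 1 := mem_unitaryGroup_iff'.mp hV
  rw [conjTranspose_mul, trace_mul_comm, Matrix.mul_assoc, ← Matrix.mul_assoc Vᴴ, hV1,
    Matrix.one_mul, trace_mul_comm]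

theorem lintegral_re_trace_gaussMat (r : ℕ) :
    ∫⁻ G : Matrix m n ℂ, ENNReal.ofReal (G * Gᴴ).trace.re ^ r ∂(gaussMat m n) =
      ((Fintype.card m * Fintype.card n).ascFactorial r : ENNReal) := by
  rw [gaussMat, lintegral_map (by fun_prop) measurable_of_uncurry, ← Fintype.card_prod,
    ← lintegral_sum_enorm_pow_gauss]
  refine lintegral_congr fun x => ?_
  rw [re_trace_mul_conjTranspose, ENNReal.ofReal_sum_of_nonneg fun p _ => by positivity]
  congr 1
  refine Finset.sum_congr rfl fun p _ => ?_
  rw [ENNReal.ofReal_pow (norm_nonneg _), ofReal_norm]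
  rfl

/-! ### General position through analyticity. -/

/-- Matrix-valued functions with real-analytic entries. -/
def AnalyticEntries {E a b : Type*} [NormedAddCommGroup E] [NormedSpace ℝ E]
    (f : E → Matrix a b ℂ) : Prop :=
  ∀ i j, AnalyticOnNhd ℝ (fun x => f x i j) Set.univ

namespace AnalyticEntries

variable {E a b c : Type*} [NormedAddCommGroup E] [NormedSpace ℝ E]

theorem const (A : Matrix a b ℂ) : AnalyticEntries fun _ : E => A := fun _ _ => analyticOnNhd_const

theorem mul [Fintype b] {f : E → Matrix a b ℂ} {g : E → Matrix b c ℂ} (hf : AnalyticEntries f)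
    (hg : AnalyticEntries g) : AnalyticEntries fun x => f x * g x := by
  intro i j
  simp only [Matrix.mul_apply]
  exact Finset.analyticOnNhd_fun_sum _ fun k _ => (hf i k).mul (hg k j)

theorem conjTranspose {f : E → Matrix a b ℂ} (hf : AnalyticEntries f) :
    AnalyticEntries fun x => (f x)ᴴ := fun i j =>
  (Complex.conjCLE.toContinuousLinearMap.analyticOnNhd _).comp (hf j i) fun _ _ => Set.mem_univ _

theorem sum {ι : Type*} (s : Finset ι) {f : ι → E → Matrix a b ℂ}
    (hf : ∀ k, AnalyticEntries (f k)) : AnalyticEntries fun x => ∑ k ∈ s, f k x := by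
  intro i j
  simp only [Matrix.sum_apply]
  exact Finset.analyticOnNhd_fun_sum _ fun k _ => hf k i j

theorem trace [Fintype a] {f : E → Matrix a a ℂ} (hf : AnalyticEntries f) :
    AnalyticOnNhd ℝ (fun x => (f x).trace) Set.univ := by
  simp only [Matrix.trace, Matrix.diag]
  exact Finset.analyticOnNhd_fun_sum _ fun k _ => hf k k

theorem det [Fintype a] [DecidableEq a] {f : E → Matrix a a ℂ} (hf : AnalyticEntries f) :
    AnalyticOnNhd ℝ (fun x => (f x).det) Set.univ := by
  simp only [Matrix.det_apply]
  refine Finset.analyticOnNhd_fun_sum _ fun σ _ => ?_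
  have h : AnalyticOnNhd ℝ (fun x => ∏ i, f x (σ i) i) Set.univ :=
    Finset.analyticOnNhd_fun_prod _ fun k _ => hf _ _
  rcases Int.units_eq_one_or (Equiv.Perm.sign σ) with h1 | h1 <;> rw [h1]
  · simpa using h
  · convert h.neg using 1
    funext x
    simp

theorem adjugate [Fintype a] [DecidableEq a] {f : E → Matrix a a ℂ} (hf : AnalyticEntries f) :
    AnalyticEntries fun x => (f x).adjugate := by
  intro i j
  simp only [Matrix.adjugate_apply]
  refine det fun k l => ?_
  by_cases h : k = j
  · subst h; simp only [Matrix.updateRow_self]; exact analyticOnNhd_const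
  · simp only [Matrix.updateRow_ne h]; exact hf k l

end AnalyticEntries

theorem measurableSet_ne_zero {α : Type*} [MeasurableSpace α] {f : α → ℂ} (hf : Measurable f) :
    MeasurableSet {x | f x ≠ 0} :=
  (measurableSet_eq_fun hf measurable_const).compl

theorem ae_gaussMat_ne_zero {F : Matrix m n ℂ → ℂ} (hF : Measurable F)
    (han : AnalyticOnNhd ℝ (fun x : m × n → ℂ => F (Matrix.of fun i j => x (i, j))) Set.univ)
    (G₀ : Matrix m n ℂ) (h₀ : F G₀ ≠ 0) : ∀ᵐ G ∂(gaussMat m n), F G ≠ 0 := by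
  rw [gaussMat, ae_map_iff measurable_of_uncurry.aemeasurable
    (measurableSet_ne_zero hF)]
  exact gauss_zeros_of_analytic _ han (fun p => G₀ p.1 p.2) h₀

theorem analyticEntries_uncurry :
    AnalyticEntries fun x : m × n → ℂ => (Matrix.of fun i j => x (i, j) : Matrix m n ℂ) :=
  fun i j => (ContinuousLinearMap.proj (R := ℝ) (φ := fun _ : m × n => ℂ) (i, j)).analyticOnNhd _

variable [DecidableEq m] [DecidableEq n]

theorem exists_mul_conjTranspose_eq_one (h : Fintype.card m ≤ Fintype.card n) :
    ∃ G : Matrix m n ℂ, G * Gᴴ = 1 := by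
  obtain ⟨e⟩ := Function.Embedding.nonempty_of_card_le h
  refine ⟨Matrix.of fun i j => if j = e i then 1 else 0, ?_⟩
  ext i j
  simp [Matrix.mul_apply, Matrix.one_apply, eq_comm]

theorem ae_det_gaussMat_ne_zero (h : Fintype.card m ≤ Fintype.card n) :
    ∀ᵐ G : Matrix m n ℂ ∂(gaussMat m n), (G * Gᴴ).det ≠ 0 := by
  obtain ⟨G, hG⟩ := exists_mul_conjTranspose_eq_one h
  refine ae_gaussMat_ne_zero (F := fun G => (G * Gᴴ).det) (by fun_prop) ?_ G (by simp [hG])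
  exact (analyticEntries_uncurry.mul analyticEntries_uncurry.conjTranspose).det

/-- The difference `r - tr (p q)` is the squared Frobenius norm of `(1 - q) * p`, so equality forces
the range of `p` into that of `q`. -/
theorem IsProj.eq_of_trace_mul_eq {r : ℕ} {p q : Matrix n n ℂ} (hp : IsProj r p) (hq : IsProj r q)
    (h : (p * q).trace = r) : p = q := by
  have h1 : (((1 - q) * p)ᴴ * ((1 - q) * p)).trace = 0 := by
    rw [conjTranspose_mul, conjTranspose_sub, conjTranspose_one, hp.herm, hq.herm, trace_mul_comm,
      Matrix.mul_assoc, ← Matrix.mul_assoc p, hp.idem, ← Matrix.mul_assoc, trace_mul_comm,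
      ← Matrix.mul_assoc, trace_mul_comm, ← Matrix.mul_assoc]
    have h2 : p * (1 - q) * (1 - q) = p - p * q := by
      simp only [Matrix.mul_sub, Matrix.sub_mul, Matrix.mul_one, Matrix.mul_assoc, hq.idem]
      abel
    rw [h2, trace_sub, h, hp.trace_eq, sub_self]
  have h2 := trace_conjTranspose_mul_self_eq_zero_iff.mp h1
  rw [Matrix.sub_mul, Matrix.one_mul, sub_eq_zero] at h2
  have h3 := congrArg Matrix.conjTranspose h2
  rw [conjTranspose_mul, hp.herm, hq.herm] at h3
  exact hp.eq_of_mul_eq hq h3.symm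

theorem trace_mul_eq_re {p q : Matrix n n ℂ} (hp : pᴴ = p) (hq : qᴴ = q) :
    (p * q).trace = ((p * q).trace.re : ℂ) := by
  have h : star (p * q).trace = (p * q).trace := by
    rw [← trace_conjTranspose, conjTranspose_mul, hp, hq, trace_mul_comm]
  exact (Complex.conj_eq_iff_re.mp h).symm

theorem exists_proj_eq (h : Fintype.card m ≤ Fintype.card n) {p : Matrix n n ℂ}
    (hp : IsProj (Fintype.card m) p) : ∃ G : Matrix m n ℂ, (G * Gᴴ).det ≠ 0 ∧ proj G = p := by
  obtain ⟨G, hG⟩ := exists_mul_conjTranspose_eq_one h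
  have hdet : (G * Gᴴ).det ≠ 0 := by simp [hG]
  obtain ⟨V, hV, rfl⟩ := (isProj_proj hdet).exists_unitary_conj hp
  refine ⟨G * Vᴴ, ?_, proj_mul_conjTranspose hV G⟩
  have hV1 : Vᴴ * V = 1 := mem_unitaryGroup_iff'.mp hV
  rw [conjTranspose_mul, conjTranspose_conjTranspose, Matrix.mul_assoc, ← Matrix.mul_assoc Vᴴ,
    hV1, Matrix.one_mul]
  exact hdet

/-- Distinct projections almost surely have distinct distances to a Gaussian row space. -/
theorem ae_trace_proj_mul_ne (h : Fintype.card m ≤ Fintype.card n) {p q : Matrix n n ℂ}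
    (hp : IsProj (Fintype.card m) p) (hq : IsProj (Fintype.card m) q) (hpq : p ≠ q) :
    ∀ᵐ G : Matrix m n ℂ ∂(gaussMat m n), (proj G * p).trace.re ≠ (proj G * q).trace.re := by
  obtain ⟨G₀, hG₀, hG₀p⟩ := exists_proj_eq h hp
  -- The difference of the overlaps multiplied by `det (G Gᴴ)`. The adjugate replaces the inverse,
  -- so this is analytic in the entries of `G` everywhere; it is nonzero at a `G₀` whose row space
  -- is that of `p`.
  let F : Matrix m n ℂ → ℂ := fun G => (Gᴴ * (G * Gᴴ).adjugate * G * (p - q)).trace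
  have hF : ∀ G : Matrix m n ℂ, (G * Gᴴ).det ≠ 0 →
      F G = (G * Gᴴ).det * ((proj G * p).trace - (proj G * q).trace) := fun G hG => by
    have h1 : (G * Gᴴ).adjugate = (G * Gᴴ).det • (G * Gᴴ)⁻¹ := by
      rw [Matrix.inv_def, smul_smul, Ring.mul_inverse_cancel _ (isUnit_iff_ne_zero.mpr hG),
        one_smul]
    simp only [F]
    rw [h1, Matrix.mul_smul, Matrix.smul_mul, Matrix.smul_mul, trace_smul, Matrix.mul_sub,
      trace_sub, smul_eq_mul, proj]
  have hne : ∀ᵐ G : Matrix m n ℂ ∂(gaussMat m n), F G ≠ 0 := by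
    refine ae_gaussMat_ne_zero (F := F) ?_ ?_ G₀ ?_
    · have : Measurable fun G : Matrix m n ℂ => (G * Gᴴ).adjugate :=
        (Continuous.matrix_adjugate continuous_id).measurable.comp
          (g := fun A : Matrix m m ℂ => A.adjugate) (by fun_prop)
      fun_prop
    · have hG := analyticEntries_uncurry (m := m) (n := n)
      exact (((hG.conjTranspose.mul (hG.mul hG.conjTranspose).adjugate).mul hG).mul
        (AnalyticEntries.const _)).trace
    · rw [hF _ hG₀, hG₀p, hp.idem, hp.trace_eq]
      refine mul_ne_zero hG₀ fun h0 => hpq (hp.eq_of_trace_mul_eq hq ?_)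
      exact (sub_eq_zero.mp h0).symm
  filter_upwards [hne, ae_det_gaussMat_ne_zero h] with G h1 h2 h3
  rw [hF G h2] at h1
  have hG := isProj_proj h2
  rw [trace_mul_eq_re hG.herm hp.herm, trace_mul_eq_re hG.herm hq.herm, h3] at h1
  simp at h1

/-! ### Uniformly distributed subspaces. -/

/-- The uniform law on projections of rank `card m`: the law of the row space of a Gaussian
matrix. -/
noncomputable def projLaw (m n : Type*) [Fintype m] [Fintype n] [DecidableEq m] :
    Measure (Matrix n n ℂ) :=
  (gaussMat m n).map proj

instance : IsProbabilityMeasure (projLaw m n) :=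
  Measure.isProbabilityMeasure_map (by fun_prop)

theorem ae_isProj_projLaw (h : Fintype.card m ≤ Fintype.card n) :
    ∀ᵐ p ∂(projLaw m n), IsProj (Fintype.card m) p := by
  rw [projLaw, ae_map_iff (by fun_prop) (measurableSet_isProj _)]
  filter_upwards [ae_det_gaussMat_ne_zero h] with G hG using isProj_proj hG

theorem projLaw_map_conj {V : Matrix n n ℂ} (hV : V ∈ unitaryGroup n ℂ) :
    (projLaw m n).map (fun p => V * p * Vᴴ) = projLaw m n := by
  have hV' : Vᴴ ∈ unitaryGroup n ℂ := (star (⟨V, hV⟩ : unitaryGroup n ℂ)).2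
  rw [projLaw, Measure.map_map (by fun_prop) (by fun_prop)]
  conv_rhs => rw [← (measurePreserving_gaussMat_mul_right (m := m) hV').map_eq,
    Measure.map_map (by fun_prop) (by fun_prop)]
  congr 1
  funext G
  exact (proj_mul_conjTranspose hV G).symm

theorem IsProj.of_conjTranspose_mul_self {U : Matrix n m ℂ} (hU : Uᴴ * U = 1) :
    IsProj (Fintype.card m) (U * Uᴴ) := by
  refine ⟨?_, ?_, ?_⟩
  · rw [conjTranspose_mul, conjTranspose_conjTranspose]
  · rw [Matrix.mul_assoc, ← Matrix.mul_assoc Uᴴ, hU, Matrix.one_mul]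
  · rw [trace_mul_comm, hU, trace_one]

/-- The column space of an isotropic codeword has the same law as a Gaussian row space. -/
theorem IsIsotropicCodeword.map_eq_projLaw {M N : ℕ} (hMN : M ≤ N)
    {ν : Measure (Matrix (Fin N) (Fin M) ℂ)} (hν : IsIsotropicCodeword ν) :
    ν.map (fun U => U * Uᴴ) = projLaw (Fin M) (Fin N) := by
  obtain ⟨hprob, hunit, hinv⟩ := hν
  have := Measure.isProbabilityMeasure_map (μ := ν)
    (f := fun U : Matrix (Fin N) (Fin M) ℂ => U * Uᴴ) (by fun_prop)
  refine eq_of_conj_invariant (r := Fintype.card (Fin M)) _ _ ?_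
    (ae_isProj_projLaw (by simpa using hMN)) (fun V hV => ?_) (fun V hV => projLaw_map_conj hV)
  · rw [ae_map_iff (by fun_prop) (measurableSet_isProj _)]
    filter_upwards [hunit] with U hU using IsProj.of_conjTranspose_mul_self hU
  · rw [Measure.map_map (by fun_prop) (by fun_prop)]
    exact hinv V hV

theorem measurePreserving_curry {ι κ X : Type*} [Fintype ι] [Fintype κ] [MeasurableSpace X]
    (ν : Measure X) [IsProbabilityMeasure ν] :
    MeasurePreserving (fun (x : κ × ι → X) k i => x (k, i)) (Measure.pi fun _ : κ × ι => ν)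
      (Measure.pi fun _ : κ => Measure.pi fun _ : ι => ν) := by
  refine ⟨by fun_prop, ?_⟩
  have h := Measure.infinitePi_map_curry (ι := κ) (κ := ι) (fun _ _ => ν)
  simp only [Measure.infinitePi_eq_pi] at h
  exact h

theorem measurePreserving_pi_gaussMat {ι : Type*} [Fintype ι] :
    MeasurePreserving (fun (x : ι × (m × n) → ℂ) k => (Matrix.of fun i j => x (k, (i, j)) :
      Matrix m n ℂ)) (gauss (ι × (m × n))) (Measure.pi fun _ : ι => gaussMat m n) :=
  (measurePreserving_pi (fun _ : ι => gauss (m × n)) (fun _ => gaussMat m n)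
    fun _ => ⟨measurable_of_uncurry, rfl⟩).comp (measurePreserving_curry complexNormal)

/-- Independent uniformly distributed subspaces whose dimensions add up to the dimension of the
space almost surely span it. -/
theorem ae_det_sum_ne_zero {ι : Type*} [Fintype ι]
    (hcard : Fintype.card ι * Fintype.card m = Fintype.card n) (hι : 0 < Fintype.card ι) :
    ∀ᵐ p ∂(Measure.pi fun _ : ι => projLaw m n), (∑ k, p k).det ≠ 0 := by
  classical
  have hle : Fintype.card m ≤ Fintype.card n := by
    rw [← hcard]; exact Nat.le_mul_of_pos_left _ hι
  have hpi : (Measure.pi fun _ : ι => projLaw m n) =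
      (Measure.pi fun _ : ι => gaussMat m n).map fun G k => proj (G k) := by
    rw [Measure.pi_map_pi (fun _ => by fun_prop)]
    rfl
  have hmeas : Measurable fun (G : ι → Matrix m n ℂ) k => proj (G k) :=
    measurable_pi_lambda _ fun k => (measurable_pi_apply k).proj
  have hsum : Measurable fun p : ι → Matrix n n ℂ => (∑ k, p k).det :=
    (Measurable.matrix_sum _ fun k => measurable_pi_apply k).matrix_det
  rw [hpi, ae_map_iff hmeas.aemeasurable (measurableSet_ne_zero hsum)]
  have h1 : ∀ᵐ G ∂(Measure.pi fun _ : ι => gaussMat m n), (∑ k, (G k)ᴴ * G k).det ≠ 0 := by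
    have hs2 : Measurable fun G : ι → Matrix m n ℂ => (∑ k, (G k)ᴴ * G k).det :=
      (Measurable.matrix_sum _ fun k => (measurable_pi_apply k).matrix_conjTranspose.matrix_mul
        (measurable_pi_apply k)).matrix_det
    rw [← measurePreserving_pi_gaussMat.map_eq, ae_map_iff
      measurePreserving_pi_gaussMat.measurable.aemeasurable
      (measurableSet_ne_zero hs2)]
    have e : n ≃ ι × m := Fintype.equivOfCardEq (by rw [Fintype.card_prod, hcard])
    have hent : ∀ k, AnalyticEntries fun x : ι × (m × n) → ℂ =>
        (Matrix.of fun i j => x (k, (i, j)) : Matrix m n ℂ) := fun k i j =>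
      (ContinuousLinearMap.proj (R := ℝ) (φ := fun _ : ι × (m × n) => ℂ) (k, (i, j))).analyticOnNhd _
    -- The witness distributes the standard basis vectors over the blocks along `e`, so that the
    -- Gram matrices add up to the identity.
    refine gauss_zeros_of_analytic
      (fun x => (∑ k, (Matrix.of fun i j => x (k, (i, j)) : Matrix m n ℂ)ᴴ *
        (Matrix.of fun i j => x (k, (i, j)) : Matrix m n ℂ)).det)
      (AnalyticEntries.sum _ fun k => (hent k).conjTranspose.mul (hent k)).det
      (fun q => if e q.2.2 = (q.1, q.2.1) then 1 else 0) ?_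
    have : (∑ k, (Matrix.of fun i j => if e j = (k, i) then 1 else 0 : Matrix m n ℂ)ᴴ *
        (Matrix.of fun i j => if e j = (k, i) then 1 else 0 : Matrix m n ℂ)) = 1 := by
      ext a b
      simp only [Matrix.sum_apply, Matrix.mul_apply, conjTranspose_apply, of_apply]
      rw [← Fintype.sum_prod_type' (f := fun k i => star (if e a = (k, i) then (1 : ℂ) else 0) *
        if e b = (k, i) then (1 : ℂ) else 0)]
      simp [Matrix.one_apply, eq_comm]
    simp only [this, det_one]
    exact one_ne_zero
  have h2 : ∀ᵐ G ∂(Measure.pi fun _ : ι => gaussMat m n), ∀ k, (G k * (G k)ᴴ).det ≠ 0 := by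
    rw [ae_all_iff]
    intro k
    exact (Measure.quasiMeasurePreserving_eval (fun _ : ι => gaussMat m n) k).ae
      (ae_det_gaussMat_ne_zero hle)
  filter_upwards [h1, h2] with G hG1 hG2 hdet
  -- A kernel vector of the sum of the projections is killed by each of them, hence by each `G k = G
  -- k * proj (G k)`, against the invertibility of the sum of the Gram matrices.
  obtain ⟨v, hv, hv0⟩ := exists_mulVec_eq_zero_iff.mpr hdet
  have hps : ∀ k, (proj (G k)).PosSemidef := fun k => (isProj_proj (hG2 k)).posSemidef
  have hzero : ∀ k, proj (G k) *ᵥ v = 0 := by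
    have h3 : ∑ k, star v ⬝ᵥ (proj (G k) *ᵥ v) = 0 := by
      rw [← dotProduct_sum, ← Matrix.sum_mulVec, hv0, dotProduct_zero]
    have h4 := (Finset.sum_eq_zero_iff_of_nonneg
      fun k _ => (hps k).dotProduct_mulVec_nonneg v).mp h3
    exact fun k => ((hps k).dotProduct_mulVec_zero_iff v).mp (h4 k (Finset.mem_univ k))
  refine hG1 (exists_mulVec_eq_zero_iff.mp ⟨v, hv, ?_⟩)
  rw [Matrix.sum_mulVec]
  refine Finset.sum_eq_zero fun k _ => ?_
  rw [← mulVec_mulVec]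
  conv_lhs => rw [← mul_proj (hG2 k), ← mulVec_mulVec, hzero k]
  simp

end GaussMat

/-! ### Splitting a Gaussian matrix into independent column blocks. -/

section Split

variable {m a b n : Type*} [Fintype m] [Fintype a] [Fintype b] [Fintype n]

theorem measurePreserving_gaussMat_fromCols (e : a ⊕ b ≃ n) :
    MeasurePreserving (fun p : Matrix m a ℂ × Matrix m b ℂ =>
      (fromCols p.1 p.2).submatrix id e.symm)
      ((gaussMat m a).prod (gaussMat m b)) (gaussMat m n) := by
  have hmeas : Measurable (fun p : Matrix m a ℂ × Matrix m b ℂ =>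
      (fromCols p.1 p.2).submatrix id e.symm) := by
    refine measurable_matrix_iff.mpr fun i j => ?_
    simp only [submatrix_apply, id]
    rcases e.symm j with k | k
    · exact measurable_fst.matrix_entry i k
    · exact measurable_snd.matrix_entry i k
  refine ⟨hmeas, ?_⟩
  let f : m × n ≃ (m × a) ⊕ (m × b) :=
    ((Equiv.refl m).prodCongr e.symm).trans (Equiv.prodSumDistrib m a b)
  have h1 := measurePreserving_sumPiEquivProdPi_symm
    (fun _ : (m × a) ⊕ (m × b) => complexNormal)
  have h2 := (measurePreserving_gauss_comp f.injective).comp h1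
  have h3 := h2.map_eq
  rw [gaussMat, gaussMat, gaussMat, ← h3, Measure.map_prod_map _ _ measurable_of_uncurry
    measurable_of_uncurry, Measure.map_map hmeas
    (measurable_of_uncurry.prodMap measurable_of_uncurry),
    Measure.map_map measurable_of_uncurry h2.measurable]
  change Measure.map _ ((Measure.pi fun _ : m × a => complexNormal).prod
    (Measure.pi fun _ : m × b => complexNormal)) = _
  congr 1
  funext p
  ext i j
  simp only [Function.comp_apply, submatrix_apply, id, of_apply, f, Equiv.trans_apply,
    Equiv.prodCongr_apply, Prod.map_apply, Equiv.refl_apply]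
  rcases e.symm j with k | k <;> rfl

end Split

/-! ### Moments of the determinant of a Gaussian matrix. -/

section DetMoment

theorem enorm_det_unitary {n : Type*} [Fintype n] [DecidableEq n] {V : Matrix n n ℂ}
    (hV : V ∈ unitaryGroup n ℂ) : ‖V.det‖ₑ = 1 := by
  have h := CStarRing.norm_of_mem_unitary (Matrix.det_of_mem_unitary hV)
  rw [← ofReal_norm, h, ENNReal.ofReal_one]

/-- A unitary that rotates the column onto the first coordinate axis. It comes from conjugacy of two
rank-one projections, the one onto `v` and the one onto that axis. -/
theorem exists_unitary_mul_col {M : ℕ} (v : Matrix (Fin (M + 1)) Unit ℂ) :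
    ∃ V ∈ unitaryGroup (Fin (M + 1)) ℂ, (∀ i : Fin M, (V * v) i.succ () = 0) ∧
      ‖(V * v) 0 ()‖ ^ 2 = (v * vᴴ).trace.re := by
  rcases eq_or_ne v 0 with rfl | hv
  · exact ⟨1, one_mem _, by simp, by simp⟩
  have hpos : 0 < (v * vᴴ).trace.re := by
    rw [re_trace_mul_conjTranspose]
    obtain ⟨i, hi⟩ : ∃ i, v i () ≠ 0 := by
      by_contra! h
      exact hv (by ext i j; exact h i)
    refine Finset.sum_pos' (fun p _ => by positivity) ⟨(i, ()), Finset.mem_univ _, ?_⟩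
    have : 0 < ‖v i ()‖ := norm_pos_iff.mpr hi
    positivity
  set c : ℝ := (v * vᴴ).trace.re with hc
  have htr : (vᴴ * v).trace = (c : ℂ) := by
    rw [trace_mul_comm]
    exact Complex.ext rfl (by
      have := (posSemidef_self_mul_conjTranspose v).trace_nonneg
      simpa using (Complex.le_def.mp this).2.symm)
  have hvv : vᴴ * v = (c : ℂ) • 1 := by
    ext i j
    have : (vᴴ * v) () () = (c : ℂ) := by rw [← htr]; simp [Matrix.trace]
    simpa using this
  have hc0 : (c : ℂ) ≠ 0 := Complex.ofReal_ne_zero.mpr hpos.ne'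
  have hp : IsProj 1 ((c : ℂ)⁻¹ • (v * vᴴ)) := by
    refine ⟨?_, ?_, ?_⟩
    · rw [conjTranspose_smul, conjTranspose_mul, conjTranspose_conjTranspose]
      congr 1
      rw [star_inv₀, RCLike.star_def, Complex.conj_ofReal]
    · rw [Matrix.smul_mul, Matrix.mul_smul, Matrix.mul_assoc, ← Matrix.mul_assoc vᴴ, hvv,
        Matrix.smul_mul, Matrix.one_mul, Matrix.mul_smul, smul_smul (c : ℂ)⁻¹ (c : ℂ),
        inv_mul_cancel₀ hc0, one_smul]
    · rw [trace_smul, trace_mul_comm, htr, smul_eq_mul, inv_mul_cancel₀ hc0, Nat.cast_one]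
  have hq : IsProj 1 (diagonal fun i : Fin (M + 1) => if i = 0 then (1 : ℂ) else 0) := by
    refine ⟨?_, ?_, ?_⟩
    · rw [diagonal_conjTranspose]
      congr 1; funext i; by_cases h : i = 0 <;> simp [h]
    · rw [diagonal_mul_diagonal]
      congr 1; funext i; by_cases h : i = 0 <;> simp [h]
    · simp [trace_diagonal]
  obtain ⟨V, hV, hVq⟩ := hp.exists_unitary_conj hq
  have hw : ∀ i, ‖(V * v) i ()‖ ^ 2 = if i = 0 then c else 0 := fun i => by
    have h1 : (V * v) * (V * v)ᴴ =
        (c : ℂ) • diagonal fun i : Fin (M + 1) => if i = 0 then (1 : ℂ) else 0 := by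
      rw [hVq, Matrix.mul_smul, Matrix.smul_mul, smul_smul, mul_inv_cancel₀ hc0, one_smul,
        conjTranspose_mul]
      simp only [Matrix.mul_assoc]
    have h2 := congrFun (congrFun h1 i) i
    rw [Matrix.mul_apply] at h2
    simp only [Finset.univ_unique, Finset.sum_singleton, conjTranspose_apply, RCLike.star_def,
      Complex.mul_conj, Complex.normSq_eq_norm_sq, Matrix.smul_apply, diagonal_apply_eq,
      smul_eq_mul, mul_ite, mul_one, mul_zero] at h2
    by_cases h : i = 0
    · rw [if_pos h] at h2 ⊢; exact Complex.ofReal_inj.mp h2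
    · rw [if_neg h] at h2 ⊢; exact Complex.ofReal_eq_zero.mp h2
  refine ⟨V, hV, fun i => ?_, by rw [hw 0, if_pos rfl]⟩
  have := hw i.succ
  rw [if_neg (Fin.succ_ne_zero i)] at this
  simpa using this

/-- `|det A|²` behaves as a product of independent Gamma variables of shapes `1, …, M`. After
rotating the first column onto the axis, the determinant is its length times a minor of the
remaining columns. The rotation does not change their law, so the minor is a determinant of a
smaller Gaussian matrix, independent of the first column. -/
theorem lintegral_det_gaussMat (M r : ℕ) :
    ∫⁻ A : Matrix (Fin M) (Fin M) ℂ, (‖A.det‖ₑ ^ 2) ^ r ∂(gaussMat (Fin M) (Fin M)) =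
      ((∏ j ∈ Finset.range M, (j + 1).ascFactorial r : ℕ) : ENNReal) := by
  induction M with
  | zero => simp
  | succ M ih =>
    let e : Unit ⊕ Fin M ≃ Fin (M + 1) :=
      (Equiv.sumComm _ _).trans ((Equiv.optionEquivSumPUnit (Fin M)).symm.trans
        (finSuccEquiv M).symm)
    have he0 : e.symm 0 = Sum.inl () := by simp [e]
    rw [← (measurePreserving_gaussMat_fromCols (m := Fin (M + 1)) e).lintegral_comp (by fun_prop)]
    have hmeas : Measurable fun p : Matrix (Fin (M + 1)) Unit ℂ × Matrix (Fin (M + 1)) (Fin M) ℂ =>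
        (‖((fromCols p.1 p.2).submatrix id e.symm).det‖ₑ ^ 2) ^ r := by
      have := (measurePreserving_gaussMat_fromCols (m := Fin (M + 1)) e).measurable.matrix_det
      fun_prop
    rw [lintegral_prod _ hmeas.aemeasurable]
    have hlow : MeasurePreserving (fun B : Matrix (Fin (M + 1)) (Fin M) ℂ => B.submatrix Fin.succ id)
        (gaussMat (Fin (M + 1)) (Fin M)) (gaussMat (Fin M) (Fin M)) := by
      have hm : Measurable fun B : Matrix (Fin (M + 1)) (Fin M) ℂ => B.submatrix Fin.succ id :=
        measurable_matrix_iff.mpr fun i j => measurable_id.matrix_entry _ _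
      refine ⟨hm, ?_⟩
      have hinj : Function.Injective fun p : Fin M × Fin M => (p.1.succ, p.2) := fun p q h => by
        simp only [Prod.mk.injEq, Fin.succ_inj] at h
        exact Prod.ext h.1 h.2
      have hg := measurePreserving_gauss_comp hinj
      rw [gaussMat, gaussMat, ← hg.map_eq, Measure.map_map hm measurable_of_uncurry,
        Measure.map_map measurable_of_uncurry hg.measurable]
      rfl
    have hinner : ∀ v : Matrix (Fin (M + 1)) Unit ℂ,
        ∫⁻ B, (‖((fromCols v B).submatrix id e.symm).det‖ₑ ^ 2) ^ r
          ∂(gaussMat (Fin (M + 1)) (Fin M)) =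
        ENNReal.ofReal (v * vᴴ).trace.re ^ r *
          ((∏ j ∈ Finset.range M, (j + 1).ascFactorial r : ℕ) : ENNReal) := fun v => by
      obtain ⟨V, hV, hV0, hV1⟩ := exists_unitary_mul_col v
      have hdet : ∀ B : Matrix (Fin (M + 1)) (Fin M) ℂ,
          (‖((fromCols v B).submatrix id e.symm).det‖ₑ ^ 2) ^ r =
          ENNReal.ofReal (v * vᴴ).trace.re ^ r *
            (‖((V * B).submatrix Fin.succ id).det‖ₑ ^ 2) ^ r := fun B => by
        have h1 : V * (fromCols v B).submatrix id e.symm =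
            (fromCols (V * v) (V * B)).submatrix id e.symm := by
          rw [← mul_fromCols]
          rfl
        have h2 : ((fromCols (V * v) (V * B)).submatrix id e.symm).det =
            (V * v) 0 () * ((V * B).submatrix Fin.succ id).det := by
          rw [det_succ_column_zero, Fin.sum_univ_succ, Finset.sum_eq_zero, add_zero]
          · simp only [submatrix_apply, id, he0, fromCols_apply_inl, Fin.val_zero, pow_zero,
              one_mul]
            congr 2
          · intro i _
            simp only [submatrix_apply, id, he0, fromCols_apply_inl, hV0]
            simp
        have h3 : ‖((fromCols v B).submatrix id e.symm).det‖ₑ =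
            ‖(V * v) 0 ()‖ₑ * ‖((V * B).submatrix Fin.succ id).det‖ₑ := by
          rw [← enorm_mul, ← h2, ← h1, det_mul, enorm_mul, enorm_det_unitary hV, one_mul]
        rw [h3, mul_pow, mul_pow, ← hV1, ENNReal.ofReal_pow (norm_nonneg _), ofReal_norm]
      simp_rw [hdet]
      have hm2 : Measurable fun B : Matrix (Fin M) (Fin M) ℂ => (‖B.det‖ₑ ^ 2) ^ r := by fun_prop
      rw [lintegral_const_mul' _ _ (ENNReal.pow_ne_top ENNReal.ofReal_ne_top), ← ih,
        ← (hlow.comp (measurePreserving_gaussMat_mul_left hV)).lintegral_comp hm2]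
      rfl
    simp_rw [hinner]
    rw [lintegral_mul_const _ (by fun_prop), lintegral_re_trace_gaussMat, Finset.prod_range_succ]
    simp [mul_comm]

end DetMoment

/-! ### Volume of small balls in the chart of subspaces `[1 | X]`. -/

section Chart

open scoped Kronecker

variable {m r n : Type*} [Fintype m] [Fintype r] [Fintype n] [DecidableEq m] [DecidableEq r]
  [DecidableEq n]

/-- Change of variables `B = A X`. -/
theorem lintegral_mul_left_matrix {A : Matrix m m ℂ} (hA : A.det ≠ 0)
    {f : (m × r → ℂ) → ENNReal} (hf : Measurable f) :
    ∫⁻ B, f B = (‖A.det‖ₑ ^ 2) ^ Fintype.card r *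
      ∫⁻ X : m × r → ℂ, f fun p => ∑ k, A p.1 k * X (k, p.2) := by
  let T : (m × r → ℂ) →ₗ[ℂ] (m × r → ℂ) := Matrix.toLin' (A ⊗ₖ (1 : Matrix r r ℂ))
  let L : (m × r → ℂ) →ₗ[ℝ] (m × r → ℂ) := T.restrictScalars ℝ
  have hL : ∀ X, L X = fun p => ∑ k, A p.1 k * X (k, p.2) := fun X => by
    funext p
    change ((A ⊗ₖ (1 : Matrix r r ℂ)) *ᵥ X) p = _
    rw [Matrix.mulVec, dotProduct, Fintype.sum_prod_type]
    refine Finset.sum_congr rfl fun k _ => ?_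
    simp [Matrix.one_apply]
  -- `A` acts separately on each of the `card r` columns, and the real determinant of a
  -- complex-linear map is the squared modulus of its complex determinant.
  have hdet : LinearMap.det L = (‖A.det‖ ^ 2) ^ Fintype.card r := by
    change LinearMap.det (T.restrictScalars ℝ) = _
    rw [LinearMap.det_restrictScalars, LinearMap.det_toLin', det_kronecker, det_one, one_pow,
      mul_one, Algebra.norm_complex_apply, map_pow, Complex.normSq_eq_norm_sq]
  have hpos : 0 < (‖A.det‖ ^ 2) ^ Fintype.card r := by
    have := norm_pos_iff.mpr hA
    positivity
  have h := Measure.map_linearMap_addHaar_eq_smul_addHaar (volume : Measure (m × r → ℂ))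
    (f := L) (by rw [hdet]; exact hpos.ne')
  have hLm : Measurable L := L.continuous_of_finiteDimensional.measurable
  have h2 : ∫⁻ X : m × r → ℂ, f (L X) = ENNReal.ofReal |(LinearMap.det L)⁻¹| * ∫⁻ B, f B := by
    rw [← lintegral_map hf hLm, h, lintegral_smul_measure, smul_eq_mul]
  simp_rw [← hL]
  rw [h2, hdet, abs_of_pos (inv_pos.mpr hpos), ← mul_assoc, ENNReal.ofReal_inv_of_pos hpos,
    ← ofReal_norm, ← ENNReal.ofReal_pow (norm_nonneg _), ← ENNReal.ofReal_pow (by positivity),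
    ENNReal.mul_inv_cancel (ENNReal.ofReal_pos.mpr hpos).ne' ENNReal.ofReal_ne_top, one_mul]

/-- The squared chordal distance of the row spaces of `[1 | X]` and `[1 | 0]`. -/
noncomputable def chartDist (X : Matrix m r ℂ) : ℝ :=
  Fintype.card m - (1 + X * Xᴴ)⁻¹.trace.re

/-- The `l i` are the eigenvalues of `X Xᴴ`, the squared tangents of the principal angles; `l / (1 +
l)` is then the squared sine. -/
theorem exists_chartDist_eq (X : Matrix m r ℂ) : ∃ l : m → ℝ, (∀ i, 0 ≤ l i) ∧
    (X * Xᴴ).trace.re = ∑ i, l i ∧ chartDist X = ∑ i, l i / (1 + l i) := by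
  have hA := posSemidef_self_mul_conjTranspose X
  obtain ⟨V, hV1, hV2, hV⟩ := exists_spectral hA.1
  refine ⟨hA.1.eigenvalues, hA.eigenvalues_nonneg, ?_, ?_⟩
  · rw [hA.1.trace_eq_sum_eigenvalues]
    change (∑ i, ((hA.1.eigenvalues i : ℝ) : ℂ)).re = _
    rw [← Complex.ofReal_sum, Complex.ofReal_re]
  · have h := inv_one_add_smul_eq hA.eigenvalues_nonneg hV1 hV2 hV 1
    rw [Nat.cast_one, one_smul] at h
    rw [chartDist, h, trace_mul_comm, ← Matrix.mul_assoc, hV1, Matrix.one_mul, trace_diagonal]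
    have h2 : ∀ i, (1 + 1 * (hA.1.eigenvalues i : ℂ))⁻¹ =
        ((1 - hA.1.eigenvalues i / (1 + hA.1.eigenvalues i) : ℝ) : ℂ) := fun i => by
      have := hA.eigenvalues_nonneg i
      have h3 : (1 - hA.1.eigenvalues i / (1 + hA.1.eigenvalues i)) =
        (1 + hA.1.eigenvalues i)⁻¹ := by field_simp; ring
      rw [h3]; push_cast; rw [one_mul]
    simp_rw [h2]
    rw [← Complex.ofReal_sum, Complex.ofReal_re, Finset.sum_sub_distrib]
    simp

theorem chartDist_le (X : Matrix m r ℂ) : chartDist X ≤ (X * Xᴴ).trace.re := by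
  obtain ⟨l, hl, h1, h2⟩ := exists_chartDist_eq X
  rw [h1, h2]
  exact Finset.sum_le_sum fun i _ => div_le_self (hl i) (by linarith [hl i])

/-- Each summand `l / (1 + l)` is at most `z`, so `1 + l ≤ 1 / (1 - z)`. Together with
`chartDist_le`, this places the ball of radius `z` for `chartDist` between the Euclidean balls of
squared radii `z` and `z / (1 - z)`. -/
theorem trace_le_of_chartDist_le {X : Matrix m r ℂ} {z : ℝ} (hz : z < 1) (h : chartDist X ≤ z) :
    (X * Xᴴ).trace.re ≤ z / (1 - z) := by
  obtain ⟨l, hl, h1, h2⟩ := exists_chartDist_eq X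
  have hle : ∀ i, l i / (1 + l i) ≤ z := fun i => by
    rw [h2] at h
    exact (Finset.single_le_sum (f := fun i => l i / (1 + l i))
      (fun i _ => div_nonneg (hl i) (by linarith [hl i])) (Finset.mem_univ i)).trans h
  have hli : ∀ i, l i ≤ l i / (1 + l i) / (1 - z) := fun i => by
    have h3 := hle i
    have h4 := hl i
    rw [div_div, le_div_iff₀ (by nlinarith)]
    rw [div_le_iff₀ (by linarith)] at h3
    nlinarith
  calc (X * Xᴴ).trace.re = ∑ i, l i := h1
    _ ≤ ∑ i, l i / (1 + l i) / (1 - z) := Finset.sum_le_sum fun i _ => hli i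
    _ = chartDist X / (1 - z) := by rw [h2, Finset.sum_div]
    _ ≤ _ := by
      have : 0 < 1 - z := by linarith
      gcongr

theorem trace_proj_fromCols (e : m ⊕ r ≃ n) (A : Matrix m m ℂ) (B : Matrix m r ℂ) :
    (proj ((fromCols A B).submatrix id e.symm) *
      (fromBlocks (1 : Matrix m m ℂ) 0 0 (0 : Matrix r r ℂ)).submatrix e.symm e.symm).trace =
      ((A * Aᴴ + B * Bᴴ)⁻¹ * (A * Aᴴ)).trace := by
  set G := (fromCols A B).submatrix id e.symm with hG
  set q := (fromBlocks (1 : Matrix m m ℂ) 0 0 (0 : Matrix r r ℂ)).submatrix e.symm e.symm with hq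
  have hGH : Gᴴ = (fromRows Aᴴ Bᴴ).submatrix e.symm id := by
    rw [hG, conjTranspose_submatrix, conjTranspose_fromCols_eq_fromRows_conjTranspose]
  have h1 : G * Gᴴ = A * Aᴴ + B * Bᴴ := by
    rw [hGH, hG, submatrix_mul_equiv, fromCols_mul_fromRows, submatrix_id_id]
  have h2 : G * q * Gᴴ = A * Aᴴ := by
    rw [hGH, hG, hq, submatrix_mul_equiv, submatrix_mul_equiv, fromCols_mul_fromBlocks,
      fromCols_mul_fromRows, submatrix_id_id]
    simp
  rw [proj, Matrix.mul_assoc, Matrix.mul_assoc, trace_mul_comm, Matrix.mul_assoc, h2, h1]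

/-- The invertible `A` cancels: `[A | A X]` and `[1 | X]` have the same row space. The right-hand
side is the term in `chartDist`. -/
theorem trace_proj_fromCols_mul (e : m ⊕ r ≃ n) {A : Matrix m m ℂ} (hA : A.det ≠ 0)
    (X : Matrix m r ℂ) :
    (proj ((fromCols A (A * X)).submatrix id e.symm) *
      (fromBlocks (1 : Matrix m m ℂ) 0 0 (0 : Matrix r r ℂ)).submatrix e.symm e.symm).trace =
      (1 + X * Xᴴ)⁻¹.trace := by
  have hu : IsUnit A.det := isUnit_iff_ne_zero.mpr hA
  have hu' : IsUnit (Aᴴ).det := by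
    rw [det_conjTranspose]; exact isUnit_iff_ne_zero.mpr (star_ne_zero.mpr hA)
  have h1 : A * Aᴴ + A * X * (A * X)ᴴ = A * (1 + X * Xᴴ) * Aᴴ := by
    simp only [conjTranspose_mul, Matrix.mul_add, Matrix.add_mul, Matrix.mul_one,
      Matrix.mul_assoc]
  rw [trace_proj_fromCols, h1, Matrix.mul_inv_rev, Matrix.mul_inv_rev]
  calc (Aᴴ⁻¹ * ((1 + X * Xᴴ)⁻¹ * A⁻¹) * (A * Aᴴ)).trace
      = (Aᴴ⁻¹ * ((1 + X * Xᴴ)⁻¹ * (A⁻¹ * A) * Aᴴ)).trace := by simp only [Matrix.mul_assoc]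
    _ = _ := by
      rw [nonsing_inv_mul _ hu, Matrix.mul_one, trace_mul_comm, Matrix.mul_assoc,
        mul_nonsing_inv _ hu', Matrix.mul_one]

theorem isProj_fromBlocks (e : m ⊕ r ≃ n) : IsProj (Fintype.card m)
    ((fromBlocks (1 : Matrix m m ℂ) 0 0 (0 : Matrix r r ℂ)).submatrix e.symm e.symm) := by
  refine ⟨?_, ?_, ?_⟩
  · rw [conjTranspose_submatrix, fromBlocks_conjTranspose]; simp
  · rw [submatrix_mul_equiv, fromBlocks_multiply]; simp
  · have : ((fromBlocks (1 : Matrix m m ℂ) 0 0 (0 : Matrix r r ℂ)).submatrix e.symm e.symm).trace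
        = (fromBlocks (1 : Matrix m m ℂ) 0 0 (0 : Matrix r r ℂ)).trace :=
      Equiv.sum_comp e.symm
        fun i => (fromBlocks (1 : Matrix m m ℂ) 0 0 (0 : Matrix r r ℂ)) i i
    rw [this]; simp [Matrix.trace]

theorem measurableSet_dist_le (q : Matrix n n ℂ) (c z : ℝ) :
    MeasurableSet {p : Matrix n n ℂ | c - (p * q).trace.re ≤ z} := by
  have : Measurable fun p : Matrix n n ℂ => c - (p * q).trace.re :=
    (Complex.measurable_re.comp (by fun_prop)).const_sub c
  exact measurableSet_le this measurable_const

/-- The law of the distance from a uniformly distributed subspace to a fixed one does not depend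
on the latter. -/
theorem projLaw_dist_le_eq {k : ℕ} {q q' : Matrix n n ℂ} (hq : IsProj k q) (hq' : IsProj k q')
    (c z : ℝ) : projLaw m n {p | c - (p * q).trace.re ≤ z} =
      projLaw m n {p | c - (p * q').trace.re ≤ z} := by
  obtain ⟨V, hV, rfl⟩ := hq.exists_unitary_conj hq'
  have hV1 : Vᴴ * V = 1 := mem_unitaryGroup_iff'.mp hV
  conv_rhs => rw [← projLaw_map_conj hV]
  rw [Measure.map_apply (by fun_prop) (measurableSet_dist_le _ _ _)]
  congr 1
  ext p
  have : V * p * Vᴴ * (V * q * Vᴴ) = V * (p * q) * Vᴴ := by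
    calc V * p * Vᴴ * (V * q * Vᴴ) = V * p * (Vᴴ * V) * q * Vᴴ := by
          simp only [Matrix.mul_assoc]
      _ = _ := by rw [hV1, Matrix.mul_one]; simp only [Matrix.mul_assoc]
  simp only [Set.mem_preimage, Set.mem_ofPred_eq, this]
  rw [trace_mul_comm (V * (p * q)), ← Matrix.mul_assoc, hV1, Matrix.one_mul]

/-- The mass of a small ball of subspaces, computed in the chart `X ↦ [1 | X]`. -/
theorem projLaw_dist_le (e : m ⊕ r ≃ n) {q : Matrix n n ℂ} (hq : IsProj (Fintype.card m) q)
    (z : ℝ) :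
    projLaw m n {p | (Fintype.card m : ℝ) - (p * q).trace.re ≤ z} =
      ∫⁻ A : Matrix m m ℂ, (‖A.det‖ₑ ^ 2) ^ Fintype.card r *
        (∫⁻ x in {x : m × r → ℂ | chartDist (Matrix.of fun i j => x (i, j)) ≤ z},
          ENNReal.ofReal (Real.pi⁻¹ ^ Fintype.card (m × r) *
            Real.exp (-∑ p : m × r, ‖∑ k, A p.1 k * x (k, p.2)‖ ^ 2)) ∂volume)
          ∂(gaussMat m m) := by
  set q₀ := (fromBlocks (1 : Matrix m m ℂ) 0 0 (0 : Matrix r r ℂ)).submatrix e.symm e.symm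
    with hq₀
  let φ : (m × r → ℂ) → Matrix m r ℂ := fun x => Matrix.of fun i j => x (i, j)
  have hφ : Measurable φ := measurable_of_uncurry
  have hmp := measurePreserving_gaussMat_fromCols (m := m) e
  let S : Set (Matrix m m ℂ × Matrix m r ℂ) := {p | (Fintype.card m : ℝ) -
      (proj ((fromCols p.1 p.2).submatrix id e.symm) * q₀).trace.re ≤ z}
  have hS : MeasurableSet S := by
    have : Measurable fun p : Matrix m m ℂ × Matrix m r ℂ =>
        proj ((fromCols p.1 p.2).submatrix id e.symm) := hmp.measurable.proj
    exact this (measurableSet_dist_le q₀ _ z)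
  have hchart : Measurable fun x => chartDist (φ x) := by
    unfold chartDist
    exact (Complex.measurable_re.comp (by fun_prop)).const_sub _
  rw [projLaw_dist_le_eq hq (isProj_fromBlocks e), projLaw,
    Measure.map_apply (by fun_prop) (measurableSet_dist_le _ _ _), ← hmp.map_eq,
    Measure.map_apply hmp.measurable
      ((by fun_prop : Measurable (proj : Matrix m n ℂ → _)) (measurableSet_dist_le _ _ _))]
  change ((gaussMat m m).prod (gaussMat m r)) S = _
  rw [Measure.prod_apply hS]
  refine lintegral_congr_ae ?_
  -- For a fixed invertible first block `A`, the second block is substituted as `A X`, after which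
  -- the event involves `X` alone.
  filter_upwards [ae_det_gaussMat_ne_zero (m := m) (n := m) le_rfl] with A hA
  have hA' : A.det ≠ 0 := fun h => hA (by rw [det_mul, h, zero_mul])
  have hSA : MeasurableSet (φ ⁻¹' (Prod.mk A ⁻¹' S)) := hφ (measurable_prodMk_left hS)
  rw [gaussMat, Measure.map_apply hφ (measurable_prodMk_left hS), gauss_eq_withDensity,
    withDensity_apply _ hSA, ← lintegral_indicator hSA, lintegral_mul_left_matrix hA'
      (Measurable.indicator (by fun_prop) hSA), ← lintegral_indicator (measurableSet_le hchart
      measurable_const)]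
  congr 1
  refine lintegral_congr fun x => ?_
  have hmul : φ (fun p => ∑ k, A p.1 k * x (k, p.2)) = A * φ x := by
    ext i j
    simp [φ, Matrix.mul_apply]
  have hiff : (fun p : m × r => ∑ k, A p.1 k * x (k, p.2)) ∈ φ ⁻¹' (Prod.mk A ⁻¹' S) ↔
      x ∈ {x | chartDist (φ x) ≤ z} := by
    simp only [Set.mem_preimage, S, Set.mem_ofPred_eq, hmul, chartDist]
    rw [trace_proj_fromCols_mul e hA']
  by_cases hx : x ∈ {x | chartDist (φ x) ≤ z}
  · rw [Set.indicator_of_mem (hiff.mpr hx), Set.indicator_of_mem hx]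
  · rw [Set.indicator_of_notMem (fun h => hx (hiff.mp h)), Set.indicator_of_notMem hx]

theorem volume_sum_sq_le [Nonempty m] {z : ℝ} (hz : 0 ≤ z) :
    volume {x : m → ℂ | ∑ i, ‖x i‖ ^ 2 ≤ z} =
      ENNReal.ofReal (Real.pi ^ Fintype.card m / (Fintype.card m).factorial *
        z ^ Fintype.card m) := by
  have h := Complex.volume_sum_rpow_le (ι := m) (p := 2) (by norm_num) (Real.sqrt z)
  have hset : {x : m → ℂ | (∑ i, ‖x i‖ ^ (2 : ℝ)) ^ (1 / (2 : ℝ)) ≤ Real.sqrt z} =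
      {x : m → ℂ | ∑ i, ‖x i‖ ^ 2 ≤ z} := by
    ext x
    simp only [Set.mem_ofPred_eq, Real.rpow_two]
    rw [← Real.sqrt_eq_rpow, Real.sqrt_le_sqrt_iff hz]
  rw [hset] at h
  rw [h, ← ENNReal.ofReal_pow (Real.sqrt_nonneg z), ← ENNReal.ofReal_mul (by positivity), pow_mul,
    Real.sq_sqrt hz]
  congr 1
  have h1 : (2 : ℝ) / 2 + 1 = 2 := by norm_num
  have h2 : 2 * (Fintype.card m : ℝ) / 2 + 1 = Fintype.card m + 1 := by ring
  rw [h1, h2, Real.Gamma_two, Real.Gamma_nat_eq_factorial]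
  ring

theorem re_trace_uncurry (x : m × r → ℂ) :
    ((Matrix.of fun i j => x (i, j) : Matrix m r ℂ) *
      (Matrix.of fun i j => x (i, j) : Matrix m r ℂ)ᴴ).trace.re = ∑ p, ‖x p‖ ^ 2 := by
  rw [re_trace_mul_conjTranspose]; rfl

/-- Enlarge the chart ball to the Euclidean ball of squared radius `z / (1 - z)` and bound the
Gaussian exponential by one; the powers of `π` in the density and in the ball volume cancel. -/
theorem projLaw_dist_le_upper [Nonempty m] [Nonempty r] (e : m ⊕ r ≃ n) {q : Matrix n n ℂ}
    (hq : IsProj (Fintype.card m) q) {z : ℝ} (hz : 0 ≤ z) (hz1 : z < 1) :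
    projLaw m n {p | (Fintype.card m : ℝ) - (p * q).trace.re ≤ z} ≤
      (∫⁻ A : Matrix m m ℂ, (‖A.det‖ₑ ^ 2) ^ Fintype.card r ∂(gaussMat m m)) *
        ENNReal.ofReal ((z / (1 - z)) ^ Fintype.card (m × r) /
          (Fintype.card (m × r)).factorial) := by
  rw [projLaw_dist_le e hq, ← lintegral_mul_const _ (by fun_prop)]
  refine lintegral_mono fun A => ?_
  gcongr
  have hz' : 0 ≤ z / (1 - z) := div_nonneg hz (by linarith)
  calc ∫⁻ x in {x : m × r → ℂ | chartDist (Matrix.of fun i j => x (i, j)) ≤ z},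
          ENNReal.ofReal (Real.pi⁻¹ ^ Fintype.card (m × r) *
            Real.exp (-∑ p : m × r, ‖∑ k, A p.1 k * x (k, p.2)‖ ^ 2))
      ≤ ∫⁻ x in {x : m × r → ℂ | ∑ p, ‖x p‖ ^ 2 ≤ z / (1 - z)},
          ENNReal.ofReal (Real.pi⁻¹ ^ Fintype.card (m × r)) := by
        refine lintegral_mono' (Measure.restrict_mono (fun x hx => ?_) le_rfl) fun x => ?_
        · have := trace_le_of_chartDist_le hz1 (Set.mem_ofPred.mp hx)
          rw [re_trace_uncurry] at this
          exact this
        · refine ENNReal.ofReal_le_ofReal (mul_le_of_le_one_right (by positivity) ?_)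
          rw [Real.exp_le_one_iff, neg_nonpos]
          positivity
    _ = _ := by
        rw [lintegral_const, Measure.restrict_apply_univ, volume_sum_sq_le hz',
          ← ENNReal.ofReal_mul (by positivity)]
        congr 1
        have h1 : Real.pi⁻¹ ^ Fintype.card (m × r) * Real.pi ^ Fintype.card (m × r) = 1 := by
          rw [← mul_pow, inv_mul_cancel₀ Real.pi_ne_zero, one_pow]
        linear_combination ((z / (1 - z)) ^ Fintype.card (m × r) /
          (Fintype.card (m × r)).factorial) * h1

/-- Shrink the chart ball to the Euclidean ball of squared radius `z`, where Cauchy–Schwarz bounds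
the exponent by `‖A X‖² ≤ ‖A‖² ‖X‖² ≤ z tr (A Aᴴ)` in Frobenius norms. -/
theorem projLaw_dist_le_lower [Nonempty m] [Nonempty r] (e : m ⊕ r ≃ n) {q : Matrix n n ℂ}
    (hq : IsProj (Fintype.card m) q) {z : ℝ} (hz : 0 ≤ z) :
    (∫⁻ A : Matrix m m ℂ, (‖A.det‖ₑ ^ 2) ^ Fintype.card r *
        ENNReal.ofReal (Real.exp (-(z * (A * Aᴴ).trace.re))) ∂(gaussMat m m)) *
        ENNReal.ofReal (z ^ Fintype.card (m × r) / (Fintype.card (m × r)).factorial) ≤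
      projLaw m n {p | (Fintype.card m : ℝ) - (p * q).trace.re ≤ z} := by
  have hmeas : Measurable fun A : Matrix m m ℂ => (A * Aᴴ).trace.re :=
    Complex.measurable_re.comp (by fun_prop)
  rw [projLaw_dist_le e hq, ← lintegral_mul_const _ (by fun_prop)]
  refine lintegral_mono fun A => ?_
  simp only
  rw [mul_assoc]
  gcongr
  set t := (A * Aᴴ).trace.re with ht
  calc ENNReal.ofReal (Real.exp (-(z * t))) *
        ENNReal.ofReal (z ^ Fintype.card (m × r) / (Fintype.card (m × r)).factorial)
      = ∫⁻ x in {x : m × r → ℂ | ∑ p, ‖x p‖ ^ 2 ≤ z},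
          ENNReal.ofReal (Real.pi⁻¹ ^ Fintype.card (m × r) * Real.exp (-(z * t))) := by
        rw [lintegral_const, Measure.restrict_apply_univ, volume_sum_sq_le hz,
          ← ENNReal.ofReal_mul (by positivity), ← ENNReal.ofReal_mul (by positivity)]
        congr 1
        have h1 : Real.pi⁻¹ ^ Fintype.card (m × r) * Real.pi ^ Fintype.card (m × r) = 1 := by
          rw [← mul_pow, inv_mul_cancel₀ Real.pi_ne_zero, one_pow]
        linear_combination (-Real.exp (-(z * t)) * z ^ Fintype.card (m × r) /
          (Fintype.card (m × r)).factorial) * h1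
    _ ≤ ∫⁻ x in {x : m × r → ℂ | ∑ p, ‖x p‖ ^ 2 ≤ z},
          ENNReal.ofReal (Real.pi⁻¹ ^ Fintype.card (m × r) *
            Real.exp (-∑ p : m × r, ‖∑ k, A p.1 k * x (k, p.2)‖ ^ 2)) := by
        refine setLIntegral_mono' (isClosed_le (by fun_prop) continuous_const).measurableSet
          fun x hx => ?_
        have hx' : ∑ p, ‖x p‖ ^ 2 ≤ z := hx
        refine ENNReal.ofReal_le_ofReal ?_
        gcongr
        have hcs : ∀ p : m × r, ‖∑ k, A p.1 k * x (k, p.2)‖ ^ 2 ≤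
            (∑ k, ‖A p.1 k‖ ^ 2) * ∑ k, ‖x (k, p.2)‖ ^ 2 := fun p => by
          calc ‖∑ k, A p.1 k * x (k, p.2)‖ ^ 2 ≤ (∑ k, ‖A p.1 k‖ * ‖x (k, p.2)‖) ^ 2 := by
                gcongr
                refine (norm_sum_le _ _).trans (le_of_eq ?_)
                simp_rw [norm_mul]
            _ ≤ _ := Finset.sum_mul_sq_le_sq_mul_sq _ _ _
        calc ∑ p : m × r, ‖∑ k, A p.1 k * x (k, p.2)‖ ^ 2
            ≤ ∑ p : m × r, (∑ k, ‖A p.1 k‖ ^ 2) * ∑ k, ‖x (k, p.2)‖ ^ 2 :=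
              Finset.sum_le_sum fun p _ => hcs p
          _ = (∑ p : m × m, ‖A p.1 p.2‖ ^ 2) * ∑ p : m × r, ‖x p‖ ^ 2 := by
              rw [Fintype.sum_prod_type, Fintype.sum_prod_type, Fintype.sum_prod_type_right
                (f := fun p : m × r => ‖x p‖ ^ 2), Finset.sum_mul_sum]
          _ = (∑ p : m × r, ‖x p‖ ^ 2) * t := by
              rw [ht, re_trace_mul_conjTranspose, mul_comm]
          _ ≤ z * t := by
              have : 0 ≤ t := by rw [ht, re_trace_mul_conjTranspose]; positivity
              gcongr
    _ ≤ _ := by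
        refine lintegral_mono' (Measure.restrict_mono (fun x hx => ?_) le_rfl) fun x => le_rfl
        have hx' : ∑ p, ‖x p‖ ^ 2 ≤ z := hx
        have := chartDist_le (Matrix.of fun i j => x (i, j) : Matrix m r ℂ)
        rw [re_trace_uncurry] at this
        exact this.trans hx'

end Chart

/-! ### Asymptotics of the mean minimum distance. -/

section MinDistance

open scoped Topology

/-- Asymptotics of the mean minimum of `m` independent samples of a distribution function that
behaves like `c z ^ n` near the origin. -/
theorem tendsto_integral_one_sub_pow {F : ℝ → ℝ} (hF : Monotone F)
    (h1 : ∀ z, F z ≤ 1) {a : ℝ} (ha : 0 < a) (hFa : ∀ z, a ≤ z → F z = 1) {n : ℕ} (hn : 0 < n)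
    {c : ℝ} (hc : 0 < c) (hlim : Tendsto (fun z => F z / z ^ n) (𝓝[>] 0) (𝓝 c)) :
    Tendsto (fun m : ℕ => (∫ z in Set.Ioi 0, (1 - F z) ^ m) * (c * m) ^ (1 / (n : ℝ))) atTop
      (𝓝 (Real.Gamma (1 / (n : ℝ) + 1))) := by
  have hn' : (0 : ℝ) < n := Nat.cast_pos.mpr hn
  -- A lower bound on all of `(0, a]`, needed for the dominating function. Up to `η` it comes from
  -- the limit, with half the constant; beyond `η` from monotonicity, and the factor `(η / a) ^ n`
  -- makes the bound at `η` suffice up to `a`.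
  obtain ⟨b, hb, hlow⟩ : ∃ b, 0 < b ∧ ∀ z, 0 < z → z ≤ a → b * z ^ n ≤ F z := by
    have hev : ∀ᶠ z in 𝓝[>] (0 : ℝ), c / 2 ≤ F z / z ^ n :=
      (hlim.eventually (lt_mem_nhds (half_lt_self hc))).mono fun z hz => le_of_lt hz
    obtain ⟨ε, hε, hε''⟩ := mem_nhdsGT_iff_exists_Ioo_subset.mp hev
    have hε' : ∀ z, 0 < z → z < ε → c / 2 ≤ F z / z ^ n := fun z h1 h2 => hε'' ⟨h1, h2⟩
    replace hε : (0 : ℝ) < ε := hε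
    have hε2 : 0 < min (ε / 2) a := lt_min (half_pos hε) ha
    set η := min (ε / 2) a with hη
    have hηε : η < ε := (min_le_left _ _).trans_lt (half_lt_self hε)
    refine ⟨c / 2 * (η / a) ^ n, by positivity, fun z hz hza => ?_⟩
    rcases le_total z η with h | h
    · have h3 := hε' z hz (h.trans_lt hηε)
      rw [le_div_iff₀ (by positivity)] at h3
      refine le_trans ?_ h3
      gcongr
      refine mul_le_of_le_one_right (by positivity) (pow_le_one₀ (by positivity) ?_)
      exact (div_le_one ha).mpr (min_le_right _ _)
    · have h3 := hε' η hε2 hηε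
      rw [le_div_iff₀ (by positivity)] at h3
      refine le_trans ?_ (h3.trans (hF h))
      rw [mul_assoc, ← mul_pow]
      gcongr
      rw [div_mul_eq_mul_div, div_le_iff₀ ha]
      gcongr
  -- The scale at which `m F (s m * t)` tends to `t ^ n`, so that the rescaled integrand tends to
  -- `exp (-t ^ n)`.
  set s : ℕ → ℝ := fun m => (c * m) ^ (-(1 / (n : ℝ))) with hs
  have hspos : ∀ m : ℕ, 0 < m → 0 < s m := fun m hm => by
    have : (0 : ℝ) < m := Nat.cast_pos.mpr hm
    positivity
  have hspow : ∀ m : ℕ, 0 < m → ∀ t : ℝ, (s m * t) ^ n = t ^ n / (c * m) := fun m hm t => by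
    have : (0 : ℝ) < m := Nat.cast_pos.mpr hm
    rw [mul_pow, hs]
    simp only
    rw [← Real.rpow_natCast (_ ^ _), ← Real.rpow_mul (by positivity), neg_mul,
      one_div_mul_cancel hn'.ne', Real.rpow_neg_one]
    ring
  have heq : ∀ m : ℕ, 0 < m → (∫ z in Set.Ioi 0, (1 - F z) ^ m) * (c * m) ^ (1 / (n : ℝ)) =
      ∫ t in Set.Ioi 0, (1 - F (s m * t)) ^ m := fun m hm => by
    have h := integral_comp_mul_left_Ioi (fun z => (1 - F z) ^ m) 0 (hspos m hm)
    rw [mul_zero] at h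
    rw [h, smul_eq_mul, mul_comm, hs]
    simp only
    rw [Real.rpow_neg (by positivity), inv_inv]
  have hgamma : ∫ t in Set.Ioi (0 : ℝ), Real.exp (-t ^ n) = Real.Gamma (1 / (n : ℝ) + 1) := by
    rw [← integral_exp_neg_rpow hn']
    simp_rw [Real.rpow_natCast]
  rw [← hgamma]
  refine Tendsto.congr' ((eventually_gt_atTop 0).mono fun m hm => (heq m hm).symm) ?_
  refine tendsto_integral_filter_of_dominated_convergence
    (fun t => Real.exp (-(b / c) * t ^ n)) ?_ ?_ ?_ ?_
  · refine Eventually.of_forall fun m => Measurable.aestronglyMeasurable ?_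
    exact ((hF.measurable.comp (measurable_const_mul _)).const_sub 1).pow_const m
  · filter_upwards [eventually_gt_atTop 0] with m hm
    filter_upwards [ae_restrict_mem measurableSet_Ioi] with t ht
    have hm' : (0 : ℝ) < m := Nat.cast_pos.mpr hm
    have ht' : 0 < s m * t := mul_pos (hspos m hm) ht
    have hnn : 0 ≤ 1 - F (s m * t) := by linarith [h1 (s m * t)]
    rw [Real.norm_of_nonneg (pow_nonneg hnn m)]
    rcases le_total (s m * t) a with h | h
    · have h2 := hlow _ ht' h
      rw [hspow m hm] at h2
      calc (1 - F (s m * t)) ^ m ≤ Real.exp (-F (s m * t)) ^ m := by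
            gcongr; linarith [Real.add_one_le_exp (-F (s m * t))]
        _ = Real.exp (-(m * F (s m * t))) := by rw [← Real.exp_nat_mul]; ring_nf
        _ ≤ _ := by
          refine Real.exp_le_exp.mpr ?_
          rw [neg_mul, neg_le_neg_iff]
          calc b / c * t ^ n = m * (b * (t ^ n / (c * m))) := by field_simp
            _ ≤ _ := by gcongr
    · rw [hFa _ h, sub_self, zero_pow hm.ne']
      positivity
  · have h := integrableOn_rpow_mul_exp_neg_mul_rpow (s := 0) (p := n) (by norm_num) hn'
      (div_pos hb hc)
    simp only [Real.rpow_zero, one_mul, Real.rpow_natCast] at h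
    exact h
  · filter_upwards [ae_restrict_mem measurableSet_Ioi] with t ht
    have ht' : (0 : ℝ) < t := ht
    have hst : Tendsto (fun m : ℕ => s m * t) atTop (𝓝[>] 0) := by
      refine tendsto_nhdsWithin_iff.mpr ⟨?_, (eventually_gt_atTop 0).mono fun m hm =>
        mul_pos (hspos m hm) ht'⟩
      have h3 : Tendsto s atTop (𝓝 0) :=
        (tendsto_rpow_neg_atTop (by positivity)).comp
          (tendsto_natCast_atTop_atTop.const_mul_atTop hc)
      simpa using h3.mul_const t
    have h4 := (hlim.comp hst).mul_const (t ^ n / c)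
    have h5 : Tendsto (fun m : ℕ => (m : ℝ) * -F (s m * t)) atTop (𝓝 (-t ^ n)) := by
      have : c * (t ^ n / c) = t ^ n := by field_simp
      rw [this] at h4
      refine h4.neg.congr' ((eventually_gt_atTop 0).mono fun m hm => ?_)
      have hm' : (0 : ℝ) < m := Nat.cast_pos.mpr hm
      simp only [Function.comp]
      rw [hspow m hm]
      field_simp
    simpa only [← sub_eq_add_neg] using Real.tendsto_one_add_pow_exp_of_tendsto h5

/-- A fixed orthogonal projection of rank `M`. -/
def stdProj (M N : ℕ) : Matrix (Fin N) (Fin N) ℂ :=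
  diagonal fun i => if (i : ℕ) < M then 1 else 0

theorem isProj_stdProj {M N : ℕ} (h : M ≤ N) : IsProj M (stdProj M N) := by
  refine ⟨?_, ?_, ?_⟩
  · rw [stdProj, diagonal_conjTranspose]
    congr 1; funext i; simp only [Pi.star_apply]; split_ifs <;> simp
  · rw [stdProj, diagonal_mul_diagonal]
    congr 1; funext i; split_ifs <;> simp
  · rw [stdProj, trace_diagonal, Finset.sum_boole]
    congr 1
    have : (Finset.univ.filter fun i : Fin N => (i : ℕ) < M) =
        Finset.univ.image (Fin.castLE h) := by
      ext i
      simp only [Finset.mem_filter, Finset.mem_univ, true_and, Finset.mem_image]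
      exact ⟨fun hi => ⟨⟨i, hi⟩, rfl⟩, fun ⟨j, hj⟩ => hj ▸ j.2⟩
    rw [this, Finset.card_image_of_injective _ (Fin.castLE_injective h), Finset.card_univ,
      Fintype.card_fin]

/-- Distribution function of the squared chordal distance from a uniformly distributed subspace
to a fixed one. -/
noncomputable def distCDF (M N : ℕ) (z : ℝ) : ℝ :=
  (projLaw (Fin M) (Fin N)).real {p | (M : ℝ) - (p * stdProj M N).trace.re ≤ z}

theorem distCDF_mono (M N : ℕ) : Monotone (distCDF M N) := fun _ _ h =>
  measureReal_mono fun _ hp => le_trans (Set.mem_ofPred.mp hp) h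

theorem distCDF_le_one (M N : ℕ) (z : ℝ) : distCDF M N z ≤ 1 := measureReal_le_one

theorem distCDF_eq {M N : ℕ} (h : M ≤ N) {q : Matrix (Fin N) (Fin N) ℂ} (hq : IsProj M q)
    (z : ℝ) : (projLaw (Fin M) (Fin N)).real {p | (M : ℝ) - (p * q).trace.re ≤ z} =
      distCDF M N z := by
  rw [distCDF, measureReal_def, measureReal_def, projLaw_dist_le_eq hq (isProj_stdProj h)]

theorem distCDF_eq_one {M N : ℕ} (h : M ≤ N) {z : ℝ} (hz : (M : ℝ) ≤ z) :
    distCDF M N z = 1 := by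
  rw [distCDF, measureReal_def, ← ENNReal.toReal_one]
  congr 1
  refine (mem_ae_iff_prob_eq_one (measurableSet_dist_le (stdProj M N) (M : ℝ) z)).mp ?_
  filter_upwards [ae_isProj_projLaw (m := Fin M) (n := Fin N) (by simpa using h)] with p hp
  have := re_trace_mul_nonneg hp.posSemidef (isProj_stdProj h).posSemidef
  linarith

/-- The normalized volume of small metric balls in the complex Grassmannian. -/
noncomputable def ballConst (M N : ℕ) : ℝ :=
  1 / ((M * (N - M)).factorial : ℝ) *
    ∏ i ∈ Finset.Icc 1 M, ((N - i).factorial : ℝ) / ((M - i).factorial : ℝ)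

theorem ballConst_pos (M N : ℕ) : 0 < ballConst M N := by
  unfold ballConst
  positivity

/-- With `j = M - i` the quotient `(N - i)! / (M - i)!` becomes the rising factorial from `j + 1` of
length `N - M`, the factor that appears in the determinant moment. -/
theorem ballConst_eq {M N : ℕ} (h : M ≤ N) : ballConst M N =
    ((∏ j ∈ Finset.range M, (j + 1).ascFactorial (N - M) : ℕ) : ℝ) /
      ((M * (N - M)).factorial : ℝ) := by
  rw [ballConst, one_div_mul_eq_div]
  congr 1
  push_cast
  refine Finset.prod_bij' (fun i _ => M - i) (fun j _ => M - j) ?_ ?_ ?_ ?_ ?_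
  · intro i hi; simp only [Finset.mem_Icc] at hi; simp only [Finset.mem_range]; omega
  · intro j hj; simp only [Finset.mem_range] at hj; simp only [Finset.mem_Icc]; omega
  · intro i hi; simp only [Finset.mem_Icc] at hi; omega
  · intro j hj; simp only [Finset.mem_range] at hj; omega
  · intro i hi
    simp only [Finset.mem_Icc] at hi
    rw [div_eq_iff (by positivity), ← Nat.cast_mul, mul_comm, Nat.factorial_mul_ascFactorial]
    congr 2; omega

/-- A squeeze between the two ball estimates. The lower constant converges to the determinant moment
by dominated convergence, as the exponential weight tends to one; the upper one carries an extra `(1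
- z) ^ (-n)`. -/
theorem tendsto_distCDF {M N : ℕ} (hM : 0 < M) (hMN : M < N) :
    Tendsto (fun z => distCDF M N z / z ^ (M * (N - M))) (𝓝[>] 0) (𝓝 (ballConst M N)) := by
  have : Nonempty (Fin M) := ⟨⟨0, hM⟩⟩
  have : Nonempty (Fin (N - M)) := ⟨⟨0, by omega⟩⟩
  let e : Fin M ⊕ Fin (N - M) ≃ Fin N := finSumFinEquiv.trans (finCongr (by omega))
  have hq : IsProj (Fintype.card (Fin M)) (stdProj M N) := by
    simpa using isProj_stdProj hMN.le
  set ψ : ℝ → ENNReal := fun z => ∫⁻ A : Matrix (Fin M) (Fin M) ℂ, (‖A.det‖ₑ ^ 2) ^ (N - M) *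
        ENNReal.ofReal (Real.exp (-(z * (A * Aᴴ).trace.re))) ∂(gaussMat (Fin M) (Fin M)) with hψ
  set k : ℕ := ∏ j ∈ Finset.range M, (j + 1).ascFactorial (N - M) with hk
  have hmeas : Measurable fun A : Matrix (Fin M) (Fin M) ℂ => (A * Aᴴ).trace.re :=
    Complex.measurable_re.comp (by fun_prop)
  have hψlim : Tendsto ψ (𝓝[>] 0) (𝓝 (k : ENNReal)) := by
    rw [hk, ← lintegral_det_gaussMat]
    refine tendsto_lintegral_filter_of_dominated_convergence
      (fun A : Matrix (Fin M) (Fin M) ℂ => (‖A.det‖ₑ ^ 2) ^ (N - M)) ?_ ?_ ?_ ?_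
    · exact Eventually.of_forall fun z => by fun_prop
    · filter_upwards [self_mem_nhdsWithin] with z hz
      refine Eventually.of_forall fun A => mul_le_of_le_one_right' ?_
      rw [ENNReal.ofReal_le_one, Real.exp_le_one_iff, neg_nonpos]
      exact mul_nonneg (le_of_lt hz) (re_trace_nonneg (posSemidef_self_mul_conjTranspose A))
    · rw [lintegral_det_gaussMat]; exact ENNReal.natCast_ne_top _
    · refine Eventually.of_forall fun A => ?_
      have h1 : Tendsto (fun z : ℝ => ENNReal.ofReal (Real.exp (-(z * (A * Aᴴ).trace.re))))
          (𝓝[>] 0) (𝓝 1) := by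
        have hcont : Continuous fun z : ℝ =>
            ENNReal.ofReal (Real.exp (-(z * (A * Aᴴ).trace.re))) :=
          ENNReal.continuous_ofReal.comp (by fun_prop)
        simpa using (hcont.tendsto 0).mono_left nhdsWithin_le_nhds
      simpa using ENNReal.Tendsto.const_mul h1 (Or.inl one_ne_zero)
  have hψle : ∀ᶠ z in 𝓝[>] (0 : ℝ), ψ z ≠ ⊤ :=
    (hψlim.eventually (gt_mem_nhds (ENNReal.natCast_lt_top k))).mono
      fun z hz => hz.ne
  set f : ℕ := (M * (N - M)).factorial with hf
  have hf0 : (0 : ℝ) < f := Nat.cast_pos.mpr (Nat.factorial_pos _)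
  have hlow : Tendsto (fun z => (ψ z).toReal / f) (𝓝[>] 0) (𝓝 (ballConst M N)) := by
    rw [ballConst_eq hMN.le]
    have := (ENNReal.tendsto_toReal (ENNReal.natCast_ne_top k)).comp hψlim
    rw [ENNReal.toReal_natCast] at this
    exact this.div_const _
  have hup : Tendsto (fun z : ℝ => ballConst M N * (1 / (1 - z)) ^ (M * (N - M))) (𝓝[>] 0)
      (𝓝 (ballConst M N)) := by
    have : Tendsto (fun z : ℝ => ballConst M N * (1 / (1 - z)) ^ (M * (N - M))) (𝓝 0)
        (𝓝 (ballConst M N * (1 / (1 - 0)) ^ (M * (N - M)))) := by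
      refine Tendsto.const_mul _ (Tendsto.pow (Tendsto.div tendsto_const_nhds ?_ (by norm_num)) _)
      exact tendsto_const_nhds.sub tendsto_id
    simpa using this.mono_left nhdsWithin_le_nhds
  refine tendsto_of_tendsto_of_tendsto_of_le_of_le' hlow hup ?_ ?_
  · filter_upwards [self_mem_nhdsWithin, hψle] with z hz hz2
    have hz' : (0 : ℝ) < z := hz
    have h := projLaw_dist_le_lower e hq hz'.le
    rw [le_div_iff₀ (by positivity), distCDF, measureReal_def]
    have h2 := ENNReal.toReal_mono (measure_ne_top _ _) h
    rw [ENNReal.toReal_mul, ENNReal.toReal_ofReal (by positivity)] at h2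
    simp only [Fintype.card_fin, Fintype.card_prod] at h2
    refine le_trans (le_of_eq ?_) h2
    rw [hψ, hf]; ring
  · have hlt : ∀ᶠ z in 𝓝[>] (0 : ℝ), z < 1 :=
      mem_nhdsWithin_of_mem_nhds (Iio_mem_nhds one_pos)
    filter_upwards [self_mem_nhdsWithin, hlt] with z hz hz1
    have hz' : (0 : ℝ) < z := hz
    have h1z : 0 < 1 - z := by linarith
    have h := projLaw_dist_le_upper e hq hz'.le hz1
    simp only [Fintype.card_fin, Fintype.card_prod] at h
    rw [lintegral_det_gaussMat] at h
    have h2 := ENNReal.toReal_mono (ENNReal.mul_ne_top (ENNReal.natCast_ne_top _)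
      ENNReal.ofReal_ne_top) h
    rw [ENNReal.toReal_mul, ENNReal.toReal_ofReal (by positivity), ENNReal.toReal_natCast] at h2
    rw [div_le_iff₀ (by positivity), distCDF, measureReal_def]
    refine h2.trans (le_of_eq ?_)
    rw [ballConst_eq hMN.le, div_pow, div_pow]
    field_simp
    try ring

/-- Mean squared distance from a fixed subspace to the closest of `2 ^ B` independent uniformly
distributed ones. -/
noncomputable def meanDistortion (M N B : ℕ) : ℝ :=
  ∫ z in Set.Ioi 0, (1 - distCDF M N z) ^ 2 ^ B

theorem meanDistortion_isEquivalent {M N : ℕ} (hM : 0 < M) (hMN : M < N) :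
    (fun B => meanDistortion M N B) ~[atTop] fun B => distortionApprox M N B := by
  set n := M * (N - M) with hn
  have hn0 : 0 < n := Nat.mul_pos hM (by omega)
  have hn0' : (0 : ℝ) < n := Nat.cast_pos.mpr hn0
  have hc := ballConst_pos M N
  have h := tendsto_integral_one_sub_pow (distCDF_mono M N)
    (distCDF_le_one M N) (Nat.cast_pos.mpr hM : (0 : ℝ) < M)
    (fun z hz => distCDF_eq_one hMN.le hz) hn0 hc (tendsto_distCDF hM hMN)
  have h2 := h.comp (tendsto_pow_atTop_atTop_of_one_lt (one_lt_two : 1 < 2))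
  have hΓ : 0 < Real.Gamma (1 / (n : ℝ) + 1) := Real.Gamma_pos_of_pos (by positivity)
  -- The functional equation `Γ(x + 1) = x Γ(x)` at `x = 1 / n` converts the limit constant into the
  -- closed form.
  have happ : ∀ B, distortionApprox M N B =
      Real.Gamma (1 / (n : ℝ) + 1) * (ballConst M N * (2 ^ B : ℕ)) ^ (-(1 / (n : ℝ))) := fun B => by
    have hcast : (M : ℝ) * ((N : ℝ) - M) = n := by rw [hn]; push_cast [hMN.le]; ring
    rw [distortionApprox, hcast, Real.Gamma_add_one (by positivity), ballConst]
    congr 1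
    · ring
    · congr 1
      push_cast
      ring
  have hpos : ∀ B : ℕ, 0 < ballConst M N * (2 ^ B : ℕ) := fun B => by positivity
  refine isEquivalent_of_tendsto_one ?_
  have h3 := h2.div_const (Real.Gamma (1 / (n : ℝ) + 1))
  rw [div_self hΓ.ne'] at h3
  refine h3.congr fun B => ?_
  have hp := hpos B
  simp only [Function.comp, Pi.div_apply]
  rw [happ, meanDistortion, Real.rpow_neg hp.le]
  field_simp

end MinDistance

/-! ### Restricting and resampling coordinates of product measures. -/

section ProductMeasures

variable {ι κ X Y : Type*} [Fintype ι] [Fintype κ] [MeasurableSpace X] [MeasurableSpace Y]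

theorem measurePreserving_pi_comp (ν : Measure X) [IsProbabilityMeasure ν] {f : ι → κ}
    (hf : Function.Injective f) :
    MeasurePreserving (fun (x : κ → X) i => x (f i)) (Measure.pi fun _ => ν)
      (Measure.pi fun _ => ν) := by
  refine ⟨by fun_prop, ?_⟩
  have h1 : iIndepFun (fun (k : κ) (x : κ → X) => x k) (Measure.pi fun _ => ν) :=
    iIndepFun_pi (X := fun _ => id) fun _ => aemeasurable_id
  refine ((h1.precomp hf).map_fun_eq_pi_map
    (fun i => (measurable_pi_apply (f i)).aemeasurable)).trans ?_
  congr 1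
  funext i
  exact (measurePreserving_eval (fun _ : κ => ν) (f i)).map_eq

/-- Resampling one coordinate of a vector of independent identically distributed variables. -/
theorem measurePreserving_update [DecidableEq ι] (ν : Measure X) [IsProbabilityMeasure ν]
    (k : ι) :
    MeasurePreserving (fun q : X × (ι → X) => Function.update q.2 k q.1)
      (ν.prod (Measure.pi fun _ => ν)) (Measure.pi fun _ => ν) := by
  have hm : Measurable fun q : X × (ι → X) => Function.update q.2 k q.1 := by
    refine measurable_pi_lambda _ fun j => ?_
    by_cases h : j = k
    · subst h; simpa using measurable_fst
    · simp only [Function.update_of_ne h]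
      exact (measurable_pi_apply j).comp measurable_snd
  refine ⟨hm, (Measure.pi_eq fun s hs => ?_).symm⟩
  rw [Measure.map_apply hm (.univ_pi hs)]
  have : (fun q : X × (ι → X) => Function.update q.2 k q.1) ⁻¹' Set.univ.pi s =
      s k ×ˢ Set.univ.pi (Function.update s k Set.univ) := by
    ext ⟨x, y⟩
    simp only [Set.mem_preimage, Set.mem_pi, Set.mem_univ, true_imp_iff, Set.mem_prod]
    constructor
    · refine fun h => ⟨by simpa using h k, fun j => ?_⟩
      by_cases hj : j = k
      · subst hj; simp
      · simpa [Function.update_of_ne hj] using h j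
    · rintro ⟨h1, h2⟩ j
      by_cases hj : j = k
      · subst hj; simpa using h1
      · simpa [Function.update_of_ne hj] using h2 j
  rw [this, Measure.prod_prod, Measure.pi_pi, ← Finset.mul_prod_erase _ _ (Finset.mem_univ k),
    ← Finset.mul_prod_erase Finset.univ (fun i => ν (s i)) (Finset.mem_univ k)]
  simp only [Function.update_self, measure_univ, one_mul]
  congr 1
  refine Finset.prod_congr rfl fun j hj => ?_
  rw [Function.update_of_ne (Finset.ne_of_mem_erase hj)]

end ProductMeasures

/-! ### Families of independent uniform subspaces. -/

section ProjPower

variable {m n I : Type*} [Fintype m] [Fintype n] [DecidableEq m] [DecidableEq n] [Fintype I]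

theorem ae_isProj_pi_projLaw (h : Fintype.card m ≤ Fintype.card n) :
    ∀ᵐ p ∂(Measure.pi fun _ : I => projLaw m n), ∀ i, IsProj (Fintype.card m) (p i) := by
  rw [ae_all_iff]
  intro i
  exact (Measure.quasiMeasurePreserving_eval (fun _ : I => projLaw m n) i).ae
    (ae_isProj_projLaw h)

theorem measurePreserving_pi_conj {V : Matrix n n ℂ} (hV : V ∈ unitaryGroup n ℂ) :
    MeasurePreserving (fun (p : I → Matrix n n ℂ) i => V * p i * Vᴴ)
      (Measure.pi fun _ => projLaw m n) (Measure.pi fun _ => projLaw m n) :=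
  measurePreserving_pi _ _ fun _ => ⟨by fun_prop, projLaw_map_conj hV⟩

end ProjPower

/-! ### Codeword selection and its mean distortion. -/

section Selection

variable {m n I : Type*} [Fintype m] [Fintype n] [DecidableEq m] [DecidableEq n]
  [Fintype I] [LinearOrder I]

/-- `i` is the first index at which `v` is maximal. -/
def IsFirstMax (v : I → ℝ) (i : I) : Prop := ∀ j, v j < v i ∨ v j = v i ∧ i ≤ j

theorem exists_isFirstMax [Nonempty I] (v : I → ℝ) : ∃ i, IsFirstMax v i := by
  obtain ⟨i₀, hi₀⟩ := Finite.exists_max v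
  have hne : (Finset.univ.filter fun j => v j = v i₀).Nonempty := ⟨i₀, by simp⟩
  refine ⟨(Finset.univ.filter fun j => v j = v i₀).min' hne, fun j => ?_⟩
  have h1 : v ((Finset.univ.filter fun j => v j = v i₀).min' hne) = v i₀ :=
    (Finset.mem_filter.mp (Finset.min'_mem _ hne)).2
  rw [h1]
  rcases (hi₀ j).lt_or_eq with h | h
  · exact Or.inl h
  · exact Or.inr ⟨h, Finset.min'_le _ _ (by simp [h])⟩

theorem IsFirstMax.le {v : I → ℝ} {i : I} (h : IsFirstMax v i) (j : I) : v j ≤ v i := by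
  rcases h j with h | h
  · exact h.le
  · exact h.1.le

theorem IsFirstMax.unique {v : I → ℝ} {i j : I} (hi : IsFirstMax v i) (hj : IsFirstMax v j) :
    i = j := by
  have h : v i = v j := le_antisymm (hj.le i) (hi.le j)
  rcases hi j with h1 | h1
  · exact absurd h h1.ne'
  rcases hj i with h2 | h2
  · exact absurd h h2.ne
  exact le_antisymm h1.2 h2.2

open Classical in
/-- The codeword with maximal overlap with `q`. -/
noncomputable def csel (q : Matrix n n ℂ) (p : I → Matrix n n ℂ) : Matrix n n ℂ :=
  ∑ i, if IsFirstMax (fun j => (q * p j).trace.re) i then p i else 0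

/-- Only the first maximizer contributes to the defining sum. Breaking ties by index makes the
selection single-valued and measurable; by `ae_eq_of_trace_eq`, any other tie rule almost surely
gives the same projection. -/
theorem csel_eq {q : Matrix n n ℂ} {p : I → Matrix n n ℂ} {i : I}
    (h : IsFirstMax (fun j => (q * p j).trace.re) i) : csel q p = p i := by
  classical
  rw [csel, Finset.sum_eq_single i, if_pos h]
  · intro j _ hj
    exact if_neg fun hj' => hj (hj'.unique h)
  · simp

theorem exists_csel_eq [Nonempty I] (q : Matrix n n ℂ) (p : I → Matrix n n ℂ) :
    ∃ i, csel q p = p i ∧ ∀ j, (q * p j).trace.re ≤ (q * p i).trace.re := by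
  obtain ⟨i, hi⟩ := exists_isFirstMax fun j => (q * p j).trace.re
  exact ⟨i, csel_eq hi, hi.le⟩

theorem csel_conj [Nonempty I] {V : Matrix n n ℂ} (hV : V ∈ unitaryGroup n ℂ) (q : Matrix n n ℂ)
    (p : I → Matrix n n ℂ) :
    csel (V * q * Vᴴ) (fun i => V * p i * Vᴴ) = V * csel q p * Vᴴ := by
  have hV1 : Vᴴ * V = 1 := mem_unitaryGroup_iff'.mp hV
  have h : ∀ j, (V * q * Vᴴ * (V * p j * Vᴴ)).trace = (q * p j).trace := fun j => by
    calc (V * q * Vᴴ * (V * p j * Vᴴ)).trace = (V * q * (Vᴴ * V) * p j * Vᴴ).trace := by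
          simp only [Matrix.mul_assoc]
      _ = (q * p j).trace := by
        rw [hV1, Matrix.mul_one, trace_mul_comm, Matrix.mul_assoc V, ← Matrix.mul_assoc, hV1,
          Matrix.one_mul]
  obtain ⟨i, hi⟩ := exists_isFirstMax fun j => (q * p j).trace.re
  rw [csel_eq hi, csel_eq (i := i)]
  simpa only [h] using hi

theorem _root_.Measurable.csel {Ω : Type*} [MeasurableSpace Ω] {f : Ω → Matrix n n ℂ}
    {g : Ω → I → Matrix n n ℂ} (hf : Measurable f) (hg : Measurable g) :
    Measurable fun x => csel (f x) (g x) := by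
  classical
  have hgi : ∀ i, Measurable fun x => g x i := fun i => (measurable_pi_apply i).comp hg
  have ho : ∀ i, Measurable fun x => (f x * g x i).trace.re := fun i =>
    Complex.measurable_re.comp (hf.matrix_mul (hgi i)).matrix_trace
  refine Measurable.matrix_sum _ fun i => Measurable.ite ?_ (hgi i) measurable_const
  have : {x | IsFirstMax (fun j => (f x * g x j).trace.re) i} =
      ⋂ j, ({x | (f x * g x j).trace.re < (f x * g x i).trace.re} ∪
        ({x | (f x * g x j).trace.re = (f x * g x i).trace.re} ∩ {_x | i ≤ j})) := by
    ext x
    simp [IsFirstMax]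
  rw [this]
  exact MeasurableSet.iInter fun j => (measurableSet_lt (ho j) (ho i)).union
    ((measurableSet_eq_fun (ho j) (ho i)).inter (MeasurableSet.const _))

/-- The law of a user's data: an uncorrelated channel and the projections of its codewords. -/
noncomputable def userLaw (m n I : Type*) [Fintype m] [Fintype n] [DecidableEq m] [Fintype I] :
    Measure (Matrix m n ℂ × (I → Matrix n n ℂ)) :=
  (gaussMat m n).prod (Measure.pi fun _ => projLaw m n)

instance : IsProbabilityMeasure (userLaw m n I) := by unfold userLaw; infer_instance

/-- The projection of the codeword that is fed back. -/
noncomputable def psel (y : Matrix m n ℂ × (I → Matrix n n ℂ)) : Matrix n n ℂ :=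
  csel (proj y.1) y.2

theorem measurable_psel :
    Measurable (psel : Matrix m n ℂ × (I → Matrix n n ℂ) → Matrix n n ℂ) :=
  Measurable.csel measurable_fst.proj measurable_snd

theorem ae_isProj_userLaw (h : Fintype.card m ≤ Fintype.card n) :
    ∀ᵐ y ∂(userLaw m n I), (y.1 * y.1ᴴ).det ≠ 0 ∧ ∀ i, IsProj (Fintype.card m) (y.2 i) := by
  have h1 := (Measure.quasiMeasurePreserving_fst (μ := gaussMat m n)
    (ν := Measure.pi fun _ : I => projLaw m n)).ae (ae_det_gaussMat_ne_zero h)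
  have h2 := (Measure.quasiMeasurePreserving_snd (μ := gaussMat m n)
    (ν := Measure.pi fun _ : I => projLaw m n)).ae (ae_isProj_pi_projLaw h)
  filter_upwards [h1, h2] with y hy1 hy2 using ⟨hy1, hy2⟩

theorem isProj_csel [Nonempty I] {r : ℕ} (q : Matrix n n ℂ) {p : I → Matrix n n ℂ}
    (hp : ∀ i, IsProj r (p i)) : IsProj r (csel q p) := by
  obtain ⟨i, hi, -⟩ := exists_csel_eq q p
  rw [hi]; exact hp i

/-- Rotating the channel and all codewords together preserves their joint law and rotates the
selected projection. Its law is therefore invariant, and uniqueness identifies it: selection does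
not destroy uniformity. -/
theorem measurePreserving_psel [Nonempty I] (h : Fintype.card m ≤ Fintype.card n) :
    MeasurePreserving psel (userLaw m n I) (projLaw m n) := by
  have hprob : IsProbabilityMeasure ((userLaw m n I).map psel) :=
    Measure.isProbabilityMeasure_map measurable_psel.aemeasurable
  refine ⟨measurable_psel, eq_of_conj_invariant (r := Fintype.card m) _ _ ?_
    (ae_isProj_projLaw h) (fun V hV => ?_) fun V hV => projLaw_map_conj hV⟩
  · rw [ae_map_iff measurable_psel.aemeasurable (measurableSet_isProj _)]
    filter_upwards [ae_isProj_userLaw h] with y hy using isProj_csel _ hy.2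
  · have hV' : Vᴴ ∈ unitaryGroup n ℂ := (star (⟨V, hV⟩ : unitaryGroup n ℂ)).2
    have hmp : MeasurePreserving (Prod.map (fun G : Matrix m n ℂ => G * Vᴴ)
        fun (p : I → Matrix n n ℂ) i => V * p i * Vᴴ) (userLaw m n I) (userLaw m n I) :=
      (measurePreserving_gaussMat_mul_right hV').prod (measurePreserving_pi_conj hV)
    rw [Measure.map_map (by fun_prop) measurable_psel]
    conv_rhs => rw [← hmp.map_eq, Measure.map_map measurable_psel hmp.measurable]
    congr 1
    funext y
    simp only [Function.comp, psel, Prod.map_fst, Prod.map_snd]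
    rw [proj_mul_conjTranspose hV, csel_conj hV]

theorem measurePreserving_fst_proj :
    MeasurePreserving (fun y : Matrix m n ℂ × (I → Matrix n n ℂ) => proj y.1) (userLaw m n I)
      (projLaw m n) :=
  (⟨by fun_prop, rfl⟩ : MeasurePreserving proj (gaussMat m n) (projLaw m n)).comp
    measurePreserving_fst

/-- Almost surely, two codewords at the same distance from the channel span the same space. -/
theorem ae_eq_of_trace_eq (h : Fintype.card m ≤ Fintype.card n) :
    ∀ᵐ y ∂(userLaw m n I), ∀ i j, (proj y.1 * y.2 i).trace.re = (proj y.1 * y.2 j).trace.re →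
      y.2 i = y.2 j := by
  simp_rw [ae_all_iff]
  intro i j
  have ho : ∀ i, Measurable fun y : Matrix m n ℂ × (I → Matrix n n ℂ) =>
      (proj y.1 * y.2 i).trace.re := fun i =>
    Complex.measurable_re.comp
      (measurable_fst.proj.matrix_mul ((measurable_pi_apply i).comp measurable_snd)).matrix_trace
  have hset : MeasurableSet {y : Matrix m n ℂ × (I → Matrix n n ℂ) |
      (proj y.1 * y.2 i).trace.re = (proj y.1 * y.2 j).trace.re → y.2 i = y.2 j} := by
    have : {y : Matrix m n ℂ × (I → Matrix n n ℂ) |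
      (proj y.1 * y.2 i).trace.re = (proj y.1 * y.2 j).trace.re → y.2 i = y.2 j} =
        {y | (proj y.1 * y.2 i).trace.re = (proj y.1 * y.2 j).trace.re}ᶜ ∪
          {y | y.2 i = y.2 j} := by
      ext y; simp [imp_iff_not_or]
    rw [this]
    exact (measurableSet_eq_fun (ho i) (ho j)).compl.union
      (measurableSet_eq_fun ((measurable_pi_apply i).comp measurable_snd)
        ((measurable_pi_apply j).comp measurable_snd))
  rw [userLaw, Measure.ae_prod_iff_ae_ae hset, Measure.ae_ae_comm hset]
  filter_upwards [ae_isProj_pi_projLaw (I := I) h] with p hp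
  by_cases hij : p i = p j
  · exact Eventually.of_forall fun _ _ => hij
  · filter_upwards [ae_trace_proj_mul_ne h (hp i) (hp j) hij] with G hG h2 using absurd h2 hG

theorem IsProj.re_trace_mul_mem {r : ℕ} {p q : Matrix n n ℂ} (hp : IsProj r p)
    (hq : IsProj r q) : 0 ≤ (r : ℝ) - (p * q).trace.re ∧ (r : ℝ) - (p * q).trace.re ≤ r := by
  have h1 := re_trace_mul_nonneg hp.posSemidef hq.posSemidef
  have h2 := re_trace_mul_nonneg hp.posSemidef hq.posSemidef_one_sub
  rw [Matrix.mul_sub, Matrix.mul_one, trace_sub, hp.trace_eq, Complex.sub_re,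
    Complex.natCast_re] at h2
  exact ⟨h2, by linarith⟩

theorem integrable_dist_psel [Nonempty I] (h : Fintype.card m ≤ Fintype.card n) :
    Integrable (fun y => (Fintype.card m : ℝ) - (proj y.1 * psel y).trace.re)
      (userLaw m n I) := by
  refine Integrable.of_bound ?_ (Fintype.card m : ℝ) ?_
  · exact ((Complex.measurable_re.comp (measurable_fst.proj.matrix_mul
      measurable_psel).matrix_trace).const_sub _).aestronglyMeasurable
  · filter_upwards [ae_isProj_userLaw h] with y hy
    obtain ⟨h1, h2⟩ := (isProj_proj hy.1).re_trace_mul_mem (isProj_csel (proj y.1) hy.2)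
    rw [Real.norm_of_nonneg]
    · exact h2
    · exact h1

/-- By the layer-cake formula only tail probabilities matter. The least distance exceeds `z` exactly
when all distances do; given the channel these are independent, and their law does not depend on the
channel. -/
theorem integral_dist_psel {M N : ℕ} (h : M ≤ N) [Nonempty I] :
    ∫ y, ((M : ℝ) - (proj y.1 * psel y).trace.re) ∂(userLaw (Fin M) (Fin N) I) =
      ∫ z in Set.Ioi 0, (1 - distCDF M N z) ^ Fintype.card I := by
  have hc : Fintype.card (Fin M) ≤ Fintype.card (Fin N) := by simpa using h
  have hint := integrable_dist_psel (I := I) hc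
  rw [Fintype.card_fin] at hint
  rw [hint.integral_eq_integral_meas_lt]
  swap
  · filter_upwards [ae_isProj_userLaw hc] with y hy
    have := ((isProj_proj hy.1).re_trace_mul_mem (isProj_csel (proj y.1) hy.2)).1
    simpa [psel] using this
  refine integral_congr_ae (Eventually.of_forall fun z => ?_)
  let E : Set (Matrix (Fin M) (Fin N) ℂ × (I → Matrix (Fin N) (Fin N) ℂ)) :=
    {y | z < (M : ℝ) - (proj y.1 * psel y).trace.re}
  have hE : MeasurableSet E := measurableSet_lt measurable_const
    ((Complex.measurable_re.comp (measurable_fst.proj.matrix_mul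
      measurable_psel).matrix_trace).const_sub _)
  have hsec : ∀ G : Matrix (Fin M) (Fin N) ℂ, Prod.mk G ⁻¹' E =
      Set.univ.pi fun _ => {p | (M : ℝ) - (p * proj G).trace.re ≤ z}ᶜ := fun G => by
    ext p
    obtain ⟨i, hi, hmax⟩ := exists_csel_eq (proj G) p
    simp only [E, Set.mem_preimage, Set.mem_ofPred_eq, psel, hi, Set.mem_pi, Set.mem_univ,
      true_imp_iff, Set.mem_compl_iff, not_le, trace_mul_comm _ (proj G)]
    exact ⟨fun hz j => by linarith [hmax j], fun hz => hz i⟩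
  have hmeas : userLaw (Fin M) (Fin N) I E =
      ENNReal.ofReal ((1 - distCDF M N z) ^ Fintype.card I) := by
    rw [userLaw, Measure.prod_apply hE]
    have hG : ∀ᵐ G ∂(gaussMat (Fin M) (Fin N)), (Measure.pi fun _ : I => projLaw (Fin M) (Fin N))
        (Prod.mk G ⁻¹' E) = ENNReal.ofReal ((1 - distCDF M N z) ^ Fintype.card I) := by
      filter_upwards [ae_det_gaussMat_ne_zero hc] with G hG
      have hq : IsProj M (proj G) := by simpa using isProj_proj hG
      have h1 : 0 ≤ 1 - distCDF M N z := by linarith [distCDF_le_one M N z]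
      rw [hsec, Measure.pi_pi, Finset.prod_const, Finset.card_univ, ENNReal.ofReal_pow h1,
        ← distCDF_eq h hq, ← probReal_compl_eq_one_sub (measurableSet_dist_le _ _ _),
        ofReal_measureReal]
    rw [lintegral_congr_ae hG, lintegral_const, measure_univ, mul_one]
  change (userLaw (Fin M) (Fin N) I).real E = _
  rw [measureReal_def, hmeas, ENNReal.toReal_ofReal]
  exact pow_nonneg (by linarith [distCDF_le_one M N z]) _

end Selection

/-! ### Rank counts and the block-diagonalization projection. -/

section Ranks

variable {n ι : Type*} [Fintype n] [DecidableEq n] [Fintype ι] [DecidableEq ι]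

theorem rank_add_le_rank_add_rank (A B : Matrix n n ℂ) : (A + B).rank ≤ A.rank + B.rank := by
  unfold Matrix.rank
  rw [Matrix.mulVecLin_add]
  refine (Submodule.finrank_mono (LinearMap.range_add_le _ _)).trans ?_
  exact Submodule.finrank_add_le_finrank_add_finrank _ _

theorem rank_sum_le_sum_rank (s : Finset ι) (f : ι → Matrix n n ℂ) :
    (∑ i ∈ s, f i).rank ≤ ∑ i ∈ s, (f i).rank := by
  induction s using Finset.induction_on with
  | empty => simp
  | insert a s ha ih =>
    rw [Finset.sum_insert ha, Finset.sum_insert ha]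
    exact (rank_add_le_rank_add_rank _ _).trans (Nat.add_le_add_left ih _)

theorem IsProj.rank_eq {r : ℕ} {p : Matrix n n ℂ} (hp : IsProj r p) : p.rank = r := by
  have hA : p.IsHermitian := hp.herm
  rw [hA.rank_eq_card_non_zero_eigs]
  have h := hA.trace_eq_sum_eigenvalues
  rw [hp.trace_eq] at h
  have h2 : ∀ i, ((hA.eigenvalues i : ℝ) : ℂ) = if hA.eigenvalues i ≠ 0 then 1 else 0 :=
    fun i => by
      rcases hp.eigenvalues_eq_zero_or_one i with h | h <;> rw [h] <;> simp
  have h3 : ∑ i, ((hA.eigenvalues i : ℝ) : ℂ) =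
      (Fintype.card {i // hA.eigenvalues i ≠ 0} : ℂ) := by
    rw [Finset.sum_congr rfl fun i _ => h2 i, Finset.sum_boole, Fintype.card_subtype]
  exact_mod_cast (h.trans h3).symm

theorem IsProj.norm_apply_le_one {r : ℕ} {p : Matrix n n ℂ} (hp : IsProj r p) (i j : n) :
    ‖p i j‖ ≤ 1 := by
  have h1 : ∀ i, (p i i).re = ∑ j, ‖p i j‖ ^ 2 := fun i => by
    conv_lhs => rw [← hp.idem, Matrix.mul_apply]
    rw [Complex.re_sum]
    refine Finset.sum_congr rfl fun j _ => ?_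
    have : p j i = star (p i j) := by
      conv_lhs => rw [← hp.herm, conjTranspose_apply]
    rw [this, RCLike.star_def, Complex.mul_conj, Complex.ofReal_re, Complex.normSq_eq_norm_sq]
  have h2 : ∀ j, ‖p i j‖ ^ 2 ≤ (p i i).re := fun j => by
    rw [h1]
    exact Finset.single_le_sum (f := fun j => ‖p i j‖ ^ 2) (fun _ _ => by positivity)
      (Finset.mem_univ j)
  have h3 : (p i i).re ≤ ‖p i i‖ := Complex.re_le_norm _
  have h4 := h2 i
  have h5 : ‖p i i‖ ≤ 1 := by nlinarith [norm_nonneg (p i i)]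
  have h6 := h2 j
  nlinarith [norm_nonneg (p i j)]

/-- If projections whose ranks add up to the dimension span the space, then leaving out one of
them leaves a complement of the full codimension. -/
theorem rank_sum_erase {r : ℕ} {q : ι → Matrix n n ℂ} (hq : ∀ i, IsProj r (q i))
    (hcard : Fintype.card ι * r = Fintype.card n) (hdet : (∑ i, q i).det ≠ 0) (l : ι) :
    (∑ j ∈ Finset.univ.erase l, q j).rank + r = Fintype.card n := by
  have h1 : (∑ i, q i).rank = Fintype.card n :=
    rank_of_isUnit _ ((isUnit_iff_isUnit_det _).mpr (isUnit_iff_ne_zero.mpr hdet))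
  -- Subadditivity of rank is used twice: the remaining projections have total rank at most `(card ι
  -- - 1) * r`, and restoring the omitted one adds at most `r` to reach full rank.
  have h2 := rank_sum_le_sum_rank (Finset.univ.erase l) q
  rw [Finset.sum_congr rfl fun i _ => (hq i).rank_eq, Finset.sum_const, smul_eq_mul,
    Finset.card_erase_of_mem (Finset.mem_univ l), Finset.card_univ] at h2
  rw [← Finset.add_sum_erase _ _ (Finset.mem_univ l)] at h1
  have h3 := rank_add_le_rank_add_rank (q l) (∑ j ∈ Finset.univ.erase l, q j)
  rw [h1, (hq l).rank_eq] at h3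
  have hpos : 1 ≤ Fintype.card ι := Fintype.card_pos_iff.mpr ⟨l⟩
  obtain ⟨c, hc⟩ : ∃ c, Fintype.card ι = c + 1 := ⟨Fintype.card ι - 1, by omega⟩
  rw [hc] at hcard h2
  rw [Nat.add_sub_cancel] at h2
  rw [add_mul, one_mul] at hcard
  omega

/-- The projection onto the orthogonal complement of all subspaces but one. -/
noncomputable def bdProj (l : ι) (q : ι → Matrix n n ℂ) : Matrix n n ℂ :=
  kerProj (∑ j ∈ Finset.univ.erase l, q j)

theorem _root_.Measurable.bdProj {Ω : Type*} [MeasurableSpace Ω] {f : Ω → ι → Matrix n n ℂ}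
    (hf : Measurable f) (l : ι) : Measurable fun x => bdProj l (f x) :=
  (Measurable.matrix_sum _ fun j => (measurable_pi_apply j).comp hf).kerProj

theorem bdProj_update_self (l : ι) (q : ι → Matrix n n ℂ) (p : Matrix n n ℂ) :
    bdProj l (Function.update q l p) = bdProj l q := by
  unfold bdProj
  congr 1
  exact Finset.sum_congr rfl fun j hj => Function.update_of_ne (Finset.ne_of_mem_erase hj) _ _

theorem posSemidef_sum_erase {q : ι → Matrix n n ℂ} (hq : ∀ i, (q i).PosSemidef) (l : ι) :
    (∑ j ∈ Finset.univ.erase l, q j).PosSemidef :=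
  Matrix.posSemidef_sum _ fun j _ => hq j

theorem bdProj_conj {V : Matrix n n ℂ} (hV : V ∈ unitaryGroup n ℂ) {q : ι → Matrix n n ℂ}
    (hq : ∀ i, (q i).PosSemidef) (l : ι) :
    bdProj l (fun j => V * q j * Vᴴ) = V * bdProj l q * Vᴴ := by
  unfold bdProj
  rw [← kerProj_conj (posSemidef_sum_erase hq l) hV, Matrix.mul_sum, Matrix.sum_mul]

theorem norm_kerProj_apply_le_one {A : Matrix n n ℂ} (hA : A.PosSemidef) (i j : n) :
    ‖kerProj A i j‖ ≤ 1 := by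
  have h := rank_le_card_width A
  exact (isProj_kerProj hA (r := Fintype.card n - A.rank) (by omega)).norm_apply_le_one i j

/-- A sum of positive matrices vanishes on a subspace only if each summand does: compressed to that
subspace, the two parts have nonnegative traces adding up to zero. -/
theorem mul_bdProj {q : ι → Matrix n n ℂ} (hq : ∀ i, (q i).PosSemidef) {k l : ι}
    (hkl : k ≠ l) : q k * bdProj l q = 0 := by
  set Z := ∑ j ∈ (Finset.univ.erase l).erase k, q j with hZ
  have hsum : ∑ j ∈ Finset.univ.erase l, q j = q k + Z :=
    (Finset.add_sum_erase _ _ (Finset.mem_erase.mpr ⟨hkl, Finset.mem_univ k⟩)).symm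
  have hZp : Z.PosSemidef := Matrix.posSemidef_sum _ fun j _ => hq j
  have h := mul_kerProj (posSemidef_sum_erase hq l)
  rw [hsum] at h
  unfold bdProj
  rw [hsum]
  set κ := kerProj (q k + Z) with hκ
  have hq1 : (κᴴ * q k * κ).PosSemidef := (hq k).conjTranspose_mul_mul_same κ
  have hq2 : (κᴴ * Z * κ).PosSemidef := hZp.conjTranspose_mul_mul_same κ
  have h0 : κᴴ * q k * κ + κᴴ * Z * κ = 0 := by
    rw [← Matrix.add_mul, ← Matrix.mul_add, Matrix.mul_assoc, h, Matrix.mul_zero]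
  have h3 : (κᴴ * q k * κ).trace = 0 := by
    have ht := congrArg Matrix.trace h0
    rw [trace_add, trace_zero] at ht
    exact ((add_eq_zero_iff_of_nonneg hq1.trace_nonneg hq2.trace_nonneg).mp ht).1
  obtain ⟨C, hC⟩ := exists_eq_mul_conjTranspose (hq k)
  have h4 : (Cᴴ * κ)ᴴ * (Cᴴ * κ) = κᴴ * q k * κ := by
    rw [conjTranspose_mul, conjTranspose_conjTranspose, hC]
    simp only [Matrix.mul_assoc]
  have h5 : Cᴴ * κ = 0 := by
    rw [← trace_conjTranspose_mul_self_eq_zero_iff, h4, h3]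
  rw [hC, Matrix.mul_assoc, h5, Matrix.mul_zero]

end Ranks

/-! ### Entrywise integrals of matrices. -/

section MatrixIntegral

variable {Ω a b c d : Type*} [MeasurableSpace Ω] [Fintype a] [Fintype b] [Fintype c] [Fintype d]

/-- The entrywise integral of a matrix-valued function. -/
noncomputable def matIntegral (μ : Measure Ω) (f : Ω → Matrix a b ℂ) : Matrix a b ℂ :=
  Matrix.of fun i j => ∫ x, f x i j ∂μ

variable {μ : Measure Ω} {f : Ω → Matrix a b ℂ}

theorem integrable_mul_mul_apply (hf : ∀ i j, Integrable (fun x => f x i j) μ)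
    (A : Matrix c a ℂ) (B : Matrix b d ℂ) (i : c) (j : d) :
    Integrable (fun x => (A * f x * B) i j) μ := by
  simp only [Matrix.mul_apply, Finset.sum_mul]
  exact integrable_finsetSum _ fun k _ => integrable_finsetSum _ fun l _ =>
    ((hf l k).const_mul _).mul_const _

theorem matIntegral_mul_mul (hf : ∀ i j, Integrable (fun x => f x i j) μ)
    (A : Matrix c a ℂ) (B : Matrix b d ℂ) :
    matIntegral μ (fun x => A * f x * B) = A * matIntegral μ f * B := by
  ext i j
  simp only [matIntegral, of_apply, Matrix.mul_apply, Finset.sum_mul]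
  rw [integral_finsetSum _ fun k _ => integrable_finsetSum _ fun l _ =>
    ((hf l k).const_mul _).mul_const _]
  refine Finset.sum_congr rfl fun k _ => ?_
  rw [integral_finsetSum _ fun l _ => ((hf l k).const_mul _).mul_const _]
  refine Finset.sum_congr rfl fun l _ => ?_
  rw [integral_mul_const, integral_const_mul]

theorem integral_trace_mul_mul (hf : ∀ i j, Integrable (fun x => f x i j) μ)
    (A : Matrix c a ℂ) (B : Matrix b c ℂ) :
    ∫ x, (A * f x * B).trace ∂μ = (A * matIntegral μ f * B).trace := by
  rw [← matIntegral_mul_mul hf]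
  simp only [Matrix.trace, diag_apply, matIntegral, of_apply]
  exact integral_finsetSum _ fun i _ => integrable_mul_mul_apply hf A B i i

theorem matIntegral_congr_ae {g : Ω → Matrix a b ℂ} (h : f =ᵐ[μ] g) :
    matIntegral μ f = matIntegral μ g := by
  ext i j
  exact integral_congr_ae (h.mono fun x hx => by simp only [hx])

theorem _root_.MeasureTheory.MeasurePreserving.matIntegral_comp {Ω' : Type*} [MeasurableSpace Ω'] {ν : Measure Ω'}
    {φ : Ω' → Ω} (hφ : MeasurePreserving φ ν μ) (hf : Measurable f) :
    matIntegral ν (fun x => f (φ x)) = matIntegral μ f := by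
  ext i j
  simp only [matIntegral, of_apply]
  rw [← hφ.map_eq, integral_map hφ.measurable.aemeasurable
    (hf.matrix_entry i j).aestronglyMeasurable]

end MatrixIntegral

/-! ### Mean projections and mean Gram matrices by symmetry. -/

section Expectations

variable {m n ι I : Type*} [Fintype m] [Fintype n] [DecidableEq m] [DecidableEq n]
  [Fintype ι] [DecidableEq ι] [Fintype I] [LinearOrder I]

theorem ae_isProj_bdProj (hcard : Fintype.card ι * Fintype.card m = Fintype.card n)
    (hι : 0 < Fintype.card ι) :
    ∀ᵐ q ∂(Measure.pi fun _ : ι => projLaw m n), ∀ l, IsProj (Fintype.card m) (bdProj l q) := by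
  have hle : Fintype.card m ≤ Fintype.card n := by
    rw [← hcard]; exact Nat.le_mul_of_pos_left _ hι
  filter_upwards [ae_isProj_pi_projLaw (I := ι) hle, ae_det_sum_ne_zero hcard hι] with q hq hdet l
  exact isProj_kerProj (posSemidef_sum_erase (fun i => (hq i).posSemidef) l)
    (rank_sum_erase hq hcard hdet l)

/-- The mean of the projection `bdProj l`, given the `k`-th subspace. -/
theorem matIntegral_bdProj (hcard : Fintype.card ι * Fintype.card m = Fintype.card n)
    (hm : 0 < Fintype.card m) (hmn : Fintype.card m < Fintype.card n) {k l : ι} (hkl : k ≠ l)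
    {p : Matrix n n ℂ} (hp : IsProj (Fintype.card m) p) :
    matIntegral (Measure.pi fun _ : ι => projLaw m n)
      (fun w => bdProj l (Function.update w k p)) =
        ((Fintype.card m / (Fintype.card n - Fintype.card m) : ℝ) : ℂ) • (1 - p) := by
  have hι : 0 < Fintype.card ι := Fintype.card_pos_iff.mpr ⟨k⟩
  set ν : Measure (ι → Matrix n n ℂ) := Measure.pi fun _ : ι => projLaw m n with hν
  have hups : ∀ {w : ι → Matrix n n ℂ} {p : Matrix n n ℂ}, (∀ i, IsProj (Fintype.card m) (w i)) →
      IsProj (Fintype.card m) p → ∀ i, (Function.update w k p i).PosSemidef := by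
    intro w p hw hp i
    by_cases h : i = k
    · subst h; rw [Function.update_self]; exact hp.posSemidef
    · rw [Function.update_of_ne h]; exact (hw i).posSemidef
  have hmeas : ∀ p : Matrix n n ℂ, Measurable fun w : ι → Matrix n n ℂ =>
      bdProj l (Function.update w k p) := fun p =>
    Measurable.bdProj (measurable_update_left) l
  have hae : ∀ᵐ w ∂ν, ∀ i, IsProj (Fintype.card m) (w i) := ae_isProj_pi_projLaw hmn.le
  have hint : ∀ p, IsProj (Fintype.card m) p → ∀ i j,
      Integrable (fun w => bdProj l (Function.update w k p) i j) ν := fun p hp i j => by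
    refine Integrable.of_bound ((hmeas p).matrix_entry i j).aestronglyMeasurable 1 ?_
    filter_upwards [hae] with w hw
    exact norm_kerProj_apply_le_one (posSemidef_sum_erase (hups hw hp) l) i j
  obtain ⟨α, β, hαβ⟩ := exists_eq_smul_add_smul_of_equivariant (r := Fintype.card m)
    (fun p => matIntegral ν (fun w => bdProj l (Function.update w k p))) fun V hV p hp => by
      have hmp : MeasurePreserving (fun (w : ι → Matrix n n ℂ) i => V * w i * Vᴴ) ν ν :=
        measurePreserving_pi_conj hV
      rw [← matIntegral_mul_mul (hint p hp), ← MeasurePreserving.matIntegral_comp hmp (hmeas _)]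
      refine matIntegral_congr_ae ?_
      filter_upwards [hae] with w hw
      rw [← bdProj_conj hV (hups hw hp)]
      congr 1
      funext j
      by_cases h : j = k
      · subst h; simp
      · simp [Function.update_of_ne h]
  -- The projection `bdProj l` is annihilated by the subspace of user `k ≠ l`, so its mean has no
  -- component along `p`.
  have hα : α = 0 := by
    have h1 : p * matIntegral ν (fun w => bdProj l (Function.update w k p)) * 1 = 0 := by
      rw [← matIntegral_mul_mul (hint p hp)]
      have h2 : (fun w => p * bdProj l (Function.update w k p) * 1) =ᵐ[ν] fun _ => 0 := by
        filter_upwards [hae] with w hw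
        have := mul_bdProj (hups hw hp) hkl
        rw [Function.update_self] at this
        rw [this, Matrix.zero_mul]
      rw [matIntegral_congr_ae h2]
      ext i j
      simp [matIntegral]
    rw [hαβ p hp, Matrix.mul_one, Matrix.mul_add, Matrix.mul_smul, Matrix.mul_smul, Matrix.mul_sub,
      Matrix.mul_one, hp.idem, sub_self, smul_zero, add_zero] at h1
    have h2 := congrArg Matrix.trace h1
    rw [trace_smul, hp.trace_eq, trace_zero, smul_eq_mul] at h2
    exact (mul_eq_zero.mp h2).resolve_right (Nat.cast_ne_zero.mpr hm.ne')
  -- The trace fixes `β`. The rank of `bdProj` is controlled only for almost every choice of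
  -- subspaces, but `α` and `β` are the same for all of them, so one generic `p'` suffices.
  have hβ : β * (Fintype.card n - Fintype.card m : ℂ) = Fintype.card m := by
    have h1 : ∀ᵐ z ∂((projLaw m n).prod ν), ∀ l', IsProj (Fintype.card m)
        (bdProj l' (Function.update z.2 k z.1)) :=
      (measurePreserving_update (projLaw m n) k).quasiMeasurePreserving.ae
        (ae_isProj_bdProj hcard hι)
    obtain ⟨p', h2, hp'⟩ := ((Measure.ae_ae_of_ae_prod h1).and (ae_isProj_projLaw hmn.le)).exists
    have h3 := integral_trace_mul_mul (hint p' hp') (1 : Matrix n n ℂ) (1 : Matrix n n ℂ)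
    simp only [Matrix.mul_one, Matrix.one_mul] at h3
    rw [hαβ p' hp', hα, zero_smul, zero_add, trace_smul, trace_sub, trace_one, hp'.trace_eq,
      smul_eq_mul] at h3
    rw [← h3]
    have h4 : (fun w => (bdProj l (Function.update w k p')).trace) =ᵐ[ν]
        fun _ => (Fintype.card m : ℂ) := by
      filter_upwards [h2] with w hw using (hw l).trace_eq
    rw [integral_congr_ae h4]
    simp
  have hne : (Fintype.card n - Fintype.card m : ℂ) ≠ 0 := by
    rw [sub_ne_zero]; exact_mod_cast hmn.ne'
  rw [hαβ p hp, hα, zero_smul, zero_add]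
  congr 1
  push_cast
  rw [eq_div_iff hne, hβ]

/-- The mean squared distance between a channel and its quantization. -/
noncomputable def meanDist (m n I : Type*) [Fintype m] [Fintype n] [DecidableEq m]
    [DecidableEq n] [Fintype I] [LinearOrder I] : ℝ :=
  ∫ y, ((Fintype.card m : ℝ) - (proj y.1 * psel y).trace.re) ∂(userLaw m n I)

theorem meanDist_nonneg [Nonempty I] (h : Fintype.card m ≤ Fintype.card n) :
    0 ≤ meanDist m n I := by
  refine integral_nonneg_of_ae ?_
  filter_upwards [ae_isProj_userLaw h] with y hy
  exact ((isProj_proj hy.1).re_trace_mul_mem (isProj_csel (proj y.1) hy.2)).1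

/-- Equivariance gives the form of the mean. The number `α * card m` is the mean overlap of a
channel with its quantization, which determines `α` through the distortion. Nothing is needed about
`β`, because the channel annihilates the complement of its own row space. -/
theorem matIntegral_csel [Nonempty I] (h : Fintype.card m ≤ Fintype.card n) :
    ∃ α β : ℂ, (α * Fintype.card m).re = Fintype.card m - meanDist m n I ∧
      (α * Fintype.card m).im = 0 ∧
      ∀ q, IsProj (Fintype.card m) q →
      matIntegral (Measure.pi fun _ : I => projLaw m n) (fun p => csel q p) =
        α • q + β • (1 - q) := by
  set ν : Measure (I → Matrix n n ℂ) := Measure.pi fun _ : I => projLaw m n with hν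
  have hmeas : ∀ q : Matrix n n ℂ, Measurable fun p : I → Matrix n n ℂ => csel q p := fun q =>
    Measurable.csel measurable_const measurable_id
  have hae : ∀ᵐ p ∂ν, ∀ i, IsProj (Fintype.card m) (p i) := ae_isProj_pi_projLaw h
  have hint : ∀ q, ∀ i j, Integrable (fun p => csel q p i j) ν := fun q i j => by
    refine Integrable.of_bound ((hmeas q).matrix_entry i j).aestronglyMeasurable 1 ?_
    filter_upwards [hae] with p hp using (isProj_csel q hp).norm_apply_le_one i j
  obtain ⟨α, β, hαβ⟩ := exists_eq_smul_add_smul_of_equivariant (r := Fintype.card m)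
    (fun q => matIntegral ν (fun p => csel q p)) fun V hV q _ => by
      have hmp : MeasurePreserving (fun (p : I → Matrix n n ℂ) i => V * p i * Vᴴ) ν ν :=
        measurePreserving_pi_conj hV
      rw [← matIntegral_mul_mul (hint q), ← MeasurePreserving.matIntegral_comp hmp (hmeas _)]
      simp_rw [csel_conj hV]
  have htr : ∀ q, IsProj (Fintype.card m) q →
      ∫ p, (q * csel q p).trace ∂ν = α * Fintype.card m := fun q hq => by
    have h1 := integral_trace_mul_mul (hint q) q 1
    simp only [Matrix.mul_one] at h1
    rw [h1, hαβ q hq, Matrix.mul_add, Matrix.mul_smul, Matrix.mul_smul, Matrix.mul_sub,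
      Matrix.mul_one, hq.idem, sub_self, smul_zero, add_zero, trace_smul, hq.trace_eq,
      smul_eq_mul]
  have htr2 : ∀ q, IsProj (Fintype.card m) q →
      ((∫ p, ((Fintype.card m : ℝ) - (q * csel q p).trace.re) ∂ν : ℝ) : ℂ) =
        Fintype.card m - α * Fintype.card m := fun q hq => by
    rw [← htr q hq, ← integral_complex_ofReal]
    have h2 : (fun p => (((Fintype.card m : ℝ) - (q * csel q p).trace.re : ℝ) : ℂ)) =ᵐ[ν]
        fun p => (Fintype.card m : ℂ) - (q * csel q p).trace := by
      filter_upwards [hae] with p hp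
      rw [trace_mul_eq_re hq.herm (isProj_csel q hp).herm]
      simp
    rw [integral_congr_ae h2, integral_sub (integrable_const _), integral_const]
    · simp
    · simp only [Matrix.trace, diag_apply, Matrix.mul_apply]
      exact integrable_finsetSum _ fun i _ => integrable_finsetSum _ fun j _ =>
        (hint q j i).const_mul _
  have hD : ((meanDist m n I : ℝ) : ℂ) = Fintype.card m - α * Fintype.card m := by
    obtain ⟨G₀, hG₀⟩ := (ae_det_gaussMat_ne_zero h).exists
    have hq₀ := isProj_proj hG₀
    rw [meanDist, userLaw, integral_prod _ (integrable_dist_psel h)]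
    have h3 : (fun G : Matrix m n ℂ => ∫ p, ((Fintype.card m : ℝ) -
        (proj G * psel (G, p)).trace.re) ∂ν) =ᵐ[gaussMat m n]
        fun _ => ∫ p, ((Fintype.card m : ℝ) - (proj G₀ * csel (proj G₀) p).trace.re) ∂ν := by
      filter_upwards [ae_det_gaussMat_ne_zero h] with G hG
      have := (htr2 _ (isProj_proj hG)).trans (htr2 _ hq₀).symm
      exact_mod_cast this
    rw [integral_congr_ae h3, integral_const, probReal_univ, one_smul, htr2 _ hq₀]
  refine ⟨α, β, ?_, ?_, hαβ⟩
  · have := congrArg Complex.re hD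
    rw [Complex.ofReal_re, Complex.sub_re, Complex.natCast_re] at this
    linarith
  · have := congrArg Complex.im hD
    rw [Complex.ofReal_im, Complex.sub_im, Complex.natCast_im] at this
    linarith

theorem integrable_re_trace_gaussMat :
    Integrable (fun G : Matrix m n ℂ => (G * Gᴴ).trace.re) (gaussMat m n) := by
  refine ⟨(Complex.measurable_re.comp (by fun_prop)).aestronglyMeasurable, ?_⟩
  have h := lintegral_re_trace_gaussMat (m := m) (n := n) 1
  simp only [pow_one] at h
  rw [hasFiniteIntegral_iff_ofReal (Eventually.of_forall fun G =>
    re_trace_nonneg (posSemidef_self_mul_conjTranspose G)), h]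
  exact ENNReal.natCast_lt_top _

theorem integral_re_trace_gaussMat :
    ∫ G : Matrix m n ℂ, (G * Gᴴ).trace.re ∂(gaussMat m n) =
      Fintype.card m * Fintype.card n := by
  have h := lintegral_re_trace_gaussMat (m := m) (n := n) 1
  simp only [pow_one] at h
  rw [integral_eq_lintegral_of_nonneg_ae (Eventually.of_forall fun G =>
    re_trace_nonneg (posSemidef_self_mul_conjTranspose G))
    (Complex.measurable_re.comp (by fun_prop)).aestronglyMeasurable, h, ENNReal.toReal_natCast]
  simp [Nat.ascFactorial_succ]

theorem norm_mul_norm_le_re_trace (G : Matrix m n ℂ) (p q : m × n) :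
    ‖G p.1 p.2‖ * ‖G q.1 q.2‖ ≤ (G * Gᴴ).trace.re := by
  have h : ∀ p : m × n, ‖G p.1 p.2‖ ^ 2 ≤ (G * Gᴴ).trace.re := fun p => by
    rw [re_trace_mul_conjTranspose]
    exact Finset.single_le_sum (f := fun p : m × n => ‖G p.1 p.2‖ ^ 2)
      (fun _ _ => by positivity) (Finset.mem_univ p)
  nlinarith [h p, h q, sq_nonneg (‖G p.1 p.2‖ - ‖G q.1 q.2‖)]

/-- A bound for quadratic forms in the channel. -/
theorem norm_trace_quad_le (K : Matrix m m ℂ) (G : Matrix m n ℂ) {κ : Matrix n n ℂ} {c : ℝ}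
    (hκ : ∀ i j, ‖κ i j‖ ≤ c) :
    ‖(K * (G * κ * Gᴴ)).trace‖ ≤
      (∑ i, ∑ j, ‖K i j‖ * (∑ _b : n, ∑ _a : n, c)) * (G * Gᴴ).trace.re := by
  set t := (G * Gᴴ).trace.re
  have hG : ∀ i j a b, ‖G i a * κ a b * Gᴴ b j‖ ≤ c * t := fun i j a b => by
    rw [norm_mul, norm_mul, conjTranspose_apply, norm_star]
    calc ‖G i a‖ * ‖κ a b‖ * ‖G j b‖ = ‖κ a b‖ * (‖G i a‖ * ‖G j b‖) := by ring
      _ ≤ c * t := mul_le_mul (hκ a b) (norm_mul_norm_le_re_trace G (i, a) (j, b))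
        (by positivity) ((norm_nonneg _).trans (hκ a b))
  simp only [Matrix.trace, diag_apply]
  rw [Finset.sum_mul]
  refine (norm_sum_le _ _).trans (Finset.sum_le_sum fun i _ => ?_)
  rw [Matrix.mul_apply, Finset.sum_mul]
  refine (norm_sum_le _ _).trans (Finset.sum_le_sum fun j _ => ?_)
  rw [norm_mul, mul_assoc]
  refine mul_le_mul_of_nonneg_left ?_ (norm_nonneg _)
  rw [Matrix.mul_apply, Finset.sum_mul]
  refine (norm_sum_le _ _).trans (Finset.sum_le_sum fun b _ => ?_)
  rw [Matrix.mul_apply, Finset.sum_mul, Finset.sum_mul]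
  exact (norm_sum_le _ _).trans (Finset.sum_le_sum fun a _ => hG j i a b)

theorem integrable_mul_conjTranspose_apply (i j : m) :
    Integrable (fun G : Matrix m n ℂ => (G * Gᴴ) i j) (gaussMat m n) := by
  have hmeas : Measurable fun G : Matrix m n ℂ => G * Gᴴ := by fun_prop
  refine Integrable.mono' (integrable_re_trace_gaussMat.const_mul (Fintype.card n : ℝ))
    (hmeas.matrix_entry i j).aestronglyMeasurable (Eventually.of_forall fun G => ?_)
  rw [Matrix.mul_apply, ← nsmul_eq_mul, ← Finset.card_univ, ← Finset.sum_const]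
  refine (norm_sum_le _ _).trans (Finset.sum_le_sum fun a _ => ?_)
  rw [norm_mul, conjTranspose_apply, norm_star]
  exact norm_mul_norm_le_re_trace G (i, a) (j, a)

/-- Left unitary invariance makes the mean scalar: the equivariance lemma is applied to a constant
function and read off at the projection `1`. The trace then fixes the scalar. -/
theorem matIntegral_mul_conjTranspose (hm : 0 < Fintype.card m) :
    matIntegral (gaussMat m n) (fun G => G * Gᴴ) = (Fintype.card n : ℂ) • (1 : Matrix m m ℂ) := by
  have hmeas : Measurable fun G : Matrix m n ℂ => G * Gᴴ := by fun_prop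
  have hint := integrable_mul_conjTranspose_apply (m := m) (n := n)
  obtain ⟨α, β, hαβ⟩ := exists_eq_smul_add_smul_of_equivariant (r := Fintype.card m)
    (fun _ => matIntegral (gaussMat m n) (fun G => G * Gᴴ)) fun V hV _ _ => by
      rw [← matIntegral_mul_mul hint]
      conv_lhs => rw [← MeasurePreserving.matIntegral_comp
        (measurePreserving_gaussMat_mul_left hV) hmeas]
      simp only [conjTranspose_mul, Matrix.mul_assoc]
  have h1 : IsProj (Fintype.card m) (1 : Matrix m m ℂ) :=
    ⟨conjTranspose_one, Matrix.one_mul 1, trace_one⟩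
  have h2 := hαβ 1 h1
  simp only [sub_self, smul_zero, add_zero] at h2
  rw [h2]
  congr 1
  have h3 := integral_trace_mul_mul hint (1 : Matrix m m ℂ) (1 : Matrix m m ℂ)
  simp only [Matrix.mul_one, Matrix.one_mul] at h3
  rw [h2, trace_smul, trace_one, smul_eq_mul] at h3
  have h4 : (fun G : Matrix m n ℂ => (G * Gᴴ).trace) = fun G => (((G * Gᴴ).trace.re : ℝ) : ℂ) := by
    funext G
    exact Complex.ext rfl (by
      simpa using (Complex.le_def.mp (posSemidef_self_mul_conjTranspose G).trace_nonneg).2.symm)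
  rw [h4, integral_complex_ofReal, integral_re_trace_gaussMat] at h3
  have hne : (Fintype.card m : ℂ) ≠ 0 := Nat.cast_ne_zero.mpr hm.ne'
  refine mul_right_cancel₀ hne ?_
  rw [← h3]
  push_cast
  ring

end Expectations

/-! ### Mean interference power. -/

section Interference

variable {m n ι I : Type*} [Fintype m] [Fintype n] [DecidableEq m] [DecidableEq n]
  [Fintype ι] [DecidableEq ι] [Fintype I] [LinearOrder I]

/-- Independence across users: the full data of user `k` are kept, while the others enter only
through independent uniform subspaces. Leaving `ψ` general covers both true row spaces (`proj`) and
quantized ones (`psel`). -/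
theorem integral_pi_userLaw_eq {E : Type*} [NormedAddCommGroup E] [NormedSpace ℝ E]
    {ψ : Matrix m n ℂ × (I → Matrix n n ℂ) → Matrix n n ℂ}
    (hψ : MeasurePreserving ψ (userLaw m n I) (projLaw m n)) (k : ι)
    {f : (Matrix m n ℂ × (I → Matrix n n ℂ)) × (ι → Matrix n n ℂ) → E}
    (hf : StronglyMeasurable f) :
    ∫ y, f (y k, fun j => ψ (y j)) ∂(Measure.pi fun _ : ι => userLaw m n I) =
      ∫ z, f (z.1, Function.update z.2 k (ψ z.1))
        ∂((userLaw m n I).prod (Measure.pi fun _ : ι => projLaw m n)) := by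
  have hψm := hψ.measurable
  have hm1 : Measurable fun y : ι → Matrix m n ℂ × (I → Matrix n n ℂ) =>
      (y k, fun j => ψ (y j)) :=
    (measurable_pi_apply k).prodMk
      (measurable_pi_lambda _ fun j => hψm.comp (measurable_pi_apply j))
  have hup := measurePreserving_update (userLaw m n I) k
  have hmp : MeasurePreserving (Prod.map id fun (z : ι → Matrix m n ℂ × (I → Matrix n n ℂ)) j =>
      ψ (z j)) ((userLaw m n I).prod (Measure.pi fun _ : ι => userLaw m n I))
      ((userLaw m n I).prod (Measure.pi fun _ : ι => projLaw m n)) :=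
    (MeasurePreserving.id _).prod (measurePreserving_pi _ _ fun _ => hψ)
  have hm2 : Measurable fun z : (Matrix m n ℂ × (I → Matrix n n ℂ)) × (ι → Matrix n n ℂ) =>
      (z.1, Function.update z.2 k (ψ z.1)) := by
    refine measurable_fst.prodMk (measurable_pi_lambda _ fun j => ?_)
    by_cases h : j = k
    · subst h; simp only [Function.update_self]; exact hψm.comp measurable_fst
    · simp only [Function.update_of_ne h]
      exact (measurable_pi_apply j).comp measurable_snd
  rw [← hup.map_eq, integral_map hup.measurable.aemeasurable
    (f := fun y => f (y k, fun j => ψ (y j))) (hf.comp_measurable hm1).aestronglyMeasurable, ← hmp.map_eq,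
    integral_map hmp.measurable.aemeasurable (f := fun z => f (z.1, Function.update z.2 k (ψ z.1)))
      (hf.comp_measurable hm2).aestronglyMeasurable]
  refine integral_congr_ae (Eventually.of_forall fun q => ?_)
  simp only [Function.update_self, Prod.map_fst, Prod.map_snd, id]
  congr 2
  funext j
  by_cases h : j = k
  · subst h; simp
  · simp [Function.update_of_ne h]

theorem integrable_re_trace_userLaw :
    Integrable (fun y : Matrix m n ℂ × (I → Matrix n n ℂ) => (y.1 * y.1ᴴ).trace.re)
      (userLaw m n I) :=
  (measurePreserving_fst (μ := gaussMat m n)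
    (ν := Measure.pi fun _ : I => projLaw m n)).integrable_comp_of_integrable
    integrable_re_trace_gaussMat

/-- The mean channel energy outside the quantized space. Given `G`, the mean of `psel` acts on `G`
as the scalar `α`, since `G` kills `1 - proj G`. This leaves `1 - α = D / M` times `G Gᴴ`, whose
mean is `N` times the identity. -/
theorem integral_quad_one_sub_psel [Nonempty I] (hm : 0 < Fintype.card m)
    (h : Fintype.card m ≤ Fintype.card n) (K : Matrix m m ℂ) :
    ∫ y, (K * (y.1 * (1 - psel y) * y.1ᴴ)).trace ∂(userLaw m n I) =
      ((Fintype.card n * meanDist m n I / Fintype.card m : ℝ) : ℂ) * K.trace := by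
  have hp := measurable_psel (m := m) (n := n) (I := I)
  have hm0 : (Fintype.card m : ℂ) ≠ 0 := Nat.cast_ne_zero.mpr hm.ne'
  have hmeas : Measurable fun y : Matrix m n ℂ × (I → Matrix n n ℂ) =>
      (K * (y.1 * (1 - psel y) * y.1ᴴ)).trace := by fun_prop
  have hint : Integrable (fun y : Matrix m n ℂ × (I → Matrix n n ℂ) =>
      (K * (y.1 * (1 - psel y) * y.1ᴴ)).trace) (userLaw m n I) := by
    refine Integrable.mono' (integrable_re_trace_userLaw.const_mul
      (∑ i, ∑ j, ‖K i j‖ * (∑ _b : n, ∑ _a : n, 2))) hmeas.aestronglyMeasurable ?_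
    filter_upwards [ae_isProj_userLaw h] with y hy
    refine norm_trace_quad_le K y.1 fun i j => ?_
    have h1 := (isProj_csel (proj y.1) hy.2).norm_apply_le_one i j
    have h2 : ‖(1 : Matrix n n ℂ) i j‖ ≤ 1 := by
      rw [Matrix.one_apply]; split_ifs <;> simp
    calc ‖(1 - psel y) i j‖ ≤ ‖(1 : Matrix n n ℂ) i j‖ + ‖psel y i j‖ := norm_sub_le _ _
      _ ≤ 2 := by unfold psel; linarith
  obtain ⟨α, β, hre, him, hαβ⟩ := matIntegral_csel (m := m) (n := n) (I := I) h
  have hα : 1 - α = ((meanDist m n I / Fintype.card m : ℝ) : ℂ) := by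
    have h1 : α * Fintype.card m = ((Fintype.card m - meanDist m n I : ℝ) : ℂ) :=
      Complex.ext (by simpa using hre) (by simpa using him)
    push_cast at h1 ⊢
    rw [eq_div_iff hm0, sub_mul, h1]
    ring
  rw [userLaw] at hint ⊢
  rw [integral_prod _ hint]
  have hG : (fun G : Matrix m n ℂ => ∫ p, (K * (G * (1 - psel (G, p)) * Gᴴ)).trace
      ∂(Measure.pi fun _ : I => projLaw m n)) =ᵐ[gaussMat m n]
      fun G => (1 - α) * (K * (G * Gᴴ) * 1).trace := by
    filter_upwards [ae_det_gaussMat_ne_zero h] with G hG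
    have hq := isProj_proj hG
    have hc : ∀ i j, Integrable (fun p : I → Matrix n n ℂ => csel (proj G) p i j)
        (Measure.pi fun _ => projLaw m n) := fun i j => by
      refine Integrable.of_bound ((Measurable.csel measurable_const
        measurable_id).matrix_entry i j).aestronglyMeasurable 1 ?_
      filter_upwards [ae_isProj_pi_projLaw h] with p hp
      exact (isProj_csel _ hp).norm_apply_le_one i j
    have hsplit : ∀ p : I → Matrix n n ℂ, (K * (G * (1 - psel (G, p)) * Gᴴ)).trace =
        (K * (G * Gᴴ)).trace - ((K * G) * csel (proj G) p * Gᴴ).trace := fun p => by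
      rw [← trace_sub, psel]
      simp only [Matrix.mul_sub, Matrix.sub_mul, Matrix.mul_one, Matrix.mul_assoc]
    have hGq : G * (1 - proj G) = 0 := by
      rw [Matrix.mul_sub, Matrix.mul_one, mul_proj hG, sub_self]
    have hcint : Integrable (fun p : I → Matrix n n ℂ =>
        ((K * G) * csel (proj G) p * Gᴴ).trace) (Measure.pi fun _ => projLaw m n) := by
      simp only [Matrix.trace, diag_apply]
      exact integrable_finsetSum _ fun i _ => integrable_mul_mul_apply hc _ _ i i
    simp_rw [hsplit]
    rw [integral_sub (integrable_const _) hcint, integral_trace_mul_mul hc, hαβ _ hq,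
      integral_const, probReal_univ, one_smul, Matrix.mul_one, Matrix.mul_add, Matrix.mul_smul,
      Matrix.mul_smul, Matrix.mul_assoc K G (proj G), Matrix.mul_assoc K G (1 - proj G), hGq,
      mul_proj hG, Matrix.mul_zero, smul_zero, add_zero, Matrix.smul_mul, trace_smul,
      Matrix.mul_assoc, smul_eq_mul]
    ring
  have hent : ∀ i j, Integrable (fun G : Matrix m n ℂ => (G * Gᴴ) i j) (gaussMat m n) :=
    integrable_mul_conjTranspose_apply
  rw [integral_congr_ae hG, integral_const_mul, integral_trace_mul_mul hent,
    matIntegral_mul_conjTranspose hm, hα, Matrix.mul_one, Matrix.mul_smul, Matrix.mul_one,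
    trace_smul, smul_eq_mul]
  push_cast
  ring

theorem ae_pi_userLaw [Nonempty I] (hcard : Fintype.card ι * Fintype.card m = Fintype.card n)
    (hι : 0 < Fintype.card ι) :
    ∀ᵐ y ∂(Measure.pi fun _ : ι => userLaw m n I),
      (∀ l, IsProj (Fintype.card m) (bdProj l fun j => psel (y j))) ∧
      ∀ l, IsProj (Fintype.card m) (bdProj l fun j => proj (y j).1) := by
  have hle : Fintype.card m ≤ Fintype.card n := by
    rw [← hcard]; exact Nat.le_mul_of_pos_left _ hι
  have h1 := (measurePreserving_pi (fun _ : ι => userLaw m n I) (fun _ => projLaw m n) fun _ =>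
    measurePreserving_psel hle).quasiMeasurePreserving.ae (ae_isProj_bdProj hcard hι)
  have h2 := (measurePreserving_pi (fun _ : ι => userLaw m n I) (fun _ => projLaw m n) fun _ =>
    measurePreserving_fst_proj).quasiMeasurePreserving.ae (ae_isProj_bdProj hcard hι)
  filter_upwards [h1, h2] with y hy1 hy2 using ⟨hy1, hy2⟩

theorem integrable_quad_bdProj [Nonempty I]
    (hcard : Fintype.card ι * Fintype.card m = Fintype.card n) (k l : ι) (K : Matrix m m ℂ) :
    Integrable (fun y => (K * ((y k).1 * bdProj l (fun j => psel (y j)) * (y k).1ᴴ)).trace)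
      (Measure.pi fun _ : ι => userLaw m n I) := by
  have hp : ∀ j, Measurable fun y : ι → Matrix m n ℂ × (I → Matrix n n ℂ) => psel (y j) :=
    fun j => measurable_psel.comp (measurable_pi_apply j)
  have hb : Measurable fun y : ι → Matrix m n ℂ × (I → Matrix n n ℂ) =>
      bdProj l (fun j => psel (y j)) := (measurable_pi_lambda _ hp).bdProj l
  have hk : Measurable fun y : ι → Matrix m n ℂ × (I → Matrix n n ℂ) => (y k).1 :=
    measurable_fst.comp (measurable_pi_apply k)
  have ht : Integrable (fun y : ι → Matrix m n ℂ × (I → Matrix n n ℂ) =>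
      ((y k).1 * (y k).1ᴴ).trace.re) (Measure.pi fun _ : ι => userLaw m n I) :=
    (measurePreserving_eval (fun _ : ι => userLaw m n I) k).integrable_comp_of_integrable
      integrable_re_trace_userLaw
  refine Integrable.mono' (ht.const_mul (∑ i, ∑ j, ‖K i j‖ * (∑ _b : n, ∑ _a : n, 1)))
    (by fun_prop) ?_
  filter_upwards [ae_pi_userLaw hcard (Fintype.card_pos_iff.mpr ⟨k⟩)] with y hy
  exact norm_trace_quad_le K _ fun i j => (hy.1 l).norm_apply_le_one i j

/-- The mean interference from the precoder of user `l` at user `k`. -/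
theorem integral_quad_bdProj [Nonempty I]
    (hcard : Fintype.card ι * Fintype.card m = Fintype.card n)
    (hm : 0 < Fintype.card m) (hmn : Fintype.card m < Fintype.card n) {k l : ι} (hkl : k ≠ l)
    (K : Matrix m m ℂ) :
    ∫ y, (K * ((y k).1 * bdProj l (fun j => psel (y j)) * (y k).1ᴴ)).trace
        ∂(Measure.pi fun _ : ι => userLaw m n I) =
      ((Fintype.card n * meanDist m n I / (Fintype.card n - Fintype.card m) : ℝ) : ℂ) *
        K.trace := by
  have hmeas : Measurable fun z : (Matrix m n ℂ × (I → Matrix n n ℂ)) × (ι → Matrix n n ℂ) =>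
      (K * (z.1.1 * bdProj l z.2 * z.1.1ᴴ)).trace := by
    have : Measurable fun z : (Matrix m n ℂ × (I → Matrix n n ℂ)) × (ι → Matrix n n ℂ) =>
      bdProj l z.2 := measurable_snd.bdProj l
    fun_prop
  have hp := measurable_psel (m := m) (n := n) (I := I)
  have hupm : Measurable fun z : (Matrix m n ℂ × (I → Matrix n n ℂ)) × (ι → Matrix n n ℂ) =>
      (z.1, Function.update z.2 k (psel z.1)) := by
    refine measurable_fst.prodMk (measurable_pi_lambda _ fun j => ?_)
    by_cases h : j = k
    · subst h; simp only [Function.update_self]; exact hp.comp measurable_fst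
    · simp only [Function.update_of_ne h]
      exact (measurable_pi_apply j).comp measurable_snd
  rw [integral_pi_userLaw_eq (measurePreserving_psel hmn.le) k
    (f := fun z => (K * (z.1.1 * bdProj l z.2 * z.1.1ᴴ)).trace) hmeas.stronglyMeasurable]
  have hae : ∀ᵐ z ∂((userLaw m n I).prod (Measure.pi fun _ : ι => projLaw m n)),
      (∀ i, IsProj (Fintype.card m) (z.1.2 i)) ∧ ∀ i, IsProj (Fintype.card m) (z.2 i) := by
    have h1 := (Measure.quasiMeasurePreserving_fst (μ := userLaw m n I)
      (ν := Measure.pi fun _ : ι => projLaw m n)).ae (ae_isProj_userLaw hmn.le)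
    have h2 := (Measure.quasiMeasurePreserving_snd (μ := userLaw m n I)
      (ν := Measure.pi fun _ : ι => projLaw m n)).ae (ae_isProj_pi_projLaw hmn.le)
    filter_upwards [h1, h2] with z hz1 hz2 using ⟨hz1.2, hz2⟩
  have hups : ∀ {w : ι → Matrix n n ℂ} {p : Matrix n n ℂ}, (∀ i, IsProj (Fintype.card m) (w i)) →
      IsProj (Fintype.card m) p → ∀ i, (Function.update w k p i).PosSemidef := by
    intro w p hw hp i
    by_cases h : i = k
    · subst h; rw [Function.update_self]; exact hp.posSemidef
    · rw [Function.update_of_ne h]; exact (hw i).posSemidef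
  have hint : Integrable (fun z : (Matrix m n ℂ × (I → Matrix n n ℂ)) × (ι → Matrix n n ℂ) =>
      (K * (z.1.1 * bdProj l (Function.update z.2 k (psel z.1)) * z.1.1ᴴ)).trace)
      ((userLaw m n I).prod (Measure.pi fun _ : ι => projLaw m n)) := by
    have ht : Integrable (fun z : (Matrix m n ℂ × (I → Matrix n n ℂ)) × (ι → Matrix n n ℂ) =>
        (z.1.1 * z.1.1ᴴ).trace.re) ((userLaw m n I).prod (Measure.pi fun _ : ι => projLaw m n)) :=
      measurePreserving_fst.integrable_comp_of_integrable integrable_re_trace_userLaw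
    refine Integrable.mono' (ht.const_mul (∑ i, ∑ j, ‖K i j‖ * (∑ _b : n, ∑ _a : n, 1)))
      (hmeas.comp hupm).aestronglyMeasurable ?_
    filter_upwards [hae] with z hz
    exact norm_trace_quad_le K _ fun i j => norm_kerProj_apply_le_one
      (posSemidef_sum_erase (hups hz.2 (isProj_csel _ hz.1)) l) i j
  rw [integral_prod _ hint]
  -- The data of user `k` are held fixed and only the other users' subspaces are averaged, which
  -- turns the precoder projection into a multiple of `1 - psel y`.
  have hy : (fun y : Matrix m n ℂ × (I → Matrix n n ℂ) => ∫ w, (K * (y.1 * bdProj l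
      (Function.update w k (psel y)) * y.1ᴴ)).trace ∂(Measure.pi fun _ : ι => projLaw m n))
      =ᵐ[userLaw m n I] fun y =>
        ((Fintype.card m / (Fintype.card n - Fintype.card m) : ℝ) : ℂ) *
          (K * (y.1 * (1 - psel y) * y.1ᴴ)).trace := by
    filter_upwards [ae_isProj_userLaw hmn.le] with y hy
    have hyp : IsProj (Fintype.card m) (psel y) := isProj_csel _ hy.2
    have hc : ∀ i j, Integrable (fun w : ι → Matrix n n ℂ =>
        bdProj l (Function.update w k (psel y)) i j) (Measure.pi fun _ => projLaw m n) :=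
      fun i j => by
        refine Integrable.of_bound ((Measurable.bdProj measurable_update_left
          l).matrix_entry i j).aestronglyMeasurable 1 ?_
        filter_upwards [ae_isProj_pi_projLaw hmn.le] with w hw
        exact norm_kerProj_apply_le_one (posSemidef_sum_erase (hups hw hyp) l) i j
    simp_rw [← Matrix.mul_assoc K]
    rw [integral_trace_mul_mul hc, matIntegral_bdProj hcard hm hmn hkl hyp, Matrix.mul_smul,
      Matrix.smul_mul, trace_smul, smul_eq_mul]
  rw [integral_congr_ae hy, integral_const_mul, integral_quad_one_sub_psel hm hmn.le, ← mul_assoc,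
    ← Complex.ofReal_mul]
  congr 2
  have : (Fintype.card m : ℝ) ≠ 0 := Nat.cast_ne_zero.mpr hm.ne'
  field_simp

end Interference

/-! ### Received covariances, equality of signal laws, and Jensen's inequality. -/

section Gain

variable {m n ι I : Type*} [Fintype m] [Fintype n] [DecidableEq m] [DecidableEq n]
  [Fintype ι] [DecidableEq ι] [Fintype I] [LinearOrder I]

/-- The normalized received covariance `1 + c A G κ Gᴴ Aᴴ`. -/
noncomputable def recvCov (c : ℝ) (A : Matrix m m ℂ) (G : Matrix m n ℂ) (κ : Matrix n n ℂ) :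
    Matrix m m ℂ :=
  1 + (c : ℂ) • (A * (G * κ * Gᴴ) * Aᴴ)

variable {c : ℝ} {A : Matrix m m ℂ} {G : Matrix m n ℂ} {κ κ' : Matrix n n ℂ}

theorem posSemidef_smul_quad (hc : 0 ≤ c) (A : Matrix m m ℂ) (G : Matrix m n ℂ)
    (hκ : κ.PosSemidef) : ((c : ℂ) • (A * (G * κ * Gᴴ) * Aᴴ)).PosSemidef :=
  ((hκ.mul_mul_conjTranspose_same G).mul_mul_conjTranspose_same A).smul (by exact_mod_cast hc)

theorem recvCov_posDef (hc : 0 ≤ c) (hκ : κ.PosSemidef) : (recvCov c A G κ).PosDef :=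
  PosDef.one.add_posSemidef (posSemidef_smul_quad hc A G hκ)

theorem re_det_recvCov_le_add (hc : 0 ≤ c) (hκ : κ.PosSemidef) (hκ' : κ'.PosSemidef) :
    (recvCov c A G κ).det.re ≤ (recvCov c A G (κ + κ')).det.re := by
  refine re_det_le_re_det (recvCov_posDef hc hκ) (recvCov_posDef hc (hκ.add hκ')) ?_
  have : recvCov c A G (κ + κ') - recvCov c A G κ = (c : ℂ) • (A * (G * κ' * Gᴴ) * Aᴴ) := by
    simp only [recvCov, Matrix.mul_add, Matrix.add_mul, smul_add]
    abel
  rw [this]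
  exact posSemidef_smul_quad hc A G hκ'

theorem log_det_recvCov_nonneg (hc : 0 ≤ c) (hκ : κ.PosSemidef) :
    0 ≤ Real.log (recvCov c A G κ).det.re := by
  have h := re_det_recvCov_le_add (A := A) (G := G) hc (PosSemidef.zero (n := n) (R := ℂ)) hκ
  rw [zero_add] at h
  refine Real.log_nonneg (le_trans (le_of_eq ?_) h)
  simp [recvCov]

theorem log_det_recvCov_le (hc : 0 ≤ c) (hκ : κ.PosSemidef) :
    Real.log (recvCov c A G κ).det.re ≤ c * ‖(Aᴴ * A * (G * κ * Gᴴ)).trace‖ := by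
  refine (log_det_le_trace (recvCov_posDef hc hκ)).trans ?_
  rw [recvCov, trace_add, trace_one, trace_smul, smul_eq_mul, Complex.add_re, Complex.natCast_re,
    Complex.re_ofReal_mul, add_sub_cancel_left]
  refine mul_le_mul_of_nonneg_left ?_ hc
  rw [trace_mul_comm, ← Matrix.mul_assoc]
  exact Complex.re_le_norm _

theorem _root_.Measurable.log_det_recvCov {Ω : Type*} [MeasurableSpace Ω] {g : Ω → Matrix m n ℂ}
    {f : Ω → Matrix n n ℂ} (hg : Measurable g) (hf : Measurable f) (c : ℝ) (A : Matrix m m ℂ) :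
    Measurable fun x => Real.log (recvCov c A (g x) (f x)).det.re := by
  unfold recvCov
  exact Real.measurable_log.comp (Complex.measurable_re.comp (by fun_prop))

theorem integrable_log_det_recvCov (hc : 0 ≤ c) (A : Matrix m m ℂ) (k : ι)
    {f : (ι → Matrix m n ℂ × (I → Matrix n n ℂ)) → Matrix n n ℂ} (hf : Measurable f)
    {b : ℝ} (hae : ∀ᵐ y ∂(Measure.pi fun _ : ι => userLaw m n I), (f y).PosSemidef ∧
      ∀ i j, ‖f y i j‖ ≤ b) :
    Integrable (fun y => Real.log (recvCov c A (y k).1 (f y)).det.re)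
      (Measure.pi fun _ : ι => userLaw m n I) := by
  have ht : Integrable (fun y : ι → Matrix m n ℂ × (I → Matrix n n ℂ) =>
      ((y k).1 * (y k).1ᴴ).trace.re) (Measure.pi fun _ : ι => userLaw m n I) :=
    (measurePreserving_eval (fun _ : ι => userLaw m n I) k).integrable_comp_of_integrable
      integrable_re_trace_userLaw
  refine Integrable.mono' ((ht.const_mul (∑ i, ∑ j, ‖(Aᴴ * A) i j‖ *
    (∑ _b : n, ∑ _a : n, b))).const_mul c) (Measurable.log_det_recvCov
      (measurable_fst.comp (measurable_pi_apply k)) hf c A).aestronglyMeasurable ?_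
  filter_upwards [hae] with y hy
  rw [Real.norm_of_nonneg (log_det_recvCov_nonneg hc hy.1)]
  exact (log_det_recvCov_le hc hy.1).trans
    (mul_le_mul_of_nonneg_left (norm_trace_quad_le _ _ hy.2) hc)

/-- The precoders computed from true and from quantized channels have the same law given the
channel of the served user. -/
theorem integral_log_det_recvCov_eq [Nonempty I] (h : Fintype.card m ≤ Fintype.card n) (c : ℝ)
    (A : Matrix m m ℂ) (k : ι) :
    ∫ y, Real.log (recvCov c A (y k).1 (bdProj k fun j => proj (y j).1)).det.re
        ∂(Measure.pi fun _ : ι => userLaw m n I) =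
      ∫ y, Real.log (recvCov c A (y k).1 (bdProj k fun j => psel (y j))).det.re
        ∂(Measure.pi fun _ : ι => userLaw m n I) := by
  have hf : StronglyMeasurable fun z : (Matrix m n ℂ × (I → Matrix n n ℂ)) × (ι → Matrix n n ℂ) =>
      Real.log (recvCov c A z.1.1 (bdProj k z.2)).det.re :=
    (Measurable.log_det_recvCov (measurable_fst.comp measurable_fst)
      (measurable_snd.bdProj k) c A).stronglyMeasurable
  rw [integral_pi_userLaw_eq measurePreserving_fst_proj k hf,
    integral_pi_userLaw_eq (measurePreserving_psel h) k hf]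
  -- The two sides differ only in the subspace placed at position `k`, which `bdProj k` ignores.
  simp only [bdProj_update_self]

/-- Jensen's inequality for the interference covariance. -/
theorem integral_log_det_interference_le [Nonempty I]
    (hcard : Fintype.card ι * Fintype.card m = Fintype.card n)
    (hm : 0 < Fintype.card m) (hmn : Fintype.card m < Fintype.card n) (hc : 0 ≤ c)
    (A : Matrix m m ℂ) (k : ι)
    (hint : Integrable (fun y => Real.log (recvCov c A (y k).1
      (∑ l ∈ Finset.univ.erase k, bdProj l fun j => psel (y j))).det.re)
      (Measure.pi fun _ : ι => userLaw m n I)) :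
    ∫ y, Real.log (recvCov c A (y k).1
        (∑ l ∈ Finset.univ.erase k, bdProj l fun j => psel (y j))).det.re
        ∂(Measure.pi fun _ : ι => userLaw m n I) ≤
      Real.log (1 + ((c * Fintype.card n / Fintype.card m * meanDist m n I : ℝ) : ℂ) •
        (A * Aᴴ)).det.re := by
  have hι : 0 < Fintype.card ι := Fintype.card_pos_iff.mpr ⟨k⟩
  have hD := meanDist_nonneg (m := m) (n := n) (I := I) hmn.le
  set μ := (Measure.pi fun _ : ι => userLaw m n I) with hμ
  set b : ℝ := c * Fintype.card n / Fintype.card m * meanDist m n I with hb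
  have hb0 : 0 ≤ b := by positivity
  -- `B` is the mean of the interference covariance. Jensen's inequality is obtained by integrating
  -- the tangent-plane inequality at `B`; `K` is the weight for which the linear term becomes a
  -- trace against `G κ Gᴴ`.
  set B := 1 + (b : ℂ) • (A * Aᴴ) with hB
  have hBpos : B.PosDef := PosDef.one.add_posSemidef
    ((posSemidef_self_mul_conjTranspose A).smul (by exact_mod_cast hb0))
  set K := Aᴴ * B⁻¹ * A with hK
  have htr : ∀ (G : Matrix m n ℂ) (κ : Matrix n n ℂ), (B⁻¹ * recvCov c A G κ).trace =
      B⁻¹.trace + (c : ℂ) * (K * (G * κ * Gᴴ)).trace := fun G κ => by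
    rw [recvCov, Matrix.mul_add, Matrix.mul_one, trace_add, Matrix.mul_smul, trace_smul, smul_eq_mul,
      ← Matrix.mul_assoc, ← Matrix.mul_assoc, trace_mul_comm, hK]
    simp only [Matrix.mul_assoc]
  have hquad := fun l : ι => integrable_quad_bdProj (I := I) hcard k l K
  have hsum : ∀ y : ι → Matrix m n ℂ × (I → Matrix n n ℂ), (K * ((y k).1 *
      (∑ l ∈ Finset.univ.erase k, bdProj l fun j => psel (y j)) * (y k).1ᴴ)).trace =
      ∑ l ∈ Finset.univ.erase k, (K * ((y k).1 * (bdProj l fun j => psel (y j)) *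
        (y k).1ᴴ)).trace := fun y => by
    rw [Matrix.mul_sum, Matrix.sum_mul, Matrix.mul_sum, trace_sum]
  have hqint : Integrable (fun y : ι → Matrix m n ℂ × (I → Matrix n n ℂ) => (K * ((y k).1 *
      (∑ l ∈ Finset.univ.erase k, bdProj l fun j => psel (y j)) * (y k).1ᴴ)).trace) μ := by
    simp_rw [hsum]
    exact integrable_finsetSum _ fun l _ => hquad l
  have hm0 : (Fintype.card m : ℝ) ≠ 0 := Nat.cast_ne_zero.mpr hm.ne'
  have hnm : ((Fintype.card n : ℝ) - Fintype.card m) ≠ 0 := by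
    rw [sub_ne_zero]; exact_mod_cast hmn.ne'
  have hqval : ∫ y, (K * ((y k).1 * (∑ l ∈ Finset.univ.erase k, bdProj l fun j => psel (y j)) *
      (y k).1ᴴ)).trace ∂μ = ((Fintype.card n * meanDist m n I / Fintype.card m : ℝ) : ℂ) *
        K.trace := by
    simp_rw [hsum]
    rw [integral_finsetSum _ fun l _ => hquad l, Finset.sum_congr rfl fun l hl =>
      integral_quad_bdProj hcard hm hmn (Finset.ne_of_mem_erase hl).symm K, Finset.sum_const,
      Finset.card_erase_of_mem (Finset.mem_univ k), Finset.card_univ, nsmul_eq_mul, ← mul_assoc]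
    congr 1
    rw [← Complex.ofReal_natCast, ← Complex.ofReal_mul]
    congr 1
    -- There are `card ι - 1` interferers, and this count cancels the denominator `n - m` of the
    -- mean interference from each.
    have h1 : ((Fintype.card ι - 1 : ℕ) : ℝ) * Fintype.card m =
        Fintype.card n - Fintype.card m := by
      rw [Nat.cast_sub hι, ← hcard]; push_cast; ring
    field_simp
    linear_combination (Fintype.card n * meanDist m n I) * h1
  have hae := ae_pi_userLaw (I := I) hcard hι
  calc ∫ y, Real.log (recvCov c A (y k).1
        (∑ l ∈ Finset.univ.erase k, bdProj l fun j => psel (y j))).det.re ∂μ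
      ≤ ∫ y, (Real.log B.det.re + ((B⁻¹.trace + (c : ℂ) * (K * ((y k).1 *
        (∑ l ∈ Finset.univ.erase k, bdProj l fun j => psel (y j)) * (y k).1ᴴ)).trace).re -
          Fintype.card m)) ∂μ := by
        refine integral_mono_ae hint ?_ ?_
        · exact (integrable_const _).add
            ((((integrable_const _).add (hqint.const_mul _)).re).sub (integrable_const _))
        · filter_upwards [hae] with y hy
          rw [← htr]
          exact log_det_le_log_det_add (recvCov_posDef hc
            (Matrix.posSemidef_sum _ fun l _ => (hy.1 l).posSemidef)) hBpos
    _ = Real.log B.det.re := by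
        have hre : ∀ y : ι → Matrix m n ℂ × (I → Matrix n n ℂ), Real.log B.det.re +
            ((B⁻¹.trace + (c : ℂ) * (K * ((y k).1 * (∑ l ∈ Finset.univ.erase k, bdProj l
              fun j => psel (y j)) * (y k).1ᴴ)).trace).re - Fintype.card m) =
            (Real.log B.det.re + B⁻¹.trace.re - Fintype.card m) + c * (K * ((y k).1 *
              (∑ l ∈ Finset.univ.erase k, bdProj l fun j => psel (y j)) *
                (y k).1ᴴ)).trace.re := fun y => by
          rw [Complex.add_re, Complex.re_ofReal_mul]; ring
        simp_rw [hre]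
        have hqre : Integrable (fun y : ι → Matrix m n ℂ × (I → Matrix n n ℂ) => (K * ((y k).1 *
            (∑ l ∈ Finset.univ.erase k, bdProj l fun j => psel (y j)) *
              (y k).1ᴴ)).trace.re) μ := hqint.re
        rw [integral_add (integrable_const _) (hqre.const_mul c), integral_const,
          probReal_univ, one_smul, integral_const_mul]
        have h2 : ∫ y, (K * ((y k).1 * (∑ l ∈ Finset.univ.erase k, bdProj l
            fun j => psel (y j)) * (y k).1ᴴ)).trace.re ∂μ =
            Fintype.card n * meanDist m n I / Fintype.card m * K.trace.re := by
          rw [← Complex.re_ofReal_mul, ← hqval]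
          exact integral_re hqint
        rw [h2]
        have hu : IsUnit B.det := isUnit_iff_ne_zero.mpr hBpos.det_pos.ne'
        -- Since `tr (B⁻¹ B) = m`, the linear term of the tangent plane has mean zero.
        have h3 : B⁻¹.trace + (b : ℂ) * K.trace = Fintype.card m := by
          rw [← trace_one, ← nonsing_inv_mul _ hu]
          conv_rhs => rw [hB, Matrix.mul_add, Matrix.mul_one, trace_add, Matrix.mul_smul,
            trace_smul, smul_eq_mul, ← Matrix.mul_assoc, trace_mul_comm _ Aᴴ, ← Matrix.mul_assoc]
        have h4 := congrArg Complex.re h3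
        rw [Complex.add_re, Complex.re_ofReal_mul, Complex.natCast_re] at h4
        have h5 : c * (Fintype.card n * meanDist m n I / Fintype.card m * K.trace.re) =
            b * K.trace.re := by rw [hb]; ring
        linarith

end Gain

/-! ### Rates as functions of the user data, and the rate-loss bound. -/

section CanonicalRates

variable {m n ι I : Type*} [Fintype m] [Fintype n] [DecidableEq m] [DecidableEq n]
  [Fintype ι] [DecidableEq ι] [Fintype I] [LinearOrder I]

/-- The rate with perfect channel knowledge as a function of the user data. -/
noncomputable def dataRate (c : ℝ) (A : Matrix m m ℂ) (k : ι)
    (y : ι → Matrix m n ℂ × (I → Matrix n n ℂ)) : ℝ :=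
  Real.logb 2 (recvCov c A (y k).1 (bdProj k fun j => proj (y j).1)).det.re

/-- The rate with quantized channel knowledge as a function of the user data. -/
noncomputable def dataRateQ (c : ℝ) (A : Matrix m m ℂ) (k : ι)
    (y : ι → Matrix m n ℂ × (I → Matrix n n ℂ)) : ℝ :=
  Real.logb 2 ((recvCov c A (y k).1 (∑ l, bdProj l fun j => psel (y j))).det.re /
    (recvCov c A (y k).1 (∑ l ∈ Finset.univ.erase k, bdProj l fun j => psel (y j))).det.re)

variable {c : ℝ} {A : Matrix m m ℂ}

theorem measurable_psel_pi (j : ι) :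
    Measurable fun y : ι → Matrix m n ℂ × (I → Matrix n n ℂ) => psel (y j) :=
  measurable_psel.comp (measurable_pi_apply j)

theorem measurable_bdProj_psel (l : ι) :
    Measurable fun y : ι → Matrix m n ℂ × (I → Matrix n n ℂ) => bdProj l fun j => psel (y j) :=
  (measurable_pi_lambda _ measurable_psel_pi : Measurable
    fun (y : ι → Matrix m n ℂ × (I → Matrix n n ℂ)) j => psel (y j)).bdProj l

theorem measurable_bdProj_proj (l : ι) :
    Measurable fun y : ι → Matrix m n ℂ × (I → Matrix n n ℂ) => bdProj l fun j => proj (y j).1 :=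
  (measurable_pi_lambda _ fun j => (measurable_fst.comp (measurable_pi_apply j)).proj : Measurable
    fun (y : ι → Matrix m n ℂ × (I → Matrix n n ℂ)) j => proj (y j).1).bdProj l

theorem measurable_channel (k : ι) :
    Measurable fun y : ι → Matrix m n ℂ × (I → Matrix n n ℂ) => (y k).1 :=
  measurable_fst.comp (measurable_pi_apply k)

theorem measurable_dataRate (c : ℝ) (A : Matrix m m ℂ) (k : ι) :
    Measurable (dataRate c A k : (ι → Matrix m n ℂ × (I → Matrix n n ℂ)) → ℝ) :=
  (Measurable.log_det_recvCov (measurable_channel k) (measurable_bdProj_proj k) c A).div_const _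

theorem measurable_re_det_recvCov {Ω : Type*} [MeasurableSpace Ω] {g : Ω → Matrix m n ℂ}
    {f : Ω → Matrix n n ℂ} (hg : Measurable g) (hf : Measurable f) (c : ℝ) (A : Matrix m m ℂ) :
    Measurable fun x => (recvCov c A (g x) (f x)).det.re := by
  unfold recvCov
  exact Complex.measurable_re.comp (by fun_prop)

theorem measurable_dataRateQ (c : ℝ) (A : Matrix m m ℂ) (k : ι) :
    Measurable (dataRateQ c A k : (ι → Matrix m n ℂ × (I → Matrix n n ℂ)) → ℝ) := by
  have h : ∀ s : Finset ι, Measurable fun y : ι → Matrix m n ℂ × (I → Matrix n n ℂ) =>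
      (recvCov c A (y k).1 (∑ l ∈ s, bdProj l fun j => psel (y j))).det.re := fun s =>
    measurable_re_det_recvCov (measurable_channel k)
      (Measurable.matrix_sum _ fun l => measurable_bdProj_psel l) c A
  exact (Real.measurable_log.comp ((h _).div (h _))).div_const _

theorem integrable_log_det_sum_bdProj [Nonempty I]
    (hcard : Fintype.card ι * Fintype.card m = Fintype.card n) (hc : 0 ≤ c) (A : Matrix m m ℂ)
    (k : ι) (s : Finset ι) :
    Integrable (fun y => Real.log (recvCov c A (y k).1
      (∑ l ∈ s, bdProj l fun j => psel (y j))).det.re)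
      (Measure.pi fun _ : ι => userLaw m n I) := by
  refine integrable_log_det_recvCov hc A k
    (f := fun y => ∑ l ∈ s, bdProj l fun j => psel (y j)) (b := s.card)
    (Measurable.matrix_sum _ fun l => measurable_bdProj_psel l) ?_
  filter_upwards [ae_pi_userLaw hcard (Fintype.card_pos_iff.mpr ⟨k⟩)] with y hy
  refine ⟨Matrix.posSemidef_sum _ fun l _ => (hy.1 l).posSemidef, fun i j => ?_⟩
  rw [Matrix.sum_apply]
  refine (norm_sum_le _ _).trans ((Finset.sum_le_sum fun l _ =>
    (hy.1 l).norm_apply_le_one i j).trans ?_)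
  simp

theorem integrable_log_det_bdProj_proj [Nonempty I]
    (hcard : Fintype.card ι * Fintype.card m = Fintype.card n) (hc : 0 ≤ c) (A : Matrix m m ℂ)
    (k : ι) :
    Integrable (fun y => Real.log (recvCov c A (y k).1
      (bdProj k fun j => proj (y j).1)).det.re) (Measure.pi fun _ : ι => userLaw m n I) := by
  refine integrable_log_det_recvCov hc A k (f := fun y => bdProj k fun j => proj (y j).1) (b := 1)
    (measurable_bdProj_proj k) ?_
  filter_upwards [ae_pi_userLaw hcard (Fintype.card_pos_iff.mpr ⟨k⟩)] with y hy
  exact ⟨(hy.2 k).posSemidef, (hy.2 k).norm_apply_le_one⟩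

theorem integrable_dataRate [Nonempty I]
    (hcard : Fintype.card ι * Fintype.card m = Fintype.card n) (hc : 0 ≤ c) (A : Matrix m m ℂ)
    (k : ι) : Integrable (dataRate c A k) (Measure.pi fun _ : ι => userLaw m n I) :=
  (integrable_log_det_bdProj_proj hcard hc A k).div_const _

theorem dataRateQ_ae_eq [Nonempty I]
    (hcard : Fintype.card ι * Fintype.card m = Fintype.card n) (hc : 0 ≤ c) (A : Matrix m m ℂ)
    (k : ι) : dataRateQ c A k =ᵐ[Measure.pi fun _ : ι => userLaw m n I] fun y =>
      (Real.log (recvCov c A (y k).1 (∑ l, bdProj l fun j => psel (y j))).det.re -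
      Real.log (recvCov c A (y k).1 (∑ l ∈ Finset.univ.erase k,
        bdProj l fun j => psel (y j))).det.re) / Real.log 2 := by
  filter_upwards [ae_pi_userLaw hcard (Fintype.card_pos_iff.mpr ⟨k⟩)] with y hy
  have h : ∀ s : Finset ι, (recvCov c A (y k).1
      (∑ l ∈ s, bdProj l fun j => psel (y j))).det.re ≠ 0 := fun s =>
    (re_det_pos (recvCov_posDef hc (Matrix.posSemidef_sum _
      fun l _ => (hy.1 l).posSemidef))).ne'
  rw [dataRateQ, Real.logb, Real.log_div (h _) (h _)]

theorem integrable_dataRateQ [Nonempty I]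
    (hcard : Fintype.card ι * Fintype.card m = Fintype.card n) (hc : 0 ≤ c) (A : Matrix m m ℂ)
    (k : ι) : Integrable (dataRateQ c A k) (Measure.pi fun _ : ι => userLaw m n I) :=
  (((integrable_log_det_sum_bdProj hcard hc A k _).sub
    (integrable_log_det_sum_bdProj hcard hc A k _)).div_const _).congr
    (dataRateQ_ae_eq hcard hc A k).symm

/-- The bound on the mean rate loss in terms of the mean distortion. -/
theorem integral_dataRate_sub_le [Nonempty I]
    (hcard : Fintype.card ι * Fintype.card m = Fintype.card n)
    (hm : 0 < Fintype.card m) (hmn : Fintype.card m < Fintype.card n) (hc : 0 ≤ c)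
    (A : Matrix m m ℂ) (k : ι) :
    ∫ y, (dataRate c A k y - dataRateQ c A k y) ∂(Measure.pi fun _ : ι => userLaw m n I) ≤
      Real.logb 2 (1 + ((c * Fintype.card n / Fintype.card m * meanDist m n I : ℝ) : ℂ) •
        (A * Aᴴ)).det.re := by
  have h1 := integrable_log_det_bdProj_proj (I := I) hcard hc A k
  have hnum := integrable_log_det_sum_bdProj (I := I) hcard hc A k Finset.univ
  have hden := integrable_log_det_sum_bdProj (I := I) hcard hc A k (Finset.univ.erase k)
  have hself := integrable_log_det_sum_bdProj (I := I) hcard hc A k {k}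
  simp only [Finset.sum_singleton] at hself
  -- The interference is dropped from the numerator of the quantized rate, leaving the useful signal
  -- alone.
  have hmono : ∫ y, Real.log (recvCov c A (y k).1 (bdProj k fun j => psel (y j))).det.re
      ∂(Measure.pi fun _ : ι => userLaw m n I) ≤
      ∫ y, Real.log (recvCov c A (y k).1 (∑ l, bdProj l fun j => psel (y j))).det.re
        ∂(Measure.pi fun _ : ι => userLaw m n I) := by
    refine integral_mono_ae hself hnum ?_
    filter_upwards [ae_pi_userLaw hcard (Fintype.card_pos_iff.mpr ⟨k⟩)] with y hy
    have hk := (hy.1 k).posSemidef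
    refine Real.log_le_log (re_det_pos (recvCov_posDef hc hk)) ?_
    rw [← Finset.add_sum_erase _ _ (Finset.mem_univ k)]
    exact re_det_recvCov_le_add hc hk (Matrix.posSemidef_sum _ fun l _ => (hy.1 l).posSemidef)
  have hjensen := integral_log_det_interference_le hcard hm hmn hc A k hden
  -- The useful signals under true and quantized channel knowledge have equal mean rates and cancel;
  -- only the interference term survives.
  have hlaw := integral_log_det_recvCov_eq (m := m) (n := n) (I := I) hmn.le c A k
  have hlog2 : 0 < Real.log 2 := Real.log_pos one_lt_two
  rw [integral_sub (integrable_dataRate hcard hc A k) (integrable_dataRateQ hcard hc A k),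
    integral_congr_ae (dataRateQ_ae_eq hcard hc A k), integral_div, integral_sub hnum hden]
  simp only [dataRate, Real.logb]
  rw [integral_div, ← sub_div]
  gcongr
  linarith

end CanonicalRates

/-! ### Conditioning on the scheduled set. -/

section Conditioning

/-- Conditioning on an event determined by a finite-valued variable `S`, when the integrand is a
function of `S` and an independent variable `Y`. -/
theorem integrable_cond_and_integral_le {Ω F Z : Type*} [MeasurableSpace Ω] [MeasurableSpace F]
    [MeasurableSingletonClass F] [MeasurableSpace Z] [DecidableEq F] {μ : Measure Ω}
    [IsProbabilityMeasure μ] {S : Ω → F} {Y : Ω → Z} {ρ : Measure Z} (hS : Measurable S)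
    (hY : MeasurePreserving Y μ ρ) (hSY : IndepFun S Y μ) (t : Finset F)
    (hE : μ (S ⁻¹' t) ≠ 0) {f : Ω → ℝ} {φ : F → Z → ℝ} (hφ : ∀ T ∈ t, Measurable (φ T))
    (hint : ∀ T ∈ t, Integrable (φ T) ρ)
    (hf : ∀ᵐ ω ∂μ, S ω ∈ t → f ω = φ (S ω) (Y ω)) :
    Integrable f (cond μ (S ⁻¹' t)) ∧
      ∀ C : ℝ, (∀ T ∈ t, ∫ z, φ T z ∂ρ ≤ C) → ∫ ω, f ω ∂(cond μ (S ⁻¹' t)) ≤ C := by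
  have hEm : MeasurableSet (S ⁻¹' t) := hS t.measurableSet
  have hSm : ∀ T, MeasurableSet (S ⁻¹' {T}) := fun T => hS (measurableSet_singleton T)
  -- The function `f` is not assumed measurable. On the conditioning event it agrees almost
  -- everywhere with this finite sum over the values of `S`, and independence factors each summand.
  let g : Ω → ℝ := fun ω => ∑ T ∈ t, (S ⁻¹' {T}).indicator (fun ω => φ T (Y ω)) ω
  have hfg : f =ᵐ[μ.restrict (S ⁻¹' t)] g := by
    rw [EventuallyEq, ae_restrict_iff' hEm]
    filter_upwards [hf] with ω hω hmem
    have hmem' : S ω ∈ t := hmem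
    rw [hω hmem']
    simp only [g]
    rw [Finset.sum_eq_single (S ω)]
    · rw [Set.indicator_of_mem (by simp)]
    · intro T _ hT
      exact Set.indicator_of_notMem (fun h => hT (by simpa using h.symm)) _
    · exact fun h => absurd hmem' h
  have hφY : ∀ T ∈ t, Integrable (fun ω => φ T (Y ω)) μ := fun T hT =>
    hY.integrable_comp_of_integrable (hint T hT)
  have hgint : Integrable g μ :=
    integrable_finsetSum _ fun T hT => (hφY T hT).indicator (hSm T)
  refine ⟨?_, fun C hC => ?_⟩
  · exact ((hgint.restrict).congr hfg.symm).smul_measure (ENNReal.inv_ne_top.mpr hE)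
  · have h1 : ∫ ω in S ⁻¹' t, g ω ∂μ = ∑ T ∈ t, μ.real (S ⁻¹' {T}) * ∫ z, φ T z ∂ρ := by
      simp only [g]
      rw [integral_finsetSum _ fun T hT => ((hφY T hT).indicator (hSm T)).restrict]
      refine Finset.sum_congr rfl fun T hT => ?_
      have hsub : S ⁻¹' (t : Set F) ∩ S ⁻¹' {T} = S ⁻¹' {T} :=
        Set.inter_eq_right.mpr (Set.preimage_mono (by simpa using hT))
      rw [setIntegral_indicator (hSm T), hsub, ← integral_indicator (hSm T)]
      have hmul : ∀ ω, (S ⁻¹' {T}).indicator (fun ω => φ T (Y ω)) ω =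
          (S ⁻¹' {T}).indicator 1 ω * φ T (Y ω) := fun ω => by
        by_cases h : ω ∈ S ⁻¹' {T} <;> simp [h]
      have hind : IndepFun (fun ω => (S ⁻¹' {T}).indicator (1 : Ω → ℝ) ω)
          (fun ω => φ T (Y ω)) μ :=
        hSY.comp (φ := Set.indicator {T} (1 : F → ℝ)) (ψ := φ T)
          (measurable_one.indicator (measurableSet_singleton T)) (hφ T hT)
      simp_rw [hmul]
      rw [hind.integral_fun_mul_eq_mul_integral
        (measurable_one.indicator (hSm T)).aestronglyMeasurable
        (hφY T hT).aestronglyMeasurable, integral_indicator_one (hSm T), ← hY.map_eq,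
        integral_map hY.measurable.aemeasurable (hφ T hT).aestronglyMeasurable]
    have h2 : ∫ ω, f ω ∂(cond μ (S ⁻¹' t)) =
        (μ.real (S ⁻¹' t))⁻¹ * ∫ ω in S ⁻¹' t, g ω ∂μ := by
      rw [ProbabilityTheory.cond, integral_smul_measure, integral_congr_ae hfg, smul_eq_mul, ENNReal.toReal_inv]
      rfl
    have hpos : 0 < μ.real (S ⁻¹' t) := ENNReal.toReal_pos hE (measure_ne_top _ _)
    rw [h2, h1, inv_mul_le_iff₀ hpos,
      ← sum_measureReal_preimage_singleton t fun T _ => hSm T, Finset.sum_mul]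
    exact Finset.sum_le_sum fun T hT => mul_le_mul_of_nonneg_left (hC T hT) measureReal_nonneg

end Conditioning

/-! ### Identification of the precoders. -/

section Precoders

variable {K M N : ℕ}

/-- Zero interference and the dimension count determine the range of `W`, hence `W Wᴴ`. The
remaining freedom, a unitary factor on the right of `W`, does not affect the rates, which involve
only this product. -/
theorem mul_conjTranspose_eq_bdProj {ι : Type*} [Fintype ι] [DecidableEq ι]
    {W : Matrix (Fin N) (Fin M) ℂ} {p : ι → Matrix (Fin N) (Fin N) ℂ} {k : ι}
    (hp : ∀ i, (p i).PosSemidef) (hE : IsProj M (bdProj k p)) (hW : Wᴴ * W = 1)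
    (h : ∀ l, l ≠ k → p l * W = 0) : W * Wᴴ = bdProj k p := by
  have hq : IsProj M (W * Wᴴ) := by simpa using IsProj.of_conjTranspose_mul_self hW
  refine hq.eq_kerProj (posSemidef_sum_erase hp k) hE ?_
  rw [Matrix.sum_mul]
  refine Finset.sum_eq_zero fun l hl => ?_
  rw [← Matrix.mul_assoc, h l (Finset.ne_of_mem_erase hl), Matrix.zero_mul]

theorem one_add_sum_eq_recvCov (P : ℝ) (S s : Finset (Fin K)) (A : Matrix (Fin M) (Fin M) ℂ)
    (G : Matrix (Fin M) (Fin N) ℂ) (W : Fin K → Matrix (Fin N) (Fin M) ℂ) :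
    1 + ∑ l ∈ s, A * G * W l * equalPower M P S * (W l)ᴴ * (A * G)ᴴ =
      recvCov (P / ((M : ℝ) * (S.card : ℝ))) A G (∑ l ∈ s, W l * (W l)ᴴ) := by
  rw [recvCov]
  congr 1
  rw [Matrix.mul_sum, Matrix.sum_mul, Matrix.mul_sum, Matrix.sum_mul, Finset.smul_sum]
  refine Finset.sum_congr rfl fun l _ => ?_
  rw [equalPower, Matrix.mul_smul, Matrix.mul_one, Matrix.smul_mul, Matrix.smul_mul,
    conjTranspose_mul]
  simp only [Matrix.mul_assoc]

theorem sum_sdiff_singleton_eq {X : Type*} [AddCommGroup X] (S : Finset (Fin K)) {k : Fin K}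
    (hk : k ∈ S) (f : Fin K → X) :
    ∑ l ∈ S \ {k}, f l = ∑ l ∈ Finset.univ.erase (⟨k, hk⟩ : S), f l := by
  rw [Finset.sdiff_singleton_eq_erase, Finset.sum_erase_eq_sub hk,
    Finset.sum_erase_eq_sub (Finset.mem_univ _), Finset.sum_coe_sort S f]

variable {H : Fin K → Matrix (Fin M) (Fin N) ℂ} {A : Matrix (Fin M) (Fin M) ℂ}
  {I : Type*} [Fintype I] [LinearOrder I] {S : Finset (Fin K)}
  {y : Fin K → Matrix (Fin M) (Fin N) ℂ × (I → Matrix (Fin N) (Fin N) ℂ)} {k : Fin K}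

theorem rateBD_eq_dataRate (P : ℝ) (hk : k ∈ S) (hH : H k = A * (y k).1)
    {W : Fin K → Matrix (Fin N) (Fin M) ℂ} (hW : IsBDPrecoder H S W)
    (hy : ∀ l, ((y l).1 * (y l).1ᴴ).det ≠ 0) (hp : ∀ l, proj (H l) = proj (y l).1)
    (hE : IsProj M (bdProj (⟨k, hk⟩ : S) fun j => proj (y j).1)) :
    rateBD P H S W k = dataRate (P / ((M : ℝ) * (S.card : ℝ))) A (⟨k, hk⟩ : S)
      (fun l : S => y l) := by
  have hWk : W k * (W k)ᴴ = bdProj (⟨k, hk⟩ : S) fun j => proj (y j).1 := by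
    refine mul_conjTranspose_eq_bdProj (fun i => (isProj_proj (hy i)).posSemidef) hE
      (hW k hk).1 fun l hl => ?_
    have hl' : (l : Fin K) ∈ S \ {k} := by
      rw [Finset.mem_sdiff, Finset.mem_singleton]
      exact ⟨l.2, fun h => hl (Subtype.ext h)⟩
    rw [← hp l, proj, Matrix.mul_assoc, (hW k hk).2 l hl', Matrix.mul_zero]
  have h := one_add_sum_eq_recvCov P S {k} A (y k).1 W
  rw [Finset.sum_singleton, Finset.sum_singleton, hWk] at h
  rw [rateBD, hH, h, dataRate]

theorem rateBDQ_eq_dataRateQ (P : ℝ) (hk : k ∈ S) (hH : H k = A * (y k).1)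
    {U W : Fin K → Matrix (Fin N) (Fin M) ℂ} (hW : IsBDPrecoder (fun l => (U l)ᴴ) S W)
    (hU : ∀ l, U l * (U l)ᴴ = psel (y l)) (hp : ∀ l, (psel (y l)).PosSemidef)
    (hE : ∀ l : S, IsProj M (bdProj l fun j => psel (y j))) :
    rateBDQ P H S W k = dataRateQ (P / ((M : ℝ) * (S.card : ℝ))) A (⟨k, hk⟩ : S)
      (fun l : S => y l) := by
  have hWl : ∀ l : S, W l * (W l)ᴴ = bdProj l fun j => psel (y j) := fun l => by
    refine mul_conjTranspose_eq_bdProj (fun i => hp i) (hE l) (hW l l.2).1 fun j hj => ?_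
    have hj' : (j : Fin K) ∈ S \ {(l : Fin K)} := by
      rw [Finset.mem_sdiff, Finset.mem_singleton]
      exact ⟨j.2, fun h => hj (Subtype.ext h)⟩
    rw [← hU j, Matrix.mul_assoc, (hW l l.2).2 j hj', Matrix.mul_zero]
  rw [rateBDQ, hH, one_add_sum_eq_recvCov, one_add_sum_eq_recvCov, sum_sdiff_singleton_eq S hk,
    ← Finset.sum_coe_sort S, dataRateQ]
  simp_rw [hWl]

end Precoders

/-! ### Transfer to the communication system. -/

namespace BDSystem

variable {M N K B : ℕ} {Ω : Type*} [MeasurableSpace Ω] {μ : Measure Ω} [IsProbabilityMeasure μ]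

/-- The data of all users: uncorrelated channels and projections of the codewords. -/
noncomputable def userData (s : BDSystem M N K B μ) (ω : Ω) (k : Fin K) :
    Matrix (Fin M) (Fin N) ℂ × (Fin (2 ^ B) → Matrix (Fin N) (Fin N) ℂ) :=
  (s.Hw k ω, fun i => s.U k i ω * (s.U k i ω)ᴴ)

theorem measurePreserving_Hw (s : BDSystem M N K B μ) :
    MeasurePreserving (fun ω k => s.Hw k ω) μ
      (Measure.pi fun _ : Fin K => gaussMat (Fin M) (Fin N)) := by
  have hent : ∀ p : Fin K × Fin M × Fin N, Measurable fun ω => s.Hw p.1 ω p.2.1 p.2.2 :=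
    fun p => (s.Hw_meas p.1).matrix_entry _ _
  have h : MeasurePreserving (fun ω (p : Fin K × Fin M × Fin N) => s.Hw p.1 ω p.2.1 p.2.2) μ
      (gauss (Fin K × Fin M × Fin N)) := by
    refine ⟨measurable_pi_lambda _ hent, ?_⟩
    rw [s.Hw_indep.map_fun_eq_pi_map fun p => (hent p).aemeasurable, gauss]
    congr 1
    funext p
    exact (s.Hw_law p.1 p.2.1 p.2.2).map_eq
  exact measurePreserving_pi_gaussMat.comp h

theorem measurePreserving_codewordProj (s : BDSystem M N K B μ) (hMN : M ≤ N) :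
    MeasurePreserving (fun ω k i => s.U k i ω * (s.U k i ω)ᴴ) μ
      (Measure.pi fun _ : Fin K => Measure.pi fun _ : Fin (2 ^ B) =>
        projLaw (Fin M) (Fin N)) := by
  have hm : ∀ p : Fin K × Fin (2 ^ B), Measurable fun ω => s.U p.1 p.2 ω * (s.U p.1 p.2 ω)ᴴ :=
    fun p => (s.U_meas p.1 p.2).matrix_mul (s.U_meas p.1 p.2).matrix_conjTranspose
  have hg : Measurable fun X : Matrix (Fin N) (Fin M) ℂ => X * Xᴴ := by fun_prop
  have h : MeasurePreserving (fun ω (p : Fin K × Fin (2 ^ B)) =>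
      s.U p.1 p.2 ω * (s.U p.1 p.2 ω)ᴴ) μ
      (Measure.pi fun _ : Fin K × Fin (2 ^ B) => projLaw (Fin M) (Fin N)) := by
    refine ⟨measurable_pi_lambda _ hm, ?_⟩
    have hind := s.U_indep.comp (fun _ X => X * Xᴴ) fun _ => hg
    refine (hind.map_fun_eq_pi_map fun p => (hm p).aemeasurable).trans ?_
    congr 1
    funext p
    rw [← (s.U_law p.1 p.2).map_eq_projLaw hMN, Measure.map_map hg (s.U_meas p.1 p.2)]
    rfl
  exact (measurePreserving_curry (projLaw (Fin M) (Fin N))).comp h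

theorem measurePreserving_userData (s : BDSystem M N K B μ) (hMN : M ≤ N) :
    MeasurePreserving s.userData μ
      (Measure.pi fun _ : Fin K => userLaw (Fin M) (Fin N) (Fin (2 ^ B))) := by
  have h1 := s.measurePreserving_Hw
  have h2 := s.measurePreserving_codewordProj hMN
  have hφ : Measurable fun (X : Fin K → Fin (2 ^ B) → Matrix (Fin N) (Fin M) ℂ) k i =>
      X k i * (X k i)ᴴ := by
    refine measurable_pi_lambda _ fun k => measurable_pi_lambda _ fun i => ?_
    have : Measurable fun X : Fin K → Fin (2 ^ B) → Matrix (Fin N) (Fin M) ℂ => X k i :=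
      (measurable_pi_apply i).comp (measurable_pi_apply k)
    exact this.matrix_mul this.matrix_conjTranspose
  have hind : IndepFun (fun ω k => s.Hw k ω) (fun ω k i => s.U k i ω * (s.U k i ω)ᴴ) μ :=
    s.Hw_U_indep.comp measurable_id hφ
  have hpair : MeasurePreserving (fun ω => ((fun k => s.Hw k ω),
      fun k i => s.U k i ω * (s.U k i ω)ᴴ)) μ
      ((Measure.pi fun _ : Fin K => gaussMat (Fin M) (Fin N)).prod
        (Measure.pi fun _ : Fin K => Measure.pi fun _ : Fin (2 ^ B) =>
          projLaw (Fin M) (Fin N))) := by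
    refine ⟨h1.measurable.prodMk h2.measurable, ?_⟩
    rw [hind.map_prod_eq_prod_map_map h1.measurable.aemeasurable h2.measurable.aemeasurable,
      h1.map_eq, h2.map_eq]
  exact ((measurePreserving_arrowProdEquivProdArrow _ _ (Fin K)
    (fun _ => gaussMat (Fin M) (Fin N)) (fun _ => Measure.pi fun _ : Fin (2 ^ B) =>
      projLaw (Fin M) (Fin N))).symm _).comp hpair

theorem indepFun_S_userData (s : BDSystem M N K B μ) : IndepFun s.S s.userData μ := by
  have hφ : Measurable fun (X : (Fin K → Matrix (Fin M) (Fin N) ℂ) ×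
      (Fin K → Fin (2 ^ B) → Matrix (Fin N) (Fin M) ℂ)) (k : Fin K) =>
      (X.1 k, fun i => X.2 k i * (X.2 k i)ᴴ) := by
    refine measurable_pi_lambda _ fun k => ((measurable_pi_apply k).comp measurable_fst).prodMk
      (measurable_pi_lambda _ fun i => ?_)
    have : Measurable fun X : (Fin K → Matrix (Fin M) (Fin N) ℂ) ×
        (Fin K → Fin (2 ^ B) → Matrix (Fin N) (Fin M) ℂ) => X.2 k i :=
      (measurable_pi_apply i).comp ((measurable_pi_apply k).comp measurable_snd)
    exact this.matrix_mul this.matrix_conjTranspose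
  exact s.S_indep.comp measurable_id hφ

theorem det_Rsqrt_ne_zero (s : BDSystem M N K B μ) (k : Fin K) : (s.Rsqrt k).det ≠ 0 := by
  intro h
  have h1 := (s.R_posDef k).det_pos.ne'
  rw [← s.Rsqrt_mul k, det_mul, h, zero_mul] at h1
  exact h1 rfl

theorem proj_H (s : BDSystem M N K B μ) (ω : Ω) (k : Fin K) :
    proj (s.H ω k) = proj (s.userData ω k).1 :=
  proj_mul_left (s.det_Rsqrt_ne_zero k) _

theorem ae_isProj_userData (s : BDSystem M N K B μ) (hMN : M ≤ N) :
    ∀ᵐ ω ∂μ, ∀ k, ((s.userData ω k).1 * (s.userData ω k).1ᴴ).det ≠ 0 ∧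
      ∀ i, IsProj M ((s.userData ω k).2 i) := by
  rw [ae_all_iff]
  intro k
  have h := ((measurePreserving_eval (fun _ : Fin K => userLaw (Fin M) (Fin N) (Fin (2 ^ B)))
    k).comp (s.measurePreserving_userData hMN)).quasiMeasurePreserving.ae
      (ae_isProj_userLaw (by simpa using hMN))
  simpa using h

/-- The squared chordal distance in terms of the user data. -/
theorem ae_chordalDist_sq (s : BDSystem M N K B μ) (hMN : M ≤ N) :
    ∀ᵐ ω ∂μ, ∀ k i, chordalDist (s.H ω k) (s.U k i ω) ^ 2 =
      (M : ℝ) - (proj (s.userData ω k).1 * (s.userData ω k).2 i).trace.re := by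
  filter_upwards [s.ae_isProj_userData hMN] with ω hω k i
  have hp : IsProj M (proj (s.userData ω k).1) := by simpa using isProj_proj (hω k).1
  have h := s.proj_H ω k
  rw [chordalDist, Real.sq_sqrt]
  · rw [← h]; rfl
  · have := (hp.re_trace_mul_mem ((hω k).2 i)).1
    rw [← h] at this
    exact this

/-- The fed back codeword spans the space selected by `psel`. -/
theorem ae_Hbar_mul_conjTranspose (s : BDSystem M N K B μ) (hMN : M ≤ N) :
    ∀ᵐ ω ∂μ, ∀ k, s.Hbar ω k * (s.Hbar ω k)ᴴ = psel (s.userData ω k) := by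
  have htie : ∀ᵐ ω ∂μ, ∀ k, ∀ i j, (proj (s.userData ω k).1 * (s.userData ω k).2 i).trace.re =
      (proj (s.userData ω k).1 * (s.userData ω k).2 j).trace.re →
        (s.userData ω k).2 i = (s.userData ω k).2 j := by
    rw [ae_all_iff]
    intro k
    exact ((measurePreserving_eval (fun _ : Fin K => userLaw (Fin M) (Fin N) (Fin (2 ^ B)))
      k).comp (s.measurePreserving_userData hMN)).quasiMeasurePreserving.ae
        (ae_eq_of_trace_eq (by simpa using hMN))
  filter_upwards [htie, s.ae_chordalDist_sq hMN, s.sel_min] with ω h1 h2 h3 k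
  obtain ⟨i, hi, hmax⟩ := exists_csel_eq (proj (s.userData ω k).1) (s.userData ω k).2
  rw [psel, hi]
  -- The system's minimizer and the first maximizer have equal overlap with the channel, so almost
  -- surely they span the same space, however ties are broken.
  refine h1 k (s.sel k ω) i (le_antisymm (hmax _) ?_)
  have h4 : chordalDist (s.H ω k) (s.U k (s.sel k ω) ω) ^ 2 ≤
      chordalDist (s.H ω k) (s.U k i ω) ^ 2 :=
    pow_le_pow_left₀ (Real.sqrt_nonneg _) (h3 k i) 2
  rw [h2, h2] at h4
  linarith

theorem meanDist_eq (hMN : M ≤ N) (B : ℕ) :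
    meanDist (Fin M) (Fin N) (Fin (2 ^ B)) = meanDistortion M N B := by
  have h := integral_dist_psel (I := Fin (2 ^ B)) hMN
  rw [Fintype.card_fin] at h
  rw [meanDist, meanDistortion, ← h, Fintype.card_fin]

theorem integral_chordalDist_sq (s : BDSystem M N K B μ) (hMN : M ≤ N) (k : Fin K) :
    Integrable (fun ω => chordalDist (s.H ω k) (s.Hbar ω k) ^ 2) μ ∧
      meanDistortion M N B = ∫ ω, chordalDist (s.H ω k) (s.Hbar ω k) ^ 2 ∂μ := by
  have hmp := (measurePreserving_eval (fun _ : Fin K => userLaw (Fin M) (Fin N) (Fin (2 ^ B)))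
    k).comp (s.measurePreserving_userData hMN)
  have heq : (fun ω => chordalDist (s.H ω k) (s.Hbar ω k) ^ 2) =ᵐ[μ] fun ω =>
      (Fintype.card (Fin M) : ℝ) -
        (proj (s.userData ω k).1 * psel (s.userData ω k)).trace.re := by
    filter_upwards [s.ae_chordalDist_sq hMN, s.ae_Hbar_mul_conjTranspose hMN] with ω h1 h2
    rw [← h2 k, Fintype.card_fin]
    exact h1 k (s.sel k ω)
  have hint := integrable_dist_psel (m := Fin M) (n := Fin N) (I := Fin (2 ^ B))
    (by simpa using hMN)
  refine ⟨(hmp.integrable_comp_of_integrable hint).congr heq.symm, ?_⟩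
  rw [integral_congr_ae heq, ← meanDist_eq hMN, meanDist, ← hmp.map_eq,
    integral_map hmp.measurable.aemeasurable]
  · rfl
  · rw [hmp.map_eq]; exact hint.aestronglyMeasurable

/-- For each admissible scheduled set `T` the rates are those of the canonical problem on the users
in `T`, where `M * T.card = N` makes the power per stream `P / N`. The bound is the same for all
`T`, so it survives averaging over the independent scheduling. -/
theorem rate_loss (s : BDSystem M N K B μ) (hM : 1 ≤ M) (hMN : M < N) (hdvd : M ∣ N) (k : Fin K)
    {P : ℝ} (hP : 0 ≤ P) (hk : μ {ω | k ∈ s.S ω} ≠ 0) :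
    Integrable (s.g P k) (ProbabilityTheory.cond μ {ω | k ∈ s.S ω}) ∧
      Integrable (s.gQ P k) (ProbabilityTheory.cond μ {ω | k ∈ s.S ω}) ∧
      ∫ ω, (s.g P k ω - s.gQ P k ω) ∂(ProbabilityTheory.cond μ {ω | k ∈ s.S ω}) ≤
        Real.logb 2 (1 + (((P / M) * meanDistortion M N B : ℝ) : ℂ) • s.R k).det.re := by
  classical
  have hm : 0 < Fintype.card (Fin M) := by rw [Fintype.card_fin]; exact hM
  have hmn : Fintype.card (Fin M) < Fintype.card (Fin N) := by simpa using hMN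
  have hM0 : (M : ℝ) ≠ 0 := Nat.cast_ne_zero.mpr (by omega)
  have hN0 : (N : ℝ) ≠ 0 := Nat.cast_ne_zero.mpr (by omega)
  set A := s.Rsqrt k
  set c : ℝ := P / N with hc
  have hc0 : 0 ≤ c := by positivity
  set t : Finset (Finset (Fin K)) := Finset.univ.filter fun T => k ∈ T ∧ T.card = N / M with ht
  have hcard : ∀ T ∈ t, Fintype.card T * Fintype.card (Fin M) = Fintype.card (Fin N) :=
    fun T hT => by
      rw [Fintype.card_coe, (Finset.mem_filter.mp hT).2.2, Fintype.card_fin, Fintype.card_fin,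
        Nat.div_mul_cancel hdvd]
  have hpow : ∀ T ∈ t, P / ((M : ℝ) * (T.card : ℝ)) = c := fun T hT => by
    have := hcard T hT
    simp only [Fintype.card_coe, Fintype.card_fin] at this
    rw [hc, ← this]; push_cast; rw [mul_comm]
  have hmemt : ∀ ω, s.S ω ∈ t ↔ k ∈ s.S ω := fun ω => by
    simp [ht, s.S_card ω]
  have hset : {ω | k ∈ s.S ω} = s.S ⁻¹' t := by
    ext ω; exact (hmemt ω).symm
  rw [hset] at hk ⊢
  let Y := Matrix (Fin M) (Fin N) ℂ × (Fin (2 ^ B) → Matrix (Fin N) (Fin N) ℂ)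
  let φ : Finset (Fin K) → (Fin K → Y) → ℝ := fun T y =>
    if h : k ∈ T then dataRate c A (⟨k, h⟩ : T) (fun l : T => y l) else 0
  let φQ : Finset (Fin K) → (Fin K → Y) → ℝ := fun T y =>
    if h : k ∈ T then dataRateQ c A (⟨k, h⟩ : T) (fun l : T => y l) else 0
  have hrestr : ∀ T : Finset (Fin K), MeasurePreserving (fun (y : Fin K → Y) (l : T) => y l)
      (Measure.pi fun _ => userLaw (Fin M) (Fin N) (Fin (2 ^ B)))
      (Measure.pi fun _ => userLaw (Fin M) (Fin N) (Fin (2 ^ B))) := fun T =>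
    measurePreserving_pi_comp _ Subtype.val_injective
  have hφm : ∀ T ∈ t, Measurable (φ T) := fun T hT => by
    have h := (Finset.mem_filter.mp hT).2.1
    simp only [φ, h, dif_pos]
    exact (measurable_dataRate c A _).comp (hrestr T).measurable
  have hφQm : ∀ T ∈ t, Measurable (φQ T) := fun T hT => by
    have h := (Finset.mem_filter.mp hT).2.1
    simp only [φQ, h, dif_pos]
    exact (measurable_dataRateQ c A _).comp (hrestr T).measurable
  have hφi : ∀ T ∈ t, Integrable (φ T)
      (Measure.pi fun _ => userLaw (Fin M) (Fin N) (Fin (2 ^ B))) := fun T hT => by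
    have h := (Finset.mem_filter.mp hT).2.1
    simp only [φ, h, dif_pos]
    exact (hrestr T).integrable_comp_of_integrable (integrable_dataRate (hcard T hT) hc0 A _)
  have hφQi : ∀ T ∈ t, Integrable (φQ T)
      (Measure.pi fun _ => userLaw (Fin M) (Fin N) (Fin (2 ^ B))) := fun T hT => by
    have h := (Finset.mem_filter.mp hT).2.1
    simp only [φQ, h, dif_pos]
    exact (hrestr T).integrable_comp_of_integrable (integrable_dataRateQ (hcard T hT) hc0 A _)
  have hY := s.measurePreserving_userData hMN.le
  have hae : ∀ᵐ ω ∂μ, ∀ T ∈ t,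
      (∀ l : T, IsProj M (bdProj l fun j : T => psel (s.userData ω j))) ∧
      ∀ l : T, IsProj M (bdProj l fun j : T => proj (s.userData ω j).1) := by
    rw [ae_all_iff]
    intro T
    by_cases hT : T ∈ t
    · have h := ((hrestr T).comp hY).quasiMeasurePreserving.ae
        (ae_pi_userLaw (hcard T hT) (by
          rw [Fintype.card_coe]; exact Finset.card_pos.mpr ⟨k, (Finset.mem_filter.mp hT).2.1⟩))
      rw [Fintype.card_fin] at h
      exact h.mono fun ω hω _ => hω
    · exact Eventually.of_forall fun ω h => absurd h hT
  have hgood := s.ae_isProj_userData hMN.le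
  have hf : ∀ᵐ ω ∂μ, s.S ω ∈ t → s.g P k ω = φ (s.S ω) (s.userData ω) := by
    filter_upwards [hae, hgood, s.W_bd] with ω h1 h2 h3 hmem
    have hkS := (hmemt ω).mp hmem
    simp only [φ, hkS, dif_pos]
    rw [← hpow _ hmem]
    exact rateBD_eq_dataRate P hkS rfl h3 (fun l => (h2 l).1) (s.proj_H ω) ((h1 _ hmem).2 _)
  have hfQ : ∀ᵐ ω ∂μ, s.S ω ∈ t → s.gQ P k ω = φQ (s.S ω) (s.userData ω) := by
    filter_upwards [hae, hgood, s.Wq_bd, s.ae_Hbar_mul_conjTranspose hMN.le]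
      with ω h1 h2 h3 h4 hmem
    have hkS := (hmemt ω).mp hmem
    simp only [φQ, hkS, dif_pos]
    rw [← hpow _ hmem]
    exact rateBDQ_eq_dataRateQ P hkS rfl h3 h4 (fun l => (isProj_csel _ (h2 l).2).posSemidef)
      (h1 _ hmem).1
  have hind := s.indepFun_S_userData
  refine ⟨(integrable_cond_and_integral_le s.S_meas hY hind t hk hφm hφi hf).1,
    (integrable_cond_and_integral_le s.S_meas hY hind t hk hφQm hφQi hfQ).1, ?_⟩
  refine (integrable_cond_and_integral_le s.S_meas hY hind t hk
    (φ := fun T y => φ T y - φQ T y) (fun T hT => (hφm T hT).sub (hφQm T hT))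
    (fun T hT => (hφi T hT).sub (hφQi T hT)) ?_).2 _ fun T hT => ?_
  · filter_upwards [hf, hfQ] with ω h1 h2 hmem
    rw [h1 hmem, h2 hmem]
  · have h := (Finset.mem_filter.mp hT).2.1
    simp only [φ, φQ, h, dif_pos]
    have hle := integral_dataRate_sub_le (I := Fin (2 ^ B)) (hcard T hT) hm hmn hc0 A
      (⟨k, h⟩ : T)
    rw [meanDist_eq hMN.le, Fintype.card_fin, Fintype.card_fin, s.Rsqrt_mul k] at hle
    have hconst : c * N / M * meanDistortion M N B = P / M * meanDistortion M N B := by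
      rw [hc, div_mul_cancel₀ _ hN0]
    rw [hconst, ← (hrestr T).map_eq, integral_map (hrestr T).measurable.aemeasurable
      (f := fun y => dataRate c A (⟨k, h⟩ : T) y - dataRateQ c A (⟨k, h⟩ : T) y)
      ((measurable_dataRate c A _).sub (measurable_dataRateQ c A _)).aestronglyMeasurable] at hle
    exact hle

end BDSystem

end BlockDiag

/-! ### The main theorem. -/

theorem theorem3 (M N : ℕ) (hM : 1 ≤ M) (hMN : M < N) (hdvd : M ∣ N) :
    ∃ D : ℕ → ℝ,
      (∀ (B K : ℕ) (Ω : Type*) (_ : MeasurableSpace Ω) (μ : Measure Ω)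
          (_ : IsProbabilityMeasure μ) (s : BlockDiag.BDSystem M N K B μ) (k : Fin K),
        (Integrable (fun ω => BlockDiag.chordalDist (s.H ω k) (s.Hbar ω k) ^ 2) μ ∧
          D B = ∫ ω, BlockDiag.chordalDist (s.H ω k) (s.Hbar ω k) ^ 2 ∂μ) ∧
        ∀ P : ℝ, 0 ≤ P → μ {ω | k ∈ s.S ω} ≠ 0 →
          Integrable (s.g P k) (cond μ {ω | k ∈ s.S ω}) ∧
          Integrable (s.gQ P k) (cond μ {ω | k ∈ s.S ω}) ∧
          ∫ ω, (s.g P k ω - s.gQ P k ω) ∂(cond μ {ω | k ∈ s.S ω}) ≤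
            Real.logb 2 (1 + (((P / M) * D B : ℝ) : ℂ) • s.R k).det.re) ∧
      D ~[atTop] (fun B => BlockDiag.distortionApprox M N B) :=
  ⟨BlockDiag.meanDistortion M N, fun _ _ _ _ _ _ s k =>
    ⟨s.integral_chordalDist_sq hMN.le k, fun _ hP hk => s.rate_loss hM hMN hdvd k hP hk⟩,
    BlockDiag.meanDistortion_isEquivalent hM hMN⟩
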